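/- Let $F$ be a non-archimedean local field of characteristic $0$ with odd residual characteristic, $\mathcal O$ its ring of integers, $\mathfrak p$ the maximal ideal, $q=\#(\mathcal O/\mathfrak p)$, $|\cdot|$ the absolute value with $|\varpi|=q^{-1}$ for a uniformizer $\varpi$, and $(\cdot,\cdot)_2$ the quadratic Hilbert symbol. For a nontrivial additive character $\psi$ of $F$ let $c(\psi)$ be the least integer $n$ such that $\psi$ is trivial on $\mathfrak p^n$, and put $\psi_a(x)=\psi(ax)$ for $a\in F^\times$. Let $\gamma_F(\psi)$ be the Weil index of $x\mapsto\psi(x^2)$ and $\gamma_F(a,\psi)=\gamma_F(\psi_a)/\gamma_F(\psi)$. For a character $\eta$ of $\mathcal O^\times$ let $c(\eta)$ be $0$ if $\eta=1$, and otherwise the least $n\ge1$ such that $\eta$ is trivial on $1+\mathfrak p^n$; for a character $\chi$ of $F^\times$ put $c(\chi)=c(\chi|_{\mathcal O^\times})$ and write $\eta\chi=\eta\cdot\chi|_{\mathcal O^\times}$. Let $\widetilde G=\mathrm{SL}_2(F)\times\{\pm1\}$ be the metaplectic group, with product $(g,s)(h,s')=(gh,\,ss'\,\boldsymbol c(g,h))$,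 where $\boldsymbol c(g,h)=\left(\frac{x(g)}{x(gh)},\frac{x(h)}{x(gh)}\right)_2$ and $x\begin{pmatrix}a&b\\c&d\end{pmatrix}$ is $c$ if $c\ne0$ and $d$ if $c=0$. For a nontrivial additive character $\psi'$ of $F$, the Weil representation $\omega_{\psi'}$ of $\widetilde G$ on the space $\mathcal S(F)$ of locally constant compactly supported functions is determined by $$\omega_{\psi'}\left(\begin{pmatrix}a&0\\0&a^{-1}\end{pmatrix},s\right)\varphi(y)=s|a|^{1/2}\gamma_F(a,\psi')^{-1}\varphi(ay),\qquad \omega_{\psi'}\left(\begin{pmatrix}1&b\\0&1\end{pmatrix},1\right)\varphi(y)=\psi'(by^2)\varphi(y),$$ $$\omega_{\psi'}\left(\begin{pmatrix}0&1\\-1&0\end{pmatrix},1\right)\varphi(y)=\gamma_F(\psi')\int_F\varphi(x)\psi'(2xy)\,dx,$$ where $dx$ is self-dual with respect to $\psi'_2$. Let $\omega_{\psi'}^+$ be its restriction to the even functions. Let $\varepsilon\in\{0,1\}$, and let $\psi$ be an additive character of $F$ with $c(\psi)=-\varepsilon$. For $m\ge0$ let $K_m$ be the group of matrices $\begin{pmatrix}a&b\\c&d\end{pmatrix}\in\mathrm{SL}_2(F)$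 with $a,d\in\mathcal O$, $b\in\mathfrak p^{-\varepsilon}$, $c\in\mathfrak p^{m+\varepsilon}$, regarded as a subgroup of $\widetilde G$ through the unique splitting of $\widetilde G\to\mathrm{SL}_2(F)$ over $K_0$. For a genuine representation $\pi$ of $\widetilde G$ and a character $\eta$ of $\mathcal O^\times$ let $\pi^{K_m}_\eta$ be the space of vectors on which every $\begin{pmatrix}a&b\\c&d\end{pmatrix}\in K_m$ acts by $\eta(d)$ if $m\ge c(\eta)$ (for $m=0$ this means the $K_0$-fixed vectors), and $0$ if $m<c(\eta)$. Put $c^\varepsilon_\eta(\pi)=\min\{m\ge0:\pi^{K_m}_\eta\ne0\}$ ($=+\infty$ if there is no such $m$). Let $c^\varepsilon_{\min}(\pi)$ be the minimum of $c^\varepsilon_\eta(\pi)$ over the characters $\eta$ of $\mathcal O^\times$ such that $(-1_2,\gamma_F(-1,\psi))\in\widetilde G$ acts on $\pi$ by $\eta(-1)$. Let $\chi$ be a quadratic or trivial character of $F^\times$. Then $\chi=\chi_a:=(\cdot,a)_2$ for some $a\in F^\times$. For every such $a$, put $\omega_{\psi,\chi}^+=\omega_{\psi_a}^+$. Then $$c^\varepsilon_{\min}(\omega_{\psi,\chi}^+)=c(\chi),$$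 and for every character $\eta$ of $\mathcal O^\times$ with $\eta(-1)=\chi(-1)$: 1. $c^\varepsilon_\eta(\omega_{\psi,\chi}^+)=2c(\eta\chi)+c(\chi)$; 2. for every $m\ge0$, $$\dim_{\mathbb C}\left(\omega_{\psi,\chi}^+\right)^{K_m}_\eta=\max\left(0,\ \left\lfloor\frac{m-2c(\eta\chi)-c(\chi)}{2}\right\rfloor+1\right);$$ 3. $c^\varepsilon_{\min}(\omega_{\psi,\chi}^+)=c^\varepsilon_\eta(\omega_{\psi,\chi}^+)$ if and only if $\eta=\chi|_{\mathcal O^\times}$. -/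

import Mathlib

open MeasureTheory Filter Topology
open scoped NormedField Valued MatrixGroups

namespace Mp

noncomputable section

/-! ### The field, its characters and the quadratic Hilbert symbol

`F` is a locally compact nonarchimedean field, `𝒪[F]` its ring of integers, `𝓀[F]` its residue
field. In the theorem the norm of `F` is the normalized one, so that the norm of a uniformizer
is `q⁻¹`. -/

/-- The number `q` of elements of the residue field. -/
def q (F : Type*) [NontriviallyNormedField F] [IsUltrametricDist F] : ℕ := Nat.card 𝓀[F]

/-- The fractional ideal `𝔭 ^ n`, for an integer `n` (for the normalized norm). -/
def primePow (F : Type*) [NontriviallyNormedField F] [IsUltrametricDist F] (n : ℤ) : Set F :=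
  {x | ‖x‖ ≤ (q F : ℝ) ^ (-n)}

open Classical in
/-- The Hilbert symbol `(a, b)_2` of degree `2`, for nonzero `a` and `b`: it is `1` if
`z² = a x² + b y²` has a nonzero solution and `-1` otherwise. -/
def hilbert {F : Type*} [Field F] (a b : F) : ℤˣ :=
  if ∃ x y z : F, (x ≠ 0 ∨ y ≠ 0 ∨ z ≠ 0) ∧ z ^ 2 = a * x ^ 2 + b * y ^ 2 then 1 else -1

theorem hilbert_one_right {F : Type*} [Field F] (a : F) : hilbert a 1 = 1 :=
  if_pos ⟨0, 1, 1, by simp, by simp⟩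

theorem hilbert_one_left {F : Type*} [Field F] (a : F) : hilbert 1 a = 1 :=
  if_pos ⟨1, 0, 1, by simp, by simp⟩

/-- `χ = χ_a`, that is, `χ x = (x, a)_2` for all `x ∈ Fˣ`. -/
def IsHilbertChar {F : Type*} [Field F] (χ : Fˣ →* ℂˣ) (a : Fˣ) : Prop :=
  ∀ x : Fˣ, (χ x : ℂ) = ((hilbert (x : F) (a : F) : ℤ) : ℂ)

section Field

variable {F : Type*} [NontriviallyNormedField F] [IsUltrametricDist F]

/-- The conductor `c(η)` of a character `η` of `𝒪ˣ`: the least `n ≥ 0` such that `η` is trivial on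
`{u ∈ 𝒪ˣ | u - 1 ∈ 𝔭 ^ n}` (which is `𝒪ˣ` for `n = 0` and `1 + 𝔭 ^ n` for `n ≥ 1`). -/
def unitCond (η : 𝒪[F]ˣ →* ℂˣ) : ℕ :=
  sInf {n : ℕ | ∀ u : 𝒪[F]ˣ, ((u : 𝒪[F]) : F) - 1 ∈ primePow F n → η u = 1}

/-- The restriction to `𝒪ˣ` of a character of `Fˣ`. -/
def resUnits (χ : Fˣ →* ℂˣ) : 𝒪[F]ˣ →* ℂˣ := χ.comp (Units.map (𝒪[F].subtype : 𝒪[F] →* F))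

open Classical in
/-- `d ↦ η d` for `d ∈ 𝒪ˣ`, extended by `1`. The value outside `𝒪ˣ` only matters for the group
`K_0` and the trivial character `η`. -/
def evalUnit (η : 𝒪[F]ˣ →* ℂˣ) (d : F) : ℂ :=
  if h : ∃ u : 𝒪[F]ˣ, ((u : 𝒪[F]) : F) = d then (η h.choose : ℂ) else 1

end Field

/-- A nontrivial (continuous) additive character of `F`. -/
structure NontrivialAddChar (F : Type*) [NontriviallyNormedField F] where
  toAddChar : AddChar F Circle
  continuous' : Continuous toAddChar
  ne_one' : toAddChar ≠ 1

namespace NontrivialAddChar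

variable {F : Type*} [NontriviallyNormedField F]

instance : CoeFun (NontrivialAddChar F) (fun _ => F → Circle) := ⟨fun ψ => ψ.toAddChar⟩

/-- The character `ψ_a : x ↦ ψ (a x)`. -/
def twist (ψ : NontrivialAddChar F) (a : Fˣ) : NontrivialAddChar F where
  toAddChar := ψ.toAddChar.mulShift (a : F)
  continuous' := by
    have h : ⇑(ψ.toAddChar.mulShift (a : F)) = fun x => ψ.toAddChar ((a : F) * x) := by
      funext x; simp [AddChar.mulShift_apply]
    rw [h]
    exact ψ.continuous'.comp (continuous_const.mul continuous_id)
  ne_one' := by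
    intro h
    apply ψ.ne_one'
    ext x
    have := DFunLike.congr_fun h ((a : F)⁻¹ * x)
    simpa [AddChar.mulShift_apply] using congrArg (fun z : Circle => (z : ℂ)) this

variable [IsUltrametricDist F]

/-- The conductor `c(ψ)`: the least integer `n` such that `ψ` is trivial on `𝔭 ^ n`. -/
def cond (ψ : NontrivialAddChar F) : ℤ :=
  sInf {n : ℤ | ∀ x ∈ primePow F n, ψ x = 1}

theorem exists_ball (ψ : NontrivialAddChar F) : ∃ r > 0, ∀ x : F, ‖x‖ < r → ψ x = 1 := by
  have h0 : ∀ᶠ x in 𝓝 (0 : F), ‖((ψ x : Circle) : ℂ) - 1‖ < 1 / 2 := by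
    have hc : Continuous fun x : F => ‖((ψ x : Circle) : ℂ) - 1‖ :=
      ((continuous_induced_dom.comp ψ.continuous').sub continuous_const).norm
    refine hc.continuousAt.eventually_lt continuousAt_const ?_
    simp
  obtain ⟨r, hr, h⟩ := Metric.eventually_nhds_iff.mp h0
  refine ⟨r, hr, fun x hx => ?_⟩
  have hmul : ∀ n : ℕ, ‖((ψ x : Circle) : ℂ) ^ n - 1‖ < 1 / 2 := by
    intro n
    have h1 : ‖(n : F) * x‖ < r := by
      rw [norm_mul]
      have : ‖(n : F)‖ ≤ 1 := IsUltrametricDist.norm_natCast_le_one F n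
      nlinarith [norm_nonneg x]
    have h2 := h (y := (n : F) * x) (by simpa [dist_eq_norm] using h1)
    have h3 : ψ ((n : F) * x) = (ψ x) ^ n := by
      rw [← nsmul_eq_mul]; exact AddChar.map_nsmul_eq_pow _ _ _
    rw [h3] at h2
    simpa using h2
  set z : ℂ := ((ψ x : Circle) : ℂ) with hz
  have hgrow : ∀ k : ℕ, (3 / 2 : ℝ) ^ k * ‖z - 1‖ ≤ ‖z ^ (2 ^ k) - 1‖ := by
    intro k
    induction k with
    | zero => simp
    | succ k ih =>
      set v := z ^ (2 ^ k) with hv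
      have e : z ^ (2 ^ (k + 1)) - 1 = (v - 1) * (v + 1) := by
        rw [pow_succ, pow_mul, ← hv]; ring
      have hb : (3 / 2 : ℝ) ≤ ‖v + 1‖ := by
        have h1 := hmul (2 ^ k)
        rw [← hv] at h1
        have h2 : ‖(2 : ℂ)‖ ≤ ‖v + 1‖ + ‖v - 1‖ := by
          have : (2 : ℂ) = (v + 1) - (v - 1) := by ring
          rw [this]; exact norm_sub_le _ _
        simp only [Complex.norm_ofNat] at h2
        linarith
      rw [e, norm_mul, pow_succ]
      nlinarith [norm_nonneg (v - 1), norm_nonneg (z - 1)]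
  by_contra hne
  have hpos : 0 < ‖z - 1‖ := by
    rw [norm_pos_iff, sub_ne_zero]
    intro h1
    exact hne (Circle.ext (by simpa using h1))
  obtain ⟨k, hk⟩ := pow_unbounded_of_one_lt (1 / ‖z - 1‖) (by norm_num : (1 : ℝ) < 3 / 2)
  have h1 := hgrow k
  have h2 := hmul (2 ^ k)
  rw [div_lt_iff₀ hpos] at hk
  linarith

theorem isLocallyConstant (ψ : NontrivialAddChar F) :
    IsLocallyConstant fun x : F => ((ψ x : Circle) : ℂ) := by
  rw [IsLocallyConstant.iff_eventually_eq]
  intro x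
  obtain ⟨r, hr, h⟩ := ψ.exists_ball
  filter_upwards [Metric.ball_mem_nhds x hr] with y hy
  have h1 : ψ (y - x) = 1 := h _ (by simpa [dist_eq_norm] using hy)
  have h2 : ψ y = ψ (y - x) * ψ x := by
    rw [← AddChar.map_add_eq_mul, sub_add_cancel]
  rw [h2, h1, one_mul]

end NontrivialAddChar

/-! ### Haar measure and the Weil index -/

section Analysis

variable {F : Type*} [NontriviallyNormedField F] [IsUltrametricDist F] [ProperSpace F]
  [MeasurableSpace F] [BorelSpace F]

variable (F) in
/-- The Haar measure on `F` with total mass `1` on `𝒪`. -/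
def haar : Measure F :=
  Measure.addHaarMeasure
    ⟨⟨Metric.closedBall 0 1, isCompact_closedBall 0 1⟩,
      ⟨0, Metric.ball_subset_interior_closedBall (Metric.mem_ball_self one_pos)⟩⟩

instance : Measure.IsAddHaarMeasure (haar F) := Measure.isAddHaarMeasure_addHaarMeasure _

/-- The Haar measure on `F` that is self-dual with respect to `ψ`, namely `q ^ (c(ψ) / 2) dx`. -/
def selfDual (ψ : NontrivialAddChar F) : Measure F :=
  ENNReal.ofReal ((q F : ℝ) ^ ((ψ.cond : ℝ) / 2)) • haar F

instance (ψ : NontrivialAddChar F) : (selfDual ψ).IsAddLeftInvariant := by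
  unfold selfDual; infer_instance

instance (ψ : NontrivialAddChar F) : IsFiniteMeasureOnCompacts (selfDual ψ) := by
  unfold selfDual
  exact IsFiniteMeasureOnCompacts.smul _ ENNReal.ofReal_ne_top

variable [CharZero F]

/-- The character `ψ_2 : x ↦ ψ (2 x)`. -/
def NontrivialAddChar.two (ψ : NontrivialAddChar F) : NontrivialAddChar F :=
  ψ.twist (Units.mk0 2 two_ne_zero)

/-- The unnormalized Weil index `γ_F(ψ)` of `x ↦ ψ (x²)`: the integral of `ψ (x²)` over `F`, in the
sense of a limit over the balls `𝔭 ^ (-n)`, with respect to the measure self-dual for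
`(x, y) ↦ ψ (2 x y)`. -/
def weilIndex (ψ : NontrivialAddChar F) : ℂ :=
  limUnder atTop fun n : ℕ =>
    ∫ x in primePow F (-(n : ℤ)), ((ψ (x ^ 2) : Circle) : ℂ) ∂selfDual ψ.two

/-- The normalized Weil index `γ_F(a, ψ) = γ_F(ψ_a) / γ_F(ψ)`. -/
def relWeilIndex (a : Fˣ) (ψ : NontrivialAddChar F) : ℂ :=
  weilIndex (ψ.twist a) / weilIndex ψ

open Classical in
/-- A complex number known to be `1` or `-1`, as an element of `{±1}`. -/
def signOf (z : ℂ) : ℤˣ := if z = -1 then -1 else 1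

theorem signOf_relWeilIndex_one (ψ : NontrivialAddChar F) : signOf (relWeilIndex 1 ψ) = 1 := by
  have h : ψ.twist 1 = ψ := by
    obtain ⟨f, _, _⟩ := ψ
    simp [NontrivialAddChar.twist]
  unfold signOf relWeilIndex
  rw [h, if_neg]
  by_cases h0 : weilIndex ψ = 0
  · simp [h0]
  · rw [div_self h0]; norm_num

end Analysis

/-! ### The metaplectic group -/

section Group

variable {F : Type*} [Field F]

theorem mul_entry (g h : SL(2, F)) (i j : Fin 2) :
    (g * h) i j = g i 0 * h 0 j + g i 1 * h 1 j := by
  rw [Matrix.SpecialLinearGroup.coe_mul, Matrix.mul_apply, Fin.sum_univ_two]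

/-- `t(a) = (a, 0; 0, a⁻¹)` -/
def t (a : Fˣ) : SL(2, F) := ⟨!![(a : F), 0; 0, (a : F)⁻¹], by simp⟩

/-- `n(b) = (1, b; 0, 1)` -/
def n (b : F) : SL(2, F) := ⟨!![1, b; 0, 1], by simp⟩

/-- `n^op(c) = (1, 0; c, 1)` -/
def nop (c : F) : SL(2, F) := ⟨!![1, 0; c, 1], by simp⟩

variable (F) in
/-- `w = (0, 1; -1, 0)` -/
def w : SL(2, F) := ⟨!![0, 1; -1, 0], by simp⟩

open Classical in
/-- The function `x(a, b; c, d)`, equal to `c` if `c ≠ 0` and to `d` if `c = 0`. -/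
def xfun (g : SL(2, F)) : F := if g 1 0 ≠ 0 then g 1 0 else g 1 1

/-- The Kubota cocycle. -/
def kubota (g h : SL(2, F)) : ℤˣ :=
  hilbert (xfun g / xfun (g * h)) (xfun h / xfun (g * h))

variable (F) in
/-- The metaplectic double cover of `SL(2, F)`: as a set it is `SL(2, F) × {±1}`, and the product is
twisted by the Kubota cocycle. -/
@[ext] structure Metaplectic where
  mat : SL(2, F)
  sign : ℤˣ

instance : Mul (Metaplectic F) :=
  ⟨fun x y => ⟨x.mat * y.mat, x.sign * y.sign * kubota x.mat y.mat⟩⟩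

theorem Metaplectic.mul_def (x y : Metaplectic F) :
    x * y = ⟨x.mat * y.mat, x.sign * y.sign * kubota x.mat y.mat⟩ := rfl

/-- The upper left entry of a matrix with lower left entry `0`, as a unit. -/
def ulUnit (g : SL(2, F)) (h : g 1 0 = 0) : Fˣ :=
  ⟨g 0 0, g 1 1,
    by have := g.det_coe; rw [Matrix.det_fin_two, h] at this; simpa using this,
    by have := g.det_coe; rw [Matrix.det_fin_two, h] at this; simpa [mul_comm] using this⟩

/-- The element `-1/c` for a matrix with lower left entry `c ≠ 0`. -/
def llUnit (g : SL(2, F)) (h : g 1 0 ≠ 0) : Fˣ := Units.mk0 (-(g 1 0)⁻¹) (by simpa using h)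

/-- In the metaplectic group, `(g, s) = (n(ab), 1) (t(a), s)` if `c = 0`. -/
theorem borel_decomp (x : Metaplectic F) (h : x.mat 1 0 = 0) :
    (⟨n (x.mat 0 0 * x.mat 0 1), 1⟩ * ⟨t (ulUnit x.mat h), x.sign⟩ : Metaplectic F) = x := by
  have hdet := x.mat.det_coe
  rw [Matrix.det_fin_two, h] at hdet
  have hd : x.mat 0 0 * x.mat 1 1 = 1 := by simpa using hdet
  have ha : x.mat 0 0 ≠ 0 := left_ne_zero_of_mul_eq_one hd
  have hinv : (x.mat 0 0)⁻¹ = x.mat 1 1 := inv_eq_of_mul_eq_one_right hd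
  have hmat : n (x.mat 0 0 * x.mat 0 1) * t (ulUnit x.mat h) = x.mat := by
    ext i j
    fin_cases i <;> fin_cases j <;> simp only [mul_entry] <;>
      simp [n, t, ulUnit, h, hinv]
    calc x.mat 0 0 * x.mat 0 1 * x.mat 1 1
        = (x.mat 0 0 * x.mat 1 1) * x.mat 0 1 := by ring
      _ = x.mat 0 1 := by rw [hd, one_mul]
  refine Metaplectic.ext hmat ?_
  have h2 : xfun x.mat = x.mat 1 1 := by simp [xfun, h]
  have h3 : xfun (t (ulUnit x.mat h)) = x.mat 1 1 := by simp [xfun, t, ulUnit, hinv]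
  have h4 : x.mat 1 1 ≠ 0 := right_ne_zero_of_mul_eq_one hd
  change 1 * x.sign * kubota _ _ = x.sign
  rw [kubota, hmat, h2, h3, div_self h4, hilbert_one_right]
  simp

/-- In the metaplectic group, `(g, s) = (n(a/c), 1) (t(-1/c), s') (w, 1) (n(d/c), 1)` with
`s' = s (-1, -1/c)_2`, if `c ≠ 0`. -/
theorem bruhat_decomp (x : Metaplectic F) (h : x.mat 1 0 ≠ 0) :
    (⟨n (x.mat 0 0 / x.mat 1 0), 1⟩ *
      (⟨t (llUnit x.mat h), x.sign * hilbert (-1) (-(x.mat 1 0)⁻¹)⟩ *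
        ⟨w F, 1⟩ * ⟨n (x.mat 1 1 / x.mat 1 0), 1⟩) : Metaplectic F) = x := by
  have hdet := x.mat.det_coe
  rw [Matrix.det_fin_two] at hdet
  set c := x.mat 1 0 with hc
  have e1 : (t (llUnit x.mat h) * w F) 1 0 = c := by
    simp only [mul_entry]
    simp [t, w, llUnit, ← hc]
  have x1 : xfun (t (llUnit x.mat h) * w F) = c := by
    unfold xfun; rw [e1, if_pos h]
  have e2 : (t (llUnit x.mat h) * w F * n (x.mat 1 1 / c)) 1 0 = c := by
    simp only [mul_entry]
    simp [t, w, n, llUnit, ← hc]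
  have x2 : xfun (t (llUnit x.mat h) * w F * n (x.mat 1 1 / c)) = c := by
    unfold xfun; rw [e2, if_pos h]
  have xt : xfun (t (llUnit x.mat h)) = -c := by
    simp [xfun, t, llUnit, ← hc, inv_neg]
  have xw : xfun (w F) = -1 := by simp [xfun, w]
  have xn : ∀ b : F, xfun (n b) = 1 := by intro b; simp [xfun, n]
  have hmat : n (x.mat 0 0 / c) * (t (llUnit x.mat h) * w F * n (x.mat 1 1 / c)) = x.mat := by
    ext i j
    fin_cases i <;> fin_cases j <;> simp only [mul_entry] <;>
      simp [n, t, w, llUnit, ← hc]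
    · field_simp
    · field_simp
      linear_combination hdet
    · field_simp
  have xx : xfun x.mat = c := by unfold xfun; rw [← hc, if_pos h]
  refine Metaplectic.ext hmat ?_
  simp only [Metaplectic.mul_def]
  have k1 : kubota (t (llUnit x.mat h)) (w F) = hilbert (-1) (-c⁻¹) := by
    rw [kubota, x1, xt, xw, neg_div, div_self h, neg_div, one_div]
  have k2 : kubota (t (llUnit x.mat h) * w F) (n (x.mat 1 1 / c)) = 1 := by
    rw [kubota, x1, x2, div_self h, hilbert_one_left]
  have k3 : kubota (n (x.mat 0 0 / c)) (t (llUnit x.mat h) * w F * n (x.mat 1 1 / c)) = 1 := by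
    rw [kubota, hmat, x2, xx, div_self h, hilbert_one_right]
  rw [k1, k2, k3]
  simp [mul_assoc, Int.units_mul_self]

end Group

/-! ### The open compact subgroups and their splittings -/

section Compact

variable {F : Type*} [NontriviallyNormedField F] [IsUltrametricDist F]

variable (F) in
/-- The group `K^ε_m` of matrices `(a, b; c, d)` of determinant `1` with `a, d ∈ 𝒪`,
`b ∈ 𝔭 ^ (-ε)`, `c ∈ 𝔭 ^ (m + ε)`. -/
def congruenceGroup (ε m : ℕ) : Set SL(2, F) :=
  {g | g 0 0 ∈ 𝒪[F] ∧ g 1 1 ∈ 𝒪[F] ∧ g 0 1 ∈ primePow F (-(ε : ℤ)) ∧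
    g 1 0 ∈ primePow F ((m : ℤ) + ε)}

variable [ProperSpace F] [MeasurableSpace F] [BorelSpace F] [CharZero F]

open Classical in
/-- The splitting sign `s^ε` over the maximal compact group `K^ε`, for `ψ` of conductor `-ε`:
`(c, d)_2 γ_F(d⁻¹, ψ)` if `d` is a unit and `c ≠ 0`, `γ_F(d⁻¹, ψ)` if `c = 0`, and `1` if `d` is not a
unit. The map `g ↦ (g, s^ε(g))` is the unique homomorphic section over `K^ε`. -/
def splitSign (ψ : NontrivialAddChar F) (g : SL(2, F)) : ℤˣ :=
  if h : ‖g 1 1‖ = 1 then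
    (if g 1 0 = 0 then 1 else hilbert (g 1 0) (g 1 1)) *
      signOf (relWeilIndex (Units.mk0 (g 1 1) (norm_ne_zero_iff.mp (by rw [h]; exact one_ne_zero)))⁻¹ ψ)
  else 1

/-- The lift of an element of `K^ε` to the metaplectic group. -/
def lift (ψ : NontrivialAddChar F) (g : SL(2, F)) : Metaplectic F := ⟨g, splitSign ψ g⟩

theorem splitSign_n (ψ : NontrivialAddChar F) (b : F) : splitSign ψ (n b) = 1 := by
  have h1 : n b 1 1 = 1 := by simp [n]
  have h2 : n b 1 0 = 0 := by simp [n]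
  simp only [splitSign, h1, h2, norm_one, dite_true, if_true, one_mul, Units.mk0_one, inv_one]
  exact signOf_relWeilIndex_one ψ

theorem splitSign_nop (ψ : NontrivialAddChar F) (c : F) : splitSign ψ (nop c) = 1 := by
  have h1 : nop c 1 1 = 1 := by simp [nop]
  simp only [splitSign, h1, norm_one, dite_true, Units.mk0_one, inv_one, hilbert_one_right,
    ite_self, one_mul]
  exact signOf_relWeilIndex_one ψ

theorem splitSign_t (ψ : NontrivialAddChar F) (a : Fˣ) (ha : ‖(a : F)‖ = 1) :
    splitSign ψ (t a) = signOf (relWeilIndex a ψ) := by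
  have h1 : t a 1 1 = (a : F)⁻¹ := by simp [t]
  have h2 : t a 1 0 = 0 := by simp [t]
  have h3 : ‖(a : F)⁻¹‖ = 1 := by rw [norm_inv, ha, inv_one]
  simp only [splitSign, h1, h2, h3, dite_true, if_true, one_mul]
  congr 2
  ext
  simp

theorem splitSign_w_t (ψ : NontrivialAddChar F) (a : Fˣ) : splitSign ψ (w F * t a) = 1 := by
  have h1 : (w F * t a) 1 1 = 0 := by
    simp only [mul_entry]
    simp [w, t]
  simp [splitSign, h1]

end Compact

/-! ### The Weil representation -/

section Weil

variable (F : Type*) [NontriviallyNormedField F]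

/-- The space `𝒮(F)` of locally constant, compactly supported functions on `F`. -/
def SchwartzBruhat : Submodule ℂ (F → ℂ) where
  carrier := {φ | IsLocallyConstant φ ∧ HasCompactSupport φ}
  add_mem' h h' := ⟨h.1.add h'.1, h.2.add h'.2⟩
  zero_mem' := ⟨IsLocallyConstant.const 0, HasCompactSupport.zero⟩
  smul_mem' c _ h := ⟨h.1.comp (fun z => c • z), h.2.smul_left (f := fun _ => c)⟩

/-- The space `𝒮⁺(F)` of even functions in `𝒮(F)`. -/
def evenPart : Submodule ℂ (SchwartzBruhat F) where
  carrier := {φ | ∀ x, φ.1 (-x) = φ.1 x}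
  add_mem' h h' x := by simp [h x, h' x]
  zero_mem' x := by simp
  smul_mem' c φ h x := by simp [h x]

variable {F} [IsUltrametricDist F]

/-- The action of `n(b)`: `φ ↦ (y ↦ ψ (b y²) φ y)`. -/
def opN (ψ : NontrivialAddChar F) (b : F) : SchwartzBruhat F →ₗ[ℂ] SchwartzBruhat F where
  toFun φ := ⟨fun y => ((ψ (b * y ^ 2) : Circle) : ℂ) * φ.1 y,
    (ψ.isLocallyConstant.comp_continuous (by fun_prop : Continuous fun y : F => b * y ^ 2)).mul φ.2.1,
    φ.2.2.mul_left⟩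
  map_add' φ φ' := by ext y; simp [mul_add]
  map_smul' c φ := by ext y; simp; ring

/-- A function in `𝒮(F)` is invariant under translation by a small ball. -/
theorem exists_invariant (φ : SchwartzBruhat F) :
    ∃ r > 0, ∀ h : F, ‖h‖ < r → ∀ x, φ.1 (x + h) = φ.1 x := by
  obtain ⟨δ, hδ, H⟩ := lebesgue_number_lemma_of_metric (s := tsupport φ.1)
    (c := fun z : ℂ => φ.1 ⁻¹' {z}) φ.2.2 (fun z => φ.2.1 {z}) (fun x _ => by simp)
  have key : ∀ x ∈ tsupport φ.1, ∀ y, ‖y - x‖ < δ → φ.1 y = φ.1 x := by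
    intro x hx y hy
    obtain ⟨z, hz⟩ := H x hx
    have h1 : φ.1 x = z := hz (Metric.mem_ball_self hδ)
    have h2 : φ.1 y = z := hz (by simpa [dist_eq_norm] using hy)
    rw [h1, h2]
  refine ⟨δ, hδ, fun h hh x => ?_⟩
  by_cases hx : x ∈ tsupport φ.1
  · exact key x hx _ (by simpa using hh)
  · by_cases hy : x + h ∈ tsupport φ.1
    · exact (key _ hy x (by simpa using hh)).symm
    · rw [image_eq_zero_of_notMem_tsupport hx, image_eq_zero_of_notMem_tsupport hy]

variable [MeasurableSpace F] [BorelSpace F]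

theorem integrable_fourier (ψ : NontrivialAddChar F) (μ : Measure F) [IsFiniteMeasureOnCompacts μ]
    (φ : SchwartzBruhat F) (c : F) :
    Integrable (fun x => φ.1 x * ((ψ (c * x) : Circle) : ℂ)) μ := by
  refine Continuous.integrable_of_hasCompactSupport ?_ φ.2.2.mul_right
  exact φ.2.1.continuous.mul
    (continuous_induced_dom.comp (ψ.continuous'.comp (continuous_const.mul continuous_id)))

variable [ProperSpace F] [CharZero F]

/-- The space `𝒮(F)` is stable under the Fourier transform. -/
theorem fourier_mem (ψ : NontrivialAddChar F) (μ : Measure F) [IsFiniteMeasureOnCompacts μ]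
    [μ.IsAddLeftInvariant] (φ : SchwartzBruhat F) :
    (fun y => ∫ x, φ.1 x * ((ψ (2 * x * y) : Circle) : ℂ) ∂μ) ∈ SchwartzBruhat F := by
  have two0 : (2 : F) ≠ 0 := two_ne_zero
  constructor
  · obtain ⟨r, hr, hψ⟩ := ψ.exists_ball
    obtain ⟨R, hR⟩ := φ.2.2.isBounded.exists_norm_le
    have hR0 : 0 < |R| + 1 := by positivity
    have h2 : 0 < ‖(2 : F)‖ := norm_pos_iff.mpr two0
    rw [IsLocallyConstant.iff_eventually_eq]
    intro y
    have hs : 0 < r / (‖(2 : F)‖ * (|R| + 1)) := by positivity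
    filter_upwards [Metric.ball_mem_nhds y hs] with y' hy'
    refine integral_congr_ae (Eventually.of_forall fun x => ?_)
    by_cases hx : x ∈ tsupport φ.1
    · have hxR : ‖x‖ < |R| + 1 := by
        have := hR x hx
        have := le_abs_self R
        linarith
      have hd : ‖y' - y‖ < r / (‖(2 : F)‖ * (|R| + 1)) := by simpa [dist_eq_norm] using hy'
      have h3 : ‖2 * x * (y' - y)‖ < r := by
        rw [norm_mul, norm_mul]
        rw [lt_div_iff₀ (by positivity)] at hd
        calc ‖(2 : F)‖ * ‖x‖ * ‖y' - y‖ ≤ ‖(2 : F)‖ * (|R| + 1) * ‖y' - y‖ := by gcongr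
          _ < r := by linarith
      have h4 : ψ (2 * x * y') = ψ (2 * x * y) := by
        have e : 2 * x * y' = 2 * x * (y' - y) + 2 * x * y := by ring
        rw [e]
        change ψ.toAddChar _ = _
        rw [AddChar.map_add_eq_mul, hψ _ h3, one_mul]
      simp only [h4]
    · simp [image_eq_zero_of_notMem_tsupport hx]
  · obtain ⟨r, hr, hφ⟩ := exists_invariant φ
    obtain ⟨z, hz⟩ : ∃ z, ψ z ≠ 1 := by
      by_contra hcon
      push Not at hcon
      exact ψ.ne_one' (by ext x; simp [hcon x])
    refine HasCompactSupport.of_support_subset_isCompact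
      (isCompact_closedBall (0 : F) (‖z / 2‖ / r)) fun y hy => ?_
    by_contra hout
    have hlt : ‖z / 2‖ / r < ‖y‖ := by simpa using hout
    have hy0 : y ≠ 0 := by
      rintro rfl
      rw [norm_zero] at hlt
      exact absurd hlt (not_lt.mpr (by positivity))
    have hypos : 0 < ‖y‖ := norm_pos_iff.mpr hy0
    have hh : ‖z / 2 / y‖ < r := by
      rw [norm_div, div_lt_iff₀ hypos]
      rw [div_lt_iff₀ hr] at hlt
      linarith
    apply hy
    have e := integral_add_left_eq_self (μ := μ)
      (fun x => φ.1 x * ((ψ (2 * x * y) : Circle) : ℂ)) (z / 2 / y)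
    have e2 : ∀ x, φ.1 (z / 2 / y + x) * ((ψ (2 * (z / 2 / y + x) * y) : Circle) : ℂ)
        = ((ψ z : Circle) : ℂ) * (φ.1 x * ((ψ (2 * x * y) : Circle) : ℂ)) := by
      intro x
      have e3 : 2 * (z / 2 / y + x) * y = z + 2 * x * y := by field_simp
      have e4 : ψ (z + 2 * x * y) = ψ z * ψ (2 * x * y) := AddChar.map_add_eq_mul _ _ _
      rw [add_comm (z / 2 / y) x, hφ _ hh, add_comm x, e3, e4]
      push_cast
      ring
    simp only [e2] at e
    rw [integral_const_mul] at e
    have e5 : (((ψ z : Circle) : ℂ) - 1) *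
        ∫ x, φ.1 x * ((ψ (2 * x * y) : Circle) : ℂ) ∂μ = 0 := by
      rw [sub_mul, e, one_mul, sub_self]
    rcases mul_eq_zero.mp e5 with h | h
    · exact absurd (Circle.ext (by simpa using sub_eq_zero.mp h)) hz
    · exact h

/-- The action of `(t(a), s)`: `φ ↦ (y ↦ s |a|^(1/2) γ_F(a, ψ)⁻¹ φ (a y))`. -/
def opT (ψ : NontrivialAddChar F) (a : Fˣ) (s : ℤˣ) :
    SchwartzBruhat F →ₗ[ℂ] SchwartzBruhat F where
  toFun φ := ⟨fun y => ((s : ℤ) : ℂ) * (Real.sqrt ‖(a : F)‖ : ℂ) * (relWeilIndex a ψ)⁻¹ *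
      φ.1 ((a : F) * y),
    (IsLocallyConstant.const _).mul
      (φ.2.1.comp_continuous (by fun_prop : Continuous fun y : F => (a : F) * y)),
    (φ.2.2.comp_homeomorph (Homeomorph.mulLeft₀ (a : F) a.ne_zero)).mul_left⟩
  map_add' φ φ' := by ext y; simp [mul_add]
  map_smul' c φ := by ext y; simp; ring

/-- The action of `(w, 1)`: `φ ↦ (y ↦ γ_F(ψ) ∫ φ x ψ (2 x y) dx)`, for the measure self-dual with
respect to `ψ_2`. -/
def opW (ψ : NontrivialAddChar F) : SchwartzBruhat F →ₗ[ℂ] SchwartzBruhat F where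
  toFun φ := weilIndex ψ •
    ⟨fun y => ∫ x, φ.1 x * ((ψ (2 * x * y) : Circle) : ℂ) ∂selfDual ψ.two, fourier_mem ψ _ φ⟩
  map_add' φ φ' := by
    ext y
    have e : ∀ (f : SchwartzBruhat F),
        Integrable (fun x => f.1 x * ((ψ (2 * x * y) : Circle) : ℂ)) (selfDual ψ.two) := by
      intro f
      have h := integrable_fourier ψ (selfDual ψ.two) f (2 * y)
      refine h.congr (Eventually.of_forall fun x => ?_)
      simp only [mul_right_comm]
    have h := integral_add (e φ) (e φ')
    simp only [Submodule.coe_smul, Submodule.coe_add, Pi.smul_apply, Pi.add_apply, smul_eq_mul,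
      add_mul]
    rw [h, mul_add]
  map_smul' c φ := by
    ext y
    simp only [Submodule.coe_smul, Pi.smul_apply, smul_eq_mul, RingHom.id_apply, mul_assoc]
    rw [integral_const_mul]
    ring

open Classical in
/-- The Schrödinger model `ω_ψ` of the Weil representation of the metaplectic group on `𝒮(F)`. It is
determined by the action of `(t(a), s)`, `(n(b), 1)` and `(w, 1)`; the value at a general element is
given by the decompositions `borel_decomp` and `bruhat_decomp` of the element in the group. -/
def weil (ψ : NontrivialAddChar F) (x : Metaplectic F) :
    SchwartzBruhat F →ₗ[ℂ] SchwartzBruhat F :=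
  if h : x.mat 1 0 = 0 then
    opN ψ (x.mat 0 0 * x.mat 0 1) ∘ₗ opT ψ (ulUnit x.mat h) x.sign
  else
    opN ψ (x.mat 0 0 / x.mat 1 0) ∘ₗ
      opT ψ (llUnit x.mat h) (x.sign * hilbert (-1) (-(x.mat 1 0)⁻¹)) ∘ₗ
        opW ψ ∘ₗ opN ψ (x.mat 1 1 / x.mat 1 0)

/-! ### Isotypic spaces and conductors for the even Weil representation

Here `ψ` is the character defining the splitting over `K^ε`, and the representation is the even part
`ω_{ψ'}^+` of `ω_{ψ'}`, for a second character `ψ'`. -/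

open Classical in
/-- The space of vectors `φ` of `ω_{ψ'}^+` such that `(a, b; c, d) ∈ K^ε_m` acts on `φ` by `η(d)`. It
is `0` by definition if `m < c(η)`. -/
def isotypic (ψ ψ' : NontrivialAddChar F) (ε m : ℕ) (η : 𝒪[F]ˣ →* ℂˣ) :
    Submodule ℂ (SchwartzBruhat F) :=
  if unitCond η ≤ m then
    evenPart F ⊓
      ⨅ g ∈ congruenceGroup F ε m, LinearMap.ker (weil ψ' (lift ψ g) - evalUnit η (g 1 1) • LinearMap.id)
  else ⊥

/-- The `η`-conductor `c^ε_η` of `ω_{ψ'}^+` (`⊤` if all the isotypic spaces are zero). -/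
def etaCond (ψ ψ' : NontrivialAddChar F) (ε : ℕ) (η : 𝒪[F]ˣ →* ℂˣ) : ℕ∞ :=
  sInf {c : ℕ∞ | ∃ m : ℕ, c = m ∧ isotypic ψ ψ' ε m η ≠ ⊥}

/-- The central sign `z_ψ` of `ω_{ψ'}^+` is `z`: the element `(-1, γ_F(-1, ψ))` acts by `z`. -/
def IsCentralSign (ψ ψ' : NontrivialAddChar F) (z : ℂ) : Prop :=
  ∀ φ ∈ evenPart F, weil ψ' ⟨-1, signOf (relWeilIndex (-1) ψ)⟩ φ = z • φ

/-- The minimal conductor `c^ε_min` of `ω_{ψ'}^+`: the minimum of `c^ε_η` over the (continuous)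
characters `η` of `𝒪ˣ` such that `η(-1)` is the central sign. -/
def minCond (ψ ψ' : NontrivialAddChar F) (ε : ℕ) : ℕ∞ :=
  sInf {c : ℕ∞ | ∃ η : 𝒪[F]ˣ →* ℂˣ, Continuous η ∧ IsCentralSign ψ ψ' (η (-1) : ℂ) ∧
    c = etaCond ψ ψ' ε η}

end Weil

end

end Mp

set_option linter.unusedSectionVars false

namespace Mp

noncomputable section

/-! ### Valuation theory of a locally compact field of odd residual characteristic -/

/-- The norm of `F` is normalized and the residual characteristic is odd. -/
class OddNormalized (F : Type*) [NontriviallyNormedField F] [IsUltrametricDist F] : Prop where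
  norm_irreducible : ∀ ϖ : 𝒪[F], Irreducible ϖ → ‖(ϖ : F)‖ = (q F : ℝ)⁻¹
  ringChar_ne_two : ringChar 𝓀[F] ≠ 2

section Basic

variable (F : Type*) [NontriviallyNormedField F] [IsUltrametricDist F] [ProperSpace F]

theorem compactSpace_integer : CompactSpace 𝒪[F] := by
  refine (isCompact_iff_compactSpace (s := ((𝒪[F] : Subring F) : Set F))).mp ?_
  have : ((𝒪[F] : Subring F) : Set F) = Metric.closedBall 0 1 := by
    ext x; simp [Valued.integer.mem_iff]
  rw [this]
  exact isCompact_closedBall 0 1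

theorem integer_dvr_finite : IsDiscreteValuationRing 𝒪[F] ∧ Finite 𝓀[F] := by
  have hc := compactSpace_integer F
  have hr : (Valued.v : Valuation F NNReal).RankOne :=
    inferInstanceAs (NormedField.valuation (K := F)).RankOne
  have h := Valued.integer.compactSpace_iff_completeSpace_and_isDiscreteValuationRing_and_finite_residueField
    (K := F) |>.mp hc
  exact h.2

instance : IsDiscreteValuationRing 𝒪[F] := (integer_dvr_finite F).1

instance finite_residueField : Finite 𝓀[F] := (integer_dvr_finite F).2

theorem one_lt_q : 1 < q F := Finite.one_lt_card

theorem one_lt_q_real : (1 : ℝ) < q F := by exact_mod_cast one_lt_q F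

theorem q_pos : (0 : ℝ) < q F := zero_lt_one.trans (one_lt_q_real F)

variable [OddNormalized F]

theorem exists_uniformizer : ∃ ϖ : 𝒪[F], Irreducible ϖ := IsDiscreteValuationRing.exists_irreducible _

/-- A uniformizer of `F`. -/
def unif : F := ((exists_uniformizer F).choose : 𝒪[F])

theorem norm_unif : ‖unif F‖ = (q F : ℝ)⁻¹ :=
  OddNormalized.norm_irreducible _ (exists_uniformizer F).choose_spec

theorem unif_ne_zero : unif F ≠ 0 := by
  rw [← norm_ne_zero_iff, norm_unif]
  exact inv_ne_zero (q_pos F).ne'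

theorem norm_unif_zpow (k : ℤ) : ‖unif F ^ k‖ = (q F : ℝ) ^ (-k) := by
  rw [norm_zpow, norm_unif, inv_zpow, zpow_neg]

variable {F}

theorem exists_norm_eq {x : F} (hx : x ≠ 0) : ∃ k : ℤ, ‖x‖ = (q F : ℝ) ^ (-k) := by
  have key : ∀ y : F, y ≠ 0 → ‖y‖ ≤ 1 → ∃ k : ℤ, ‖y‖ = (q F : ℝ) ^ (-k) := by
    intro y hy h1
    have h0 : (⟨y, Valued.integer.mem_iff.mpr h1⟩ : 𝒪[F]) ≠ 0 := by
      intro h; exact hy (congrArg Subtype.val h)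
    obtain ⟨ϖ, hϖ⟩ := exists_uniformizer F
    obtain ⟨k, u, hk⟩ := IsDiscreteValuationRing.eq_unit_mul_pow_irreducible h0 hϖ
    refine ⟨k, ?_⟩
    have : y = ((u : 𝒪[F]) : F) * (ϖ : F) ^ k := by
      have := congrArg Subtype.val hk
      simpa using this
    rw [this, norm_mul, norm_pow, OddNormalized.norm_irreducible ϖ hϖ]
    simp
  rcases le_total ‖x‖ 1 with h | h
  · exact key x hx h
  · obtain ⟨k, hk⟩ := key x⁻¹ (inv_ne_zero hx) (by rw [norm_inv]; exact inv_le_one_of_one_le₀ h)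
    refine ⟨-k, ?_⟩
    rw [norm_inv] at hk
    rw [← inv_inv ‖x‖, hk, ← zpow_neg]

open Classical in
/-- The normalized valuation of `F`, with junk value at `0`. -/
def ord (x : F) : ℤ := if h : x = 0 then 0 else (exists_norm_eq h).choose

theorem norm_eq_ord {x : F} (hx : x ≠ 0) : ‖x‖ = (q F : ℝ) ^ (-ord x) := by
  rw [ord, dif_neg hx]; exact (exists_norm_eq hx).choose_spec

theorem q_zpow_inj {a b : ℤ} : (q F : ℝ) ^ (-a) = (q F : ℝ) ^ (-b) ↔ a = b := by
  rw [zpow_right_inj₀ (q_pos F) (one_lt_q_real F).ne']; exact neg_inj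

theorem q_zpow_le {a b : ℤ} : (q F : ℝ) ^ (-a) ≤ (q F : ℝ) ^ (-b) ↔ b ≤ a := by
  rw [zpow_le_zpow_iff_right₀ (one_lt_q_real F)]; exact neg_le_neg_iff

theorem ord_eq_of_norm {x : F} {k : ℤ} (h : ‖x‖ = (q F : ℝ) ^ (-k)) : ord x = k := by
  have hx : x ≠ 0 := by
    rw [← norm_ne_zero_iff, h]; exact zpow_ne_zero _ (q_pos F).ne'
  rw [norm_eq_ord hx] at h
  exact q_zpow_inj.mp h

theorem ord_mul {x y : F} (hx : x ≠ 0) (hy : y ≠ 0) : ord (x * y) = ord x + ord y := by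
  apply ord_eq_of_norm
  rw [norm_mul, norm_eq_ord hx, norm_eq_ord hy, ← zpow_add₀ (q_pos F).ne']
  congr 1; ring

theorem ord_inv {x : F} (hx : x ≠ 0) : ord x⁻¹ = -ord x := by
  apply ord_eq_of_norm
  rw [norm_inv, norm_eq_ord hx, ← zpow_neg]

theorem ord_div {x y : F} (hx : x ≠ 0) (hy : y ≠ 0) : ord (x / y) = ord x - ord y := by
  rw [div_eq_mul_inv, ord_mul hx (inv_ne_zero hy), ord_inv hy, sub_eq_add_neg]

theorem ord_pow {x : F} (hx : x ≠ 0) (k : ℕ) : ord (x ^ k) = k * ord x := by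
  apply ord_eq_of_norm
  rw [norm_pow, norm_eq_ord hx, ← zpow_natCast, ← zpow_mul]
  congr 1; ring

theorem ord_unif_zpow (k : ℤ) : ord (unif F ^ k) = k := ord_eq_of_norm (norm_unif_zpow F k)

theorem ord_unif : ord (unif F) = 1 := by simpa using ord_unif_zpow (F := F) 1

theorem ord_eq_zero_of_norm {x : F} (h : ‖x‖ = 1) : ord x = 0 := ord_eq_of_norm (by simpa using h)

theorem norm_eq_one_of_ord {x : F} (hx : x ≠ 0) (h : ord x = 0) : ‖x‖ = 1 := by
  rw [norm_eq_ord hx, h]; simp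

theorem ord_neg (x : F) : ord (-x) = ord x := by
  by_cases hx : x = 0
  · simp [hx]
  · exact ord_eq_of_norm (by rw [norm_neg, norm_eq_ord hx])

theorem mem_primePow {x : F} {k : ℤ} : x ∈ primePow F k ↔ ‖x‖ ≤ (q F : ℝ) ^ (-k) := Iff.rfl

theorem mem_primePow_iff {x : F} (hx : x ≠ 0) {k : ℤ} : x ∈ primePow F k ↔ k ≤ ord x := by
  rw [mem_primePow, norm_eq_ord hx, q_zpow_le]

theorem primePow_anti {j k : ℤ} (h : j ≤ k) : primePow F k ⊆ primePow F j :=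
  fun _ hx => le_trans hx (q_zpow_le.mpr h)

theorem zero_mem_primePow (k : ℤ) : (0 : F) ∈ primePow F k := by
  simp only [primePow, Set.mem_ofPred_eq, norm_zero]; positivity

theorem add_mem_primePow {x y : F} {k : ℤ} (hx : x ∈ primePow F k) (hy : y ∈ primePow F k) :
    x + y ∈ primePow F k :=
  (IsUltrametricDist.norm_add_le_max x y).trans (max_le hx hy)

theorem neg_mem_primePow {x : F} {k : ℤ} (hx : x ∈ primePow F k) : -x ∈ primePow F k := by
  simpa [primePow] using hx

theorem sub_mem_primePow {x y : F} {k : ℤ} (hx : x ∈ primePow F k) (hy : y ∈ primePow F k) :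
    x - y ∈ primePow F k := by
  rw [sub_eq_add_neg]; exact add_mem_primePow hx (neg_mem_primePow hy)

theorem mul_mem_primePow {x y : F} {j k l : ℤ} (hx : x ∈ primePow F j) (hy : y ∈ primePow F k)
    (h : l ≤ j + k) : x * y ∈ primePow F l := by
  refine primePow_anti h ?_
  have : (q F : ℝ) ^ (-(j + k)) = (q F : ℝ) ^ (-j) * (q F : ℝ) ^ (-k) := by
    rw [← zpow_add₀ (q_pos F).ne']; congr 1; ring
  simp only [primePow, Set.mem_ofPred_eq, norm_mul] at *
  rw [this]
  gcongr

theorem mem_primePow_ord (x : F) : x ∈ primePow F (ord x) := by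
  by_cases hx : x = 0
  · rw [hx]; exact zero_mem_primePow _
  · exact (mem_primePow_iff hx).mpr le_rfl

theorem mem_primePow_zero {x : F} : x ∈ primePow F 0 ↔ ‖x‖ ≤ 1 := by simp [primePow]

theorem mem_primePow_one {x : F} : x ∈ primePow F 1 ↔ ‖x‖ < 1 := by
  by_cases hx : x = 0
  · simp [hx, zero_mem_primePow]
  · rw [mem_primePow_iff hx, norm_eq_ord hx]
    have : (q F : ℝ) ^ (-ord x) < 1 ↔ ¬ (q F : ℝ) ^ (-(0:ℤ)) ≤ (q F : ℝ) ^ (-ord x) := by simp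
    rw [this, q_zpow_le]; omega

theorem mem_primePow_of_scale {x y : F} (hx : x ≠ 0) {k : ℤ} :
    x * y ∈ primePow F k ↔ y ∈ primePow F (k - ord x) := by
  by_cases hy : y = 0
  · simp [hy, zero_mem_primePow]
  · rw [mem_primePow_iff (mul_ne_zero hx hy), mem_primePow_iff hy, ord_mul hx hy]; omega

theorem two_ne_zero_residue : (2 : 𝓀[F]) ≠ 0 := Ring.two_ne_zero OddNormalized.ringChar_ne_two

theorem norm_two : ‖(2 : F)‖ = 1 := by
  have h : IsUnit (2 : 𝒪[F]) := by
    rw [← IsLocalRing.residue_ne_zero_iff_isUnit, map_ofNat]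
    exact two_ne_zero_residue
  have := Valued.integer.isUnit_iff_norm_eq_one.mp h
 
  exact this

theorem two_ne_zero' : (2 : F) ≠ 0 := norm_ne_zero_iff.mp (by rw [norm_two]; exact one_ne_zero)

theorem ord_two : ord (2 : F) = 0 := ord_eq_zero_of_norm norm_two

theorem isSquare_of_norm_sub_one_lt {u : F} (hu : ‖u - 1‖ < 1) : IsSquare u := by
  set s : Set F := {x : F | x - 1 ∈ primePow F 1}
  have hu' : u - 1 ∈ primePow F 1 := mem_primePow_one.mpr hu
  have hs : IsComplete s := by
    have : s = (fun x : F => x - 1) ⁻¹' Metric.closedBall 0 ((q F : ℝ) ^ (-(1 : ℤ))) := by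
      ext x; simp [s, primePow]
    rw [this]
    exact (Metric.isClosed_closedBall.preimage (by fun_prop)).isComplete
  let f : F → F := fun x => x - (x ^ 2 - u) / 2
  have hhalf : ∀ {x : F}, x ∈ primePow F 1 → x / 2 ∈ primePow F 1 := by
    intro x hx
    simpa [primePow, norm_two] using hx
  have hf : Set.MapsTo f s s := by
    intro x hx
    have h1 : x ^ 2 - u = (x - 1) * (x - 1) + (x - 1) + (x - 1) - (u - 1) := by ring
    have h2 : x ^ 2 - u ∈ primePow F 1 := by
      rw [h1]
      refine sub_mem_primePow (add_mem_primePow (add_mem_primePow ?_ hx) hx) hu'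
      exact mul_mem_primePow hx hx (by norm_num)
    have h3 : f x - 1 = (x - 1) - (x ^ 2 - u) / 2 := by simp only [f]; ring
    change f x - 1 ∈ primePow F 1
    rw [h3]
    exact sub_mem_primePow hx (hhalf h2)
  have hq : (q F : ℝ)⁻¹ < 1 := inv_lt_one_of_one_lt₀ (one_lt_q_real F)
  have hc : ContractingWith ⟨(q F : ℝ)⁻¹, by positivity⟩ (hf.restrict f s s) := by
    refine ⟨by exact_mod_cast hq, LipschitzWith.of_dist_le_mul fun x y => ?_⟩
    have e : f x - f y = -((((x : F) - 1) + ((y : F) - 1)) / 2) * (x - y) := by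
      simp only [f]; field_simp [two_ne_zero' (F := F)]; ring
    have h1 : ((x : F) - 1 + ((y : F) - 1)) / 2 ∈ primePow F 1 := hhalf (add_mem_primePow x.2 y.2)
    change dist (f x) (f y) ≤ (q F : ℝ)⁻¹ * dist (x : F) y
    rw [dist_eq_norm, dist_eq_norm, e, norm_mul, norm_neg]
    gcongr
    simpa [primePow] using h1
  obtain ⟨y, -, hy, -⟩ := hc.exists_fixedPoint' hs hf (x := 1)
    (by simp [s, zero_mem_primePow]) (edist_ne_top _ _)
  refine ⟨y, ?_⟩
  have h1 : y - (y ^ 2 - u) / 2 = y := hy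
  have h2 : (y ^ 2 - u) / 2 = 0 := by linear_combination -h1
  rw [div_eq_zero_iff] at h2
  rcases h2 with h2 | h2
  · linear_combination -h2
  · exact absurd h2 two_ne_zero'

end Basic

/-! ### Reduction, quadratic residues and the Hilbert symbol -/

section Residue

variable {F : Type*} [NontriviallyNormedField F] [IsUltrametricDist F] [ProperSpace F]
  [OddNormalized F]

instance fintypeResidueField : Fintype 𝓀[F] := Fintype.ofFinite _

theorem exists_unit_eq {u : F} (hu : ‖u‖ = 1) : ∃ v : 𝒪[F]ˣ, ((v : 𝒪[F]) : F) = u := by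
  have h : IsUnit (⟨u, Valued.integer.mem_iff.mpr hu.le⟩ : 𝒪[F]) :=
    Valued.integer.isUnit_iff_norm_eq_one.mpr hu
  exact ⟨h.unit, rfl⟩

open Classical in
/-- Reduction modulo the maximal ideal, extended by `0`. -/
def red (x : F) : 𝓀[F] :=
  if h : ‖x‖ ≤ 1 then IsLocalRing.residue _ (⟨x, Valued.integer.mem_iff.mpr h⟩ : 𝒪[F]) else 0

theorem red_coe (x : 𝒪[F]) : red (x : F) = IsLocalRing.residue _ x := by
  rw [red, dif_pos (Valued.integer.mem_iff.mp x.2)]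

theorem exists_red_eq (r : 𝓀[F]) : ∃ x : F, ‖x‖ ≤ 1 ∧ red x = r := by
  obtain ⟨x, rfl⟩ := IsLocalRing.residue_surjective r
  exact ⟨x, Valued.integer.mem_iff.mp x.2, red_coe x⟩

theorem red_add {x y : F} (hx : ‖x‖ ≤ 1) (hy : ‖y‖ ≤ 1) : red (x + y) = red x + red y := by
  lift x to 𝒪[F] using Valued.integer.mem_iff.mpr hx
  lift y to 𝒪[F] using Valued.integer.mem_iff.mpr hy
  rw [← Subring.coe_add, red_coe, red_coe, red_coe, map_add]

theorem red_mul {x y : F} (hx : ‖x‖ ≤ 1) (hy : ‖y‖ ≤ 1) : red (x * y) = red x * red y := by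
  lift x to 𝒪[F] using Valued.integer.mem_iff.mpr hx
  lift y to 𝒪[F] using Valued.integer.mem_iff.mpr hy
  rw [← Subring.coe_mul, red_coe, red_coe, red_coe, map_mul]

theorem red_one : red (1 : F) = 1 := by
  rw [← Subring.coe_one, red_coe, map_one]

theorem red_eq_zero_iff {x : F} (hx : ‖x‖ ≤ 1) : red x = 0 ↔ ‖x‖ < 1 := by
  lift x to 𝒪[F] using Valued.integer.mem_iff.mpr hx
  rw [red_coe, IsLocalRing.residue_eq_zero_iff, IsLocalRing.mem_maximalIdeal, mem_nonunits_iff,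
    Valued.integer.isUnit_iff_norm_eq_one]
  exact ⟨fun h => lt_of_le_of_ne hx h, fun h => h.ne⟩

theorem red_sub {x y : F} (hx : ‖x‖ ≤ 1) (hy : ‖y‖ ≤ 1) : red (x - y) = red x - red y := by
  lift x to 𝒪[F] using Valued.integer.mem_iff.mpr hx
  lift y to 𝒪[F] using Valued.integer.mem_iff.mpr hy
  rw [← AddSubgroupClass.coe_sub, red_coe, red_coe, red_coe, map_sub]

theorem red_eq_iff {x y : F} (hx : ‖x‖ ≤ 1) (hy : ‖y‖ ≤ 1) : red x = red y ↔ ‖x - y‖ < 1 := by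
  rw [← sub_eq_zero, ← red_sub hx hy, red_eq_zero_iff]
  rw [sub_eq_add_neg]
  exact (IsUltrametricDist.norm_add_le_max _ _).trans (max_le hx (by rwa [norm_neg]))

theorem red_ne_zero_iff {x : F} (hx : ‖x‖ ≤ 1) : red x ≠ 0 ↔ ‖x‖ = 1 := by
  rw [Ne, red_eq_zero_iff hx, not_lt]
  exact ⟨fun h => le_antisymm hx h, fun h => h.ge⟩

theorem isSquare_iff_red {d : F} (hd : ‖d‖ = 1) : IsSquare d ↔ IsSquare (red d) := by
  constructor
  · rintro ⟨e, rfl⟩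
    have he : ‖e‖ ≤ 1 := by
      rw [norm_mul] at hd
      nlinarith [norm_nonneg e]
    exact ⟨red e, red_mul he he⟩
  · rintro ⟨r, hr⟩
    obtain ⟨e, he, rfl⟩ := exists_red_eq r
    have he2 : ‖e * e‖ ≤ 1 := by rw [norm_mul]; exact mul_le_one₀ he (norm_nonneg _) he
    rw [← red_mul he he, red_eq_iff hd.le he2] at hr
    have h1 : ‖e * e‖ = 1 := by
      have hne : red (e * e) ≠ 0 := by
        rw [← (red_eq_iff hd.le he2).mpr hr]; exact (red_ne_zero_iff hd.le).mpr hd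
      exact (red_ne_zero_iff he2).mp hne
    have h0 : e * e ≠ 0 := norm_ne_zero_iff.mp (by rw [h1]; exact one_ne_zero)
    obtain ⟨f, hf⟩ := isSquare_of_norm_sub_one_lt (u := d / (e * e)) (by
      have : d / (e * e) - 1 = (d - e * e) / (e * e) := by rw [sub_div, div_self h0]
      rw [this, norm_div, h1, div_one]; exact hr)
    rw [div_eq_iff h0] at hf
    exact ⟨f * e, by rw [hf]; ring⟩

open Classical in
/-- The quadratic residue symbol of a unit of `𝒪`. -/
def leg (d : F) : ℤˣ := if IsSquare d then 1 else -1

open Classical in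
theorem leg_eq_quadraticChar {d : F} (hd : ‖d‖ = 1) :
    ((leg d : ℤˣ) : ℤ) = quadraticChar 𝓀[F] (red d) := by
  have h0 : red d ≠ 0 := (red_ne_zero_iff hd.le).mpr hd
  by_cases h : IsSquare d
  · rw [leg, if_pos h, (quadraticChar_one_iff_isSquare h0).mpr ((isSquare_iff_red hd).mp h)]; rfl
  · rw [leg, if_neg h, quadraticChar_neg_one_iff_not_isSquare.mpr fun h' =>
      h ((isSquare_iff_red hd).mpr h')]; rfl

theorem leg_mul {d e : F} (hd : ‖d‖ = 1) (he : ‖e‖ = 1) : leg (d * e) = leg d * leg e := by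
  classical
  apply Units.ext
  rw [Units.val_mul, leg_eq_quadraticChar (by rw [norm_mul, hd, he, one_mul]),
    leg_eq_quadraticChar hd, leg_eq_quadraticChar he, red_mul hd.le he.le, map_mul]

theorem leg_one : leg (1 : F) = 1 := if_pos ⟨1, by simp⟩

theorem leg_inv (d : F) : leg d⁻¹ = leg d := by
  have h : IsSquare d⁻¹ ↔ IsSquare d :=
    ⟨fun h => by simpa using h.inv, fun h => h.inv⟩
  by_cases hd : IsSquare d
  · rw [leg, leg, if_pos hd, if_pos (h.mpr hd)]
  · rw [leg, leg, if_neg hd, if_neg fun h' => hd (h.mp h')]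

theorem exists_nonsquare_unit : ∃ d : F, ‖d‖ = 1 ∧ ¬ IsSquare d := by
  obtain ⟨r, hr⟩ := FiniteField.exists_nonsquare (F := 𝓀[F]) OddNormalized.ringChar_ne_two
  obtain ⟨d, hd, rfl⟩ := exists_red_eq r
  have h1 : ‖d‖ = 1 := by
    rw [← red_ne_zero_iff hd]; rintro h; rw [h] at hr; exact hr ⟨0, by simp⟩
  exact ⟨d, h1, fun h => hr ((isSquare_iff_red h1).mp h)⟩

/-- The norm form of the unramified quadratic extension is anisotropic modulo `𝔭`. -/
theorem norm_sq_sub_mul_sq {d : F} (hd : ‖d‖ = 1) (hn : ¬ IsSquare d) (z y : F) :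
    ‖z ^ 2 - d * y ^ 2‖ = max ‖z‖ ‖y‖ ^ 2 := by
  have key : ∀ v : F, ‖v ^ 2 - d‖ = max ‖v‖ 1 ^ 2 := by
    intro v
    rcases lt_trichotomy ‖v‖ 1 with h | h | h
    · have h2 : ‖v ^ 2‖ < ‖d‖ := by rw [hd, norm_pow]; exact pow_lt_one₀ (norm_nonneg _) h two_ne_zero
      rw [sub_eq_add_neg, IsUltrametricDist.norm_add_eq_max_of_norm_ne_norm (by rw [norm_neg]; exact h2.ne), norm_neg, max_eq_right h2.le, hd,
        max_eq_right h.le, one_pow]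
    · have h2 : ‖v ^ 2‖ = 1 := by rw [norm_pow, h, one_pow]
      rw [h, max_self, one_pow]
      by_contra hne
      have hle : ‖v ^ 2 - d‖ ≤ 1 := by
        rw [sub_eq_add_neg]
        exact (IsUltrametricDist.norm_add_le_max _ _).trans (by rw [norm_neg, h2, hd, max_self])
      have hlt := lt_of_le_of_ne hle hne
      apply hn
      rw [isSquare_iff_red hd]
      refine ⟨red v, ?_⟩
      rw [← red_mul h.le h.le, ← pow_two]
      exact ((red_eq_iff h2.le hd.le).mpr hlt).symm
    · have h2 : ‖d‖ < ‖v ^ 2‖ := by rw [hd, norm_pow]; exact one_lt_pow₀ h two_ne_zero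
      rw [sub_eq_add_neg, IsUltrametricDist.norm_add_eq_max_of_norm_ne_norm (by rw [norm_neg]; exact h2.ne'), norm_neg, max_eq_left h2.le, norm_pow,
        max_eq_left h.le]
  by_cases hy : y = 0
  · simp [hy]
  · have e : z ^ 2 - d * y ^ 2 = ((z / y) ^ 2 - d) * y ^ 2 := by field_simp
    rw [e, norm_mul, key, norm_pow, ← mul_pow, max_mul_of_nonneg _ _ (norm_nonneg y), norm_div,
      div_mul_cancel₀ _ (norm_ne_zero_iff.mpr hy), one_mul]

theorem sq_sub_mul_sq_ne_zero {d : F} (hd : ‖d‖ = 1) (hn : ¬ IsSquare d) {z y : F}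
    (h : z ≠ 0 ∨ y ≠ 0) : z ^ 2 - d * y ^ 2 ≠ 0 := by
  rw [← norm_ne_zero_iff, norm_sq_sub_mul_sq hd hn]
  apply pow_ne_zero
  rcases h with h | h
  · exact (lt_max_of_lt_left (norm_pos_iff.mpr h)).ne'
  · exact (lt_max_of_lt_right (norm_pos_iff.mpr h)).ne'

theorem even_ord_sq_sub_mul_sq {d : F} (hd : ‖d‖ = 1) (hn : ¬ IsSquare d) {z y : F}
    (h : z ≠ 0 ∨ y ≠ 0) : Even (ord (z ^ 2 - d * y ^ 2)) := by
  have h1 := norm_sq_sub_mul_sq hd hn z y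
  obtain ⟨v, hv0, hv⟩ : ∃ v : F, v ≠ 0 ∧ ‖v‖ = max ‖z‖ ‖y‖ := by
    rcases le_total ‖z‖ ‖y‖ with hzy | hzy
    · refine ⟨y, ?_, (max_eq_right hzy).symm⟩
      rintro rfl
      rw [norm_zero] at hzy
      have := norm_le_zero_iff.mp hzy
      simp_all
    · refine ⟨z, ?_, (max_eq_left hzy).symm⟩
      rintro rfl
      rw [norm_zero] at hzy
      have := norm_le_zero_iff.mp hzy
      simp_all
  rw [← hv] at h1
  have : ord (z ^ 2 - d * y ^ 2) = ord (v ^ 2) := by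
    apply ord_eq_of_norm; rw [h1, ← norm_pow, norm_eq_ord (pow_ne_zero 2 hv0)]
  rw [this, ord_pow hv0]
  exact even_two_mul _

theorem hilbert_comm {K : Type*} [Field K] (a b : K) : hilbert a b = hilbert b a := by
  unfold hilbert
  congr 1
  rw [eq_iff_iff]
  constructor <;>
  · rintro ⟨x, y, z, h, e⟩
    exact ⟨y, x, z, by tauto, by rw [e]; ring⟩

theorem hilbert_mul_sq {K : Type*} [Field K] (a b : K) {c : K} (hc : c ≠ 0) :
    hilbert (a * c ^ 2) b = hilbert a b := by
  unfold hilbert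
  congr 1
  rw [eq_iff_iff]
  constructor
  · rintro ⟨x, y, z, h, e⟩
    refine ⟨c * x, y, z, ?_, by rw [e]; ring⟩
    simpa [hc] using h
  · rintro ⟨x, y, z, h, e⟩
    refine ⟨x / c, y, z, ?_, by rw [e]; field_simp⟩
    simpa [hc] using h

theorem hilbert_unit_unit {u d : F} (hu : ‖u‖ = 1) (hd : ‖d‖ = 1) : hilbert u d = 1 := by
  have hu0 : red u ≠ 0 := (red_ne_zero_iff hu.le).mpr hu
  have hd0 : red d ≠ 0 := (red_ne_zero_iff hd.le).mpr hd
  have hodd : Fintype.card 𝓀[F] % 2 = 1 :=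
    FiniteField.odd_card_of_char_ne_two OddNormalized.ringChar_ne_two
  obtain ⟨a, b, hab⟩ := FiniteField.exists_root_sum_quadratic
    (f := Polynomial.C (red u) * Polynomial.X ^ 2)
    (g := Polynomial.C (red d) * Polynomial.X ^ 2 - Polynomial.C 1)
    (by rw [Polynomial.degree_C_mul_X_pow 2 hu0]; rfl)
    (by
      rw [Polynomial.degree_sub_C, Polynomial.degree_C_mul_X_pow 2 hd0]
      · rfl
      · rw [Polynomial.degree_C_mul_X_pow 2 hd0]; norm_num) hodd
  simp only [Polynomial.eval_mul, Polynomial.eval_C, Polynomial.eval_pow, Polynomial.eval_X,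
    Polynomial.eval_sub] at hab
  obtain ⟨x, hx, rfl⟩ := exists_red_eq a
  obtain ⟨y, hy, rfl⟩ := exists_red_eq b
  have hx2 : ‖x * x‖ ≤ 1 := by rw [norm_mul]; exact mul_le_one₀ hx (norm_nonneg _) hx
  have hy2 : ‖y * y‖ ≤ 1 := by rw [norm_mul]; exact mul_le_one₀ hy (norm_nonneg _) hy
  have hux : ‖u * (x * x)‖ ≤ 1 := by rw [norm_mul, hu, one_mul]; exact hx2
  have hdy : ‖d * (y * y)‖ ≤ 1 := by rw [norm_mul, hd, one_mul]; exact hy2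
  have h1 : red (u * (x * x) + d * (y * y)) = red 1 := by
    rw [red_add hux hdy, red_mul hu.le hx2, red_mul hd.le hy2, red_mul hx hx, red_mul hy hy,
      red_one]
    linear_combination hab
  rw [red_eq_iff ((IsUltrametricDist.norm_add_le_max _ _).trans (max_le hux hdy))
    norm_one.le] at h1
  obtain ⟨z, hz⟩ := isSquare_of_norm_sub_one_lt h1
  refine if_pos ⟨x, y, z, ?_, by rw [pow_two, ← hz]; ring⟩
  by_contra hcon
  push Not at hcon
  obtain ⟨rfl, rfl, rfl⟩ := hcon
  simp at h1

theorem exists_eq_unif_sq_mul {x : F} (hx : x ≠ 0) :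
    ∃ u c : F, c ≠ 0 ∧ ((Even (ord x) ∧ ‖u‖ = 1 ∧ x = u * c ^ 2) ∨
      (Odd (ord x) ∧ ord u = 1 ∧ u ≠ 0 ∧ x = u * c ^ 2)) := by
  have hϖ := unif_ne_zero F
  rcases Int.even_or_odd (ord x) with ⟨j, hj⟩ | ⟨j, hj⟩
  · have hc : unif F ^ j ≠ 0 := zpow_ne_zero _ hϖ
    have hc2 := pow_ne_zero 2 hc
    refine ⟨x / (unif F ^ j) ^ 2, unif F ^ j, hc, Or.inl ⟨⟨j, hj⟩, ?_, by field_simp⟩⟩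
    apply norm_eq_one_of_ord (div_ne_zero hx hc2)
    rw [ord_div hx hc2, ord_pow hc, ord_unif_zpow]; push_cast; omega
  · have hc : unif F ^ j ≠ 0 := zpow_ne_zero _ hϖ
    have hc2 := pow_ne_zero 2 hc
    refine ⟨x / (unif F ^ j) ^ 2, unif F ^ j, hc, Or.inr ⟨⟨j, hj⟩, ?_, div_ne_zero hx hc2,
      by field_simp⟩⟩
    rw [ord_div hx hc2, ord_pow hc, ord_unif_zpow]; push_cast; omega

/-- The tame Hilbert symbol when one of the arguments is a unit. -/
theorem hilbert_unit_right {x d : F} (hx : x ≠ 0) (hd : ‖d‖ = 1) :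
    hilbert x d = leg d ^ ord x := by
  by_cases hs : IsSquare d
  · obtain ⟨e, rfl⟩ := hs
    rw [leg, if_pos ⟨e, rfl⟩, one_zpow]
    exact if_pos ⟨0, 1, e, by simp, by ring⟩
  · rw [leg, if_neg hs]
    obtain ⟨u, c, hc, ⟨hev, hu, e⟩ | ⟨hodd, hu, hu0, e⟩⟩ := exists_eq_unif_sq_mul hx
    · rw [hev.neg_one_zpow, e, hilbert_mul_sq _ _ hc, hilbert_unit_unit hu hd]
    · rw [hodd.neg_one_zpow]
      refine if_neg ?_
      rintro ⟨a, b, z, h, e2⟩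
      have e3 : z ^ 2 - d * b ^ 2 = x * a ^ 2 := by rw [e2]; ring
      by_cases hzb : z ≠ 0 ∨ b ≠ 0
      · have h1 := even_ord_sq_sub_mul_sq hd hs hzb
        have h2 := sq_sub_mul_sq_ne_zero hd hs hzb
        rw [e3] at h1 h2
        have ha : a ≠ 0 := by rintro rfl; simp at h2
        rw [ord_mul hx (pow_ne_zero 2 ha), ord_pow ha] at h1
        have h3 : Odd (ord x + (2 : ℕ) * ord a) := hodd.add_even (by
          push_cast; exact even_two_mul _)
        exact (Int.not_even_iff_odd.mpr h3) h1
      · push Not at hzb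
        obtain ⟨rfl, rfl⟩ := hzb
        have ha : a ≠ 0 := by simpa using h
        have : x * a ^ 2 = 0 := by rw [← e3]; ring
        exact mul_ne_zero hx (pow_ne_zero 2 ha) this

theorem hilbert_unit_left {x d : F} (hx : x ≠ 0) (hd : ‖d‖ = 1) :
    hilbert d x = leg d ^ ord x := by
  rw [hilbert_comm, hilbert_unit_right hx hd]

/-- The symbol `(x, -ϖ)_2` for a uniformizer `ϖ`. -/
theorem hilbert_neg_unif {ϖ u : F} (hϖ0 : ϖ ≠ 0) (hϖ : ord ϖ = 1) (hu : ‖u‖ = 1) (k : ℤ) :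
    hilbert (ϖ ^ k * u) (-ϖ) = leg u := by
  have hu0 : u ≠ 0 := norm_ne_zero_iff.mp (by rw [hu]; exact one_ne_zero)
  rcases Int.even_or_odd k with ⟨j, rfl⟩ | ⟨j, rfl⟩
  · have e : ϖ ^ (j + j) * u = u * (ϖ ^ j) ^ 2 := by rw [zpow_add₀ hϖ0]; ring
    rw [e, hilbert_mul_sq _ _ (zpow_ne_zero _ hϖ0), hilbert_unit_left (neg_ne_zero.mpr hϖ0) hu,
      ord_neg, hϖ, zpow_one]
  · have e : ϖ ^ (2 * j + 1) * u = (ϖ * u) * (ϖ ^ j) ^ 2 := by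
      rw [zpow_add₀ hϖ0, zpow_one, two_mul, zpow_add₀ hϖ0]; ring
    rw [e, hilbert_mul_sq _ _ (zpow_ne_zero _ hϖ0)]
    by_cases hs : IsSquare u
    · obtain ⟨v, rfl⟩ := hs
      rw [leg, if_pos ⟨v, rfl⟩]
      exact if_pos ⟨1, v, 0, by simp, by ring⟩
    · rw [leg, if_neg hs]
      refine if_neg ?_
      rintro ⟨a, b, z, h, e2⟩
      have e3 : z ^ 2 = -ϖ * (b ^ 2 - u * a ^ 2) := by rw [e2]; ring
      by_cases hba : b ≠ 0 ∨ a ≠ 0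
      · have h1 := even_ord_sq_sub_mul_sq hu hs hba
        have h2 := sq_sub_mul_sq_ne_zero hu hs hba
        have hz : z ≠ 0 := by
          rintro rfl
          exact mul_ne_zero (neg_ne_zero.mpr hϖ0) h2 (by rw [← e3]; ring)
        have h3 := congrArg ord e3
        rw [ord_pow hz, ord_mul (neg_ne_zero.mpr hϖ0) h2, ord_neg, hϖ] at h3
        obtain ⟨l, hl⟩ := h1
        rw [hl] at h3
        push_cast at h3
        omega
      · push Not at hba
        obtain ⟨rfl, rfl⟩ := hba
        have hz : z ≠ 0 := by simpa using h
        exact pow_ne_zero 2 hz (by rw [e3]; ring)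

end Residue

/-! ### Quadratic characters and conductors -/

section Characters

variable {F : Type*} [NontriviallyNormedField F] [IsUltrametricDist F] [ProperSpace F]
  [OddNormalized F]

theorem leg_eq_one_or (d : F) : leg d = 1 ∨ leg d = -1 := Int.units_eq_one_or _

theorem isSquare_of_leg {d : F} (h : leg d = 1) : IsSquare d := by
  by_contra hn
  rw [leg, if_neg hn] at h
  exact absurd h (by decide)

theorem eq_one_or_neg_one_of_sq {χ : Fˣ →* ℂˣ} (hχ : χ ^ 2 = 1) (x : Fˣ) :
    χ x = 1 ∨ χ x = -1 := by
  have h : χ x ^ 2 = 1 := DFunLike.congr_fun hχ x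
  have h2 : ((χ x : ℂˣ) : ℂ) * (χ x : ℂˣ) = 1 := by
    rw [← pow_two, ← Units.val_pow_eq_pow_val, h, Units.val_one]
  rcases mul_self_eq_one_iff.mp h2 with h3 | h3
  · exact Or.inl (Units.ext h3)
  · exact Or.inr (Units.ext h3)

theorem apply_eq_one_of_isSquare {χ : Fˣ →* ℂˣ} (hχ : χ ^ 2 = 1) {x : Fˣ}
    (hx : IsSquare (x : F)) : χ x = 1 := by
  obtain ⟨y, hy⟩ := hx
  have hy0 : y ≠ 0 := by rintro rfl; exact x.ne_zero (by simp at hy)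
  have : x = (Units.mk0 y hy0) ^ 2 := by ext; simp [hy, pow_two]
  rw [this, map_pow]
  exact DFunLike.congr_fun hχ _

/-- Every quadratic or trivial character is given by the Hilbert symbol. -/
theorem exists_isHilbertChar {χ : Fˣ →* ℂˣ} (hχ : χ ^ 2 = 1) : ∃ a : Fˣ, IsHilbertChar χ a := by
  obtain ⟨d, hd, hds⟩ := exists_nonsquare_unit (F := F)
  have hd0 : d ≠ 0 := norm_ne_zero_iff.mp (by rw [hd]; exact one_ne_zero)
  have hlegd : leg d = -1 := if_neg hds
  set D : Fˣ := Units.mk0 d hd0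
  set P : Fˣ := Units.mk0 (unif F) (unif_ne_zero F)
  have hunit : ∀ u : Fˣ, ‖(u : F)‖ = 1 → leg (u : F) = -1 → χ u = χ D := by
    intro u hu hl
    have h1 : χ (u * D) = 1 := by
      apply apply_eq_one_of_isSquare hχ
      apply isSquare_of_leg
      have hDv : (D : F) = d := rfl
      rw [Units.val_mul, hDv, leg_mul hu hd, hl, hlegd]
      rfl
    rw [map_mul] at h1
    rcases eq_one_or_neg_one_of_sq hχ D with h | h
    · rw [h, mul_one] at h1; rw [h1, h]
    · rw [h] at h1 ⊢
      rw [mul_neg, mul_one] at h1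
      rw [← h1, neg_neg]
  have hdec : ∀ p : Fˣ, ord (p : F) = 1 → ∀ x : Fˣ, ∃ u : Fˣ, ‖(u : F)‖ = 1 ∧ x = p ^ ord (x : F) * u := by
    intro p hp x
    have hx := norm_eq_ord x.ne_zero
    have hpn := norm_eq_ord p.ne_zero
    rw [hp] at hpn
    refine ⟨(p ^ ord (x : F))⁻¹ * x, ?_, by group⟩
    rw [Units.val_mul, norm_mul, Units.val_inv_eq_inv_val, norm_inv, Units.val_zpow_eq_zpow_val,
      norm_zpow, hpn, hx, ← zpow_mul, neg_one_mul]
    exact inv_mul_cancel₀ (zpow_ne_zero _ (q_pos F).ne')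
  have hP : ord (P : F) = 1 := ord_unif
  rcases eq_one_or_neg_one_of_sq hχ D with h | h
  · have hu1 : ∀ u : Fˣ, ‖(u : F)‖ = 1 → χ u = 1 := by
      intro u hu
      rcases leg_eq_one_or (u : F) with hl | hl
      · exact apply_eq_one_of_isSquare hχ (isSquare_of_leg hl)
      · rw [hunit u hu hl, h]
    rcases eq_one_or_neg_one_of_sq hχ P with h' | h'
    · refine ⟨1, fun x => ?_⟩
      obtain ⟨u, hu, hx⟩ := hdec P hP x
      rw [Units.val_one, hilbert_one_right, hx, map_mul, map_zpow, hu1 u hu, h']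
      simp
    · refine ⟨D, fun x => ?_⟩
      have e : hilbert (x : F) (D : F) = (-1) ^ ord (x : F) := by
        rw [hilbert_unit_right x.ne_zero (show ‖(D : F)‖ = 1 from hd)]; exact congrArg (· ^ ord (x : F)) hlegd
      obtain ⟨u, hu, hx⟩ := hdec P hP x
      rw [e, hx, map_mul, map_zpow, hu1 u hu, h', ← hx]
      rcases Int.even_or_odd (ord (x : F)) with hk | hk
      · simp [hk.neg_one_zpow]
      · simp [hk.neg_one_zpow]
  · obtain ⟨p, hp, hp1⟩ : ∃ p : Fˣ, ord (p : F) = 1 ∧ χ p = 1 := by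
      rcases eq_one_or_neg_one_of_sq hχ P with h' | h'
      · exact ⟨P, hP, h'⟩
      · refine ⟨P * D, ?_, by rw [map_mul, h, h']; simp⟩
        rw [Units.val_mul, ord_mul P.ne_zero D.ne_zero, hP, ord_eq_zero_of_norm (by exact hd),
          add_zero]
    refine ⟨-p, fun x => ?_⟩
    obtain ⟨u, hu, hx⟩ := hdec p hp x
    have e : hilbert (x : F) ((-p : Fˣ) : F) = leg (u : F) := by
      have := hilbert_neg_unif p.ne_zero hp hu (ord (x : F))
      rw [← this]
      congr 1
      conv_lhs => rw [hx]
      simp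
    rw [e, hx, map_mul, map_zpow, hp1, one_zpow, one_mul]
    rcases leg_eq_one_or (u : F) with hl | hl
    · rw [apply_eq_one_of_isSquare hχ (isSquare_of_leg hl), hl]; simp
    · rw [hunit u hu hl, h, hl]; simp

theorem coe_unit_ne_zero (u : 𝒪[F]ˣ) : ((u : 𝒪[F]) : F) ≠ 0 :=
  norm_ne_zero_iff.mp (by rw [Valued.integer.norm_coe_unit]; exact one_ne_zero)

theorem resUnits_eq_leg {χ : Fˣ →* ℂˣ} {a : Fˣ} (h : IsHilbertChar χ a) (u : 𝒪[F]ˣ) :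
    (resUnits χ u : ℂ) = (((leg ((u : 𝒪[F]) : F) ^ ord (a : F) : ℤˣ) : ℤ) : ℂ) := by
  rw [← hilbert_unit_left a.ne_zero (Valued.integer.norm_coe_unit u)]
  exact h _

theorem mem_units_primePow_zero (u : 𝒪[F]ˣ) :
    ((u : 𝒪[F]) : F) - 1 ∈ primePow F ((0 : ℕ) : ℤ) := by
  rw [Nat.cast_zero]
  refine sub_mem_primePow (mem_primePow_zero.mpr ?_) (mem_primePow_zero.mpr norm_one.le)
  exact (Valued.integer.norm_coe_unit u).le

theorem unitCond_le {η : 𝒪[F]ˣ →* ℂˣ} {k : ℕ}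
    (h : ∀ u : 𝒪[F]ˣ, ((u : 𝒪[F]) : F) - 1 ∈ primePow F k → η u = 1) : unitCond η ≤ k :=
  Nat.sInf_le h

theorem exists_of_lt_unitCond {η : 𝒪[F]ˣ →* ℂˣ} {k : ℕ} (h : k < unitCond η) :
    ∃ u : 𝒪[F]ˣ, ((u : 𝒪[F]) : F) - 1 ∈ primePow F k ∧ η u ≠ 1 := by
  by_contra hcon
  push Not at hcon
  exact absurd (unitCond_le hcon) (not_le.mpr h)

theorem eq_one_of_norm_pow_sub_one_lt {z : ℂ} (hmul : ∀ k : ℕ, ‖z ^ k - 1‖ < 1 / 2) : z = 1 := by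
  have hgrow : ∀ k : ℕ, (3 / 2 : ℝ) ^ k * ‖z - 1‖ ≤ ‖z ^ (2 ^ k) - 1‖ := by
    intro k
    induction k with
    | zero => simp
    | succ k ih =>
      set v := z ^ (2 ^ k) with hv
      have e : z ^ (2 ^ (k + 1)) - 1 = (v - 1) * (v + 1) := by
        rw [pow_succ, pow_mul, ← hv]; ring
      have hb : (3 / 2 : ℝ) ≤ ‖v + 1‖ := by
        have h1 := hmul (2 ^ k)
        rw [← hv] at h1
        have h2 : ‖(2 : ℂ)‖ ≤ ‖v + 1‖ + ‖v - 1‖ := by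
          have : (2 : ℂ) = (v + 1) - (v - 1) := by ring
          rw [this]; exact norm_sub_le _ _
        simp only [Complex.norm_ofNat] at h2
        linarith
      rw [e, norm_mul, pow_succ]
      nlinarith [norm_nonneg (v - 1), norm_nonneg (z - 1)]
  by_contra hne
  have hpos : 0 < ‖z - 1‖ := by rwa [norm_pos_iff, sub_ne_zero]
  obtain ⟨k, hk⟩ := pow_unbounded_of_one_lt (1 / ‖z - 1‖) (by norm_num : (1 : ℝ) < 3 / 2)
  have h1 := hgrow k
  have h2 := hmul (2 ^ k)
  rw [div_lt_iff₀ hpos] at hk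
  linarith

theorem pow_sub_one_mem_primePow {u : F} (hu : ‖u‖ ≤ 1) {k : ℤ} (h : u - 1 ∈ primePow F k) (l : ℕ) :
    u ^ l - 1 ∈ primePow F k := by
  induction l with
  | zero => simpa using zero_mem_primePow k
  | succ l ih =>
    have e : u ^ (l + 1) - 1 = u * (u ^ l - 1) + (u - 1) := by ring
    rw [e]
    exact add_mem_primePow (mul_mem_primePow (mem_primePow_zero.mpr hu) ih (by simp)) h

theorem exists_pow_lt {r : ℝ} (hr : 0 < r) : ∃ k : ℕ, (q F : ℝ) ^ (-(k : ℤ)) < r := by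
  obtain ⟨k, hk⟩ := exists_pow_lt_of_lt_one hr (inv_lt_one_of_one_lt₀ (one_lt_q_real F))
  exact ⟨k, by simpa using hk⟩

theorem isEmbedding_units : IsEmbedding (fun u : 𝒪[F]ˣ => ((u : 𝒪[F]) : F)) := by
  have := compactSpace_integer F
  have h : IsEmbedding (Units.val : 𝒪[F]ˣ → 𝒪[F]) := Units.isOpenEmbedding_val.isEmbedding
  exact IsEmbedding.subtypeVal.comp h

/-- A continuous character of `𝒪ˣ` has a finite conductor. -/
theorem unitCond_spec {η : 𝒪[F]ˣ →* ℂˣ} (hη : Continuous η) {u : 𝒪[F]ˣ}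
    (hu : ((u : 𝒪[F]) : F) - 1 ∈ primePow F (unitCond η)) : η u = 1 := by
  have hne : {k : ℕ | ∀ u : 𝒪[F]ˣ, ((u : 𝒪[F]) : F) - 1 ∈ primePow F k → η u = 1}.Nonempty := by
    have hc : Continuous fun u : 𝒪[F]ˣ => ‖((η u : ℂˣ) : ℂ) - 1‖ :=
      ((Units.continuous_val.comp hη).sub continuous_const).norm
    have h0 : ∀ᶠ u in 𝓝 (1 : 𝒪[F]ˣ), ‖((η u : ℂˣ) : ℂ) - 1‖ < 1 / 2 :=
      hc.continuousAt.eventually_lt continuousAt_const (by simp)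
    rw [isEmbedding_units.isInducing.nhds_eq_comap, eventually_comap,
      Metric.eventually_nhds_iff] at h0
    obtain ⟨r, hr, h⟩ := h0
    obtain ⟨k, hk⟩ := exists_pow_lt (F := F) hr
    refine ⟨k, fun u hu => Units.ext (eq_one_of_norm_pow_sub_one_lt fun l => ?_)⟩
    have h1 := pow_sub_one_mem_primePow (Valued.integer.norm_coe_unit u).le hu l
    have h2 := h (y := (((u ^ l : 𝒪[F]ˣ) : 𝒪[F]) : F)) (by
      rw [dist_eq_norm]
      exact lt_of_le_of_lt (by simpa using mem_primePow.mp h1) hk) (u ^ l) rfl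
    simpa using h2
  exact Nat.sInf_mem hne u hu

theorem unitCond_eq_zero_iff {η : 𝒪[F]ˣ →* ℂˣ} (hη : Continuous η) : unitCond η = 0 ↔ η = 1 := by
  constructor
  · intro h
    ext u
    rw [unitCond_spec hη (by rw [h]; exact mem_units_primePow_zero u)]; rfl
  · rintro rfl
    exact Nat.le_zero.mp (unitCond_le fun u _ => rfl)

theorem leg_eq_one_of_sub_one_mem {u : F} (hu : u - 1 ∈ primePow F 1) : leg u = 1 :=
  if_pos (isSquare_of_norm_sub_one_lt (mem_primePow_one.mp hu))

theorem resUnits_apply_of_sub_one_mem {χ : Fˣ →* ℂˣ} {a : Fˣ} (h : IsHilbertChar χ a) {u : 𝒪[F]ˣ}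
    (hu : ((u : 𝒪[F]) : F) - 1 ∈ primePow F 1) : resUnits χ u = 1 := by
  apply Units.ext
  rw [resUnits_eq_leg h, leg_eq_one_of_sub_one_mem hu]
  simp

theorem continuous_resUnits {χ : Fˣ →* ℂˣ} {a : Fˣ} (h : IsHilbertChar χ a) :
    Continuous (resUnits χ) := by
  apply continuous_of_continuousAt_one
  apply (continuousAt_const (y := (1 : ℂˣ))).congr
  have hc : Continuous fun u : 𝒪[F]ˣ => ‖((u : 𝒪[F]) : F) - 1‖ :=
    (isEmbedding_units.continuous.sub continuous_const).norm
  have h0 : ∀ᶠ u : 𝒪[F]ˣ in 𝓝 1, ‖((u : 𝒪[F]) : F) - 1‖ < 1 :=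
    hc.continuousAt.eventually_lt continuousAt_const (by simp)
  filter_upwards [h0] with u hu
  exact (resUnits_apply_of_sub_one_mem h (mem_primePow_one.mpr hu)).symm

/-- The conductor of `χ_a` is the parity of the valuation of `a`. -/
theorem unitCond_resUnits {χ : Fˣ →* ℂˣ} {a : Fˣ} (h : IsHilbertChar χ a) :
    (unitCond (resUnits χ) : ℤ) = ord (a : F) % 2 := by
  have hle : unitCond (resUnits χ) ≤ 1 :=
    unitCond_le fun u hu => resUnits_apply_of_sub_one_mem h (by simpa using hu)
  have h0 : unitCond (resUnits χ) = 0 ↔ Even (ord (a : F)) := by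
    rw [unitCond_eq_zero_iff (continuous_resUnits h)]
    constructor
    · intro h1
      by_contra hodd
      rw [Int.not_even_iff_odd] at hodd
      obtain ⟨d, hd, hds⟩ := exists_nonsquare_unit (F := F)
      obtain ⟨u, rfl⟩ := exists_unit_eq hd
      have h2 := resUnits_eq_leg h u
      rw [h1, leg, if_neg hds, hodd.neg_one_zpow] at h2
      norm_num at h2
    · intro hev
      ext u
      rw [resUnits_eq_leg h]
      obtain ⟨j, hj⟩ := hev
      rw [hj, zpow_add, Int.units_mul_self]
      simp
  rw [Int.even_iff] at h0
  omega

theorem unitCond_le_of_mul {χ : Fˣ →* ℂˣ} {a : Fˣ} (h : IsHilbertChar χ a) {η : 𝒪[F]ˣ →* ℂˣ}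
    (hη : Continuous η) :
    unitCond η ≤ 2 * unitCond (η * resUnits χ) + unitCond (resUnits χ) := by
  refine unitCond_le fun u hu => ?_
  have hu' : ∀ k : ℕ, k ≤ 2 * unitCond (η * resUnits χ) + unitCond (resUnits χ) →
      ((u : 𝒪[F]) : F) - 1 ∈ primePow F k := fun k hk => primePow_anti (by exact_mod_cast hk) hu
  have hc := continuous_resUnits h
  have h1 := unitCond_spec (η := η * resUnits χ) (hη.mul hc) (hu' _ (by omega))
  have h2 := unitCond_spec hc (hu' (unitCond (resUnits χ)) (by omega))
  rw [MonoidHom.mul_apply, h2, mul_one] at h1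
  exact h1

theorem mul_resUnits_eq_one_iff {χ : Fˣ →* ℂˣ} (hχ : χ ^ 2 = 1) (η : 𝒪[F]ˣ →* ℂˣ) :
    η * resUnits χ = 1 ↔ η = resUnits χ := by
  have h : resUnits χ * resUnits χ = 1 := by
    ext u
    have := DFunLike.congr_fun hχ (Units.map (𝒪[F].subtype : 𝒪[F] →* F) u)
    exact congrArg Units.val ((pow_two _).symm.trans this)
  constructor
  · intro h1
    exact mul_right_cancel (h1.trans h.symm)
  · rintro rfl
    exact h

end Characters

/-! ### Integration over fractional ideals -/

section Integration

variable {F : Type*} [NontriviallyNormedField F] [IsUltrametricDist F] [ProperSpace F]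
  [OddNormalized F]

theorem primePow_eq_closedBall (k : ℤ) :
    primePow F k = Metric.closedBall 0 ((q F : ℝ) ^ (-k)) := by
  ext x; simp [primePow]

theorem isCompact_primePow (k : ℤ) : IsCompact (primePow F k) := by
  rw [primePow_eq_closedBall]; exact isCompact_closedBall _ _

theorem isOpen_primePow (k : ℤ) : IsOpen (primePow F k) := by
  rw [primePow_eq_closedBall]
  exact IsUltrametricDist.isOpen_closedBall _ (zpow_pos (q_pos F) _).ne'

theorem add_mem_primePow_iff {z : F} {k : ℤ} (hz : z ∈ primePow F k) (x : F) :
    z + x ∈ primePow F k ↔ x ∈ primePow F k :=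
  ⟨fun h => by simpa using sub_mem_primePow h hz, fun h => add_mem_primePow hz h⟩

/-- A representative in `F` of an element of the residue field. -/
def rep (r : 𝓀[F]) : F := (exists_red_eq r).choose

theorem norm_rep_le (r : 𝓀[F]) : ‖rep r‖ ≤ 1 := (exists_red_eq r).choose_spec.1

theorem red_rep (r : 𝓀[F]) : red (rep r) = r := (exists_red_eq r).choose_spec.2

theorem unif_zpow_mul_rep_mem (k : ℤ) (r : 𝓀[F]) : unif F ^ k * rep r ∈ primePow F k := by
  rw [mem_primePow_of_scale (zpow_ne_zero _ (unif_ne_zero F)), ord_unif_zpow, sub_self]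
  exact mem_primePow_zero.mpr (norm_rep_le r)

theorem mem_coset_iff (k : ℤ) (r : 𝓀[F]) (x : F) :
    x - unif F ^ k * rep r ∈ primePow F (k + 1) ↔
      x ∈ primePow F k ∧ red (x / unif F ^ k) = r := by
  have hk : unif F ^ k ≠ 0 := zpow_ne_zero _ (unif_ne_zero F)
  obtain ⟨y, rfl⟩ : ∃ y, x = unif F ^ k * y := ⟨x / unif F ^ k, by field_simp⟩
  rw [← mul_sub, mem_primePow_of_scale hk, mem_primePow_of_scale hk, ord_unif_zpow, sub_self,
    add_sub_cancel_left, mul_div_cancel_left₀ _ hk, mem_primePow_one, mem_primePow_zero]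
  constructor
  · intro h
    have hy : ‖y‖ ≤ 1 := by
      have e : y = (y - rep r) + rep r := by ring
      rw [e]
      exact (IsUltrametricDist.norm_add_le_max _ _).trans (max_le h.le (norm_rep_le r))
    exact ⟨hy, by rw [(red_eq_iff hy (norm_rep_le r)).mpr h, red_rep]⟩
  · rintro ⟨hy, h⟩
    rw [← red_eq_iff hy (norm_rep_le r), h, red_rep]

variable [MeasurableSpace F] [BorelSpace F]

theorem measurableSet_primePow (k : ℤ) : MeasurableSet (primePow F k) :=
  (isOpen_primePow k).measurableSet

theorem integrableOn_primePow {f : F → ℂ} (hf : Continuous f) (k : ℤ) :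
    IntegrableOn f (primePow F k) (haar F) :=
  hf.continuousOn.integrableOn_compact (isCompact_primePow k)

theorem setIntegral_translate (f : F → ℂ) (z : F) {S T : Set F} (h : ∀ x, z + x ∈ T ↔ x ∈ S) :
    ∫ x in S, f (z + x) ∂haar F = ∫ x in T, f x ∂haar F := by
  have hS : S = (fun x => z + x) ⁻¹' T := by ext x; exact (h x).symm
  rw [hS]
  exact (measurePreserving_add_left (haar F) z).setIntegral_preimage_emb
    (measurableEmbedding_addLeft z) f T

theorem setIntegral_primePow_translate (f : F → ℂ) {z : F} {k : ℤ} (hz : z ∈ primePow F k) :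
    ∫ x in primePow F k, f (z + x) ∂haar F = ∫ x in primePow F k, f x ∂haar F :=
  setIntegral_translate f z (add_mem_primePow_iff hz)

/-- An integral over `𝔭 ^ k` as a sum over the cosets of `𝔭 ^ (k + 1)`. -/
theorem setIntegral_primePow_eq_sum {f : F → ℂ} (hf : Continuous f) (k : ℤ) :
    ∫ x in primePow F k, f x ∂haar F =
      ∑ r : 𝓀[F], ∫ x in primePow F (k + 1), f (unif F ^ k * rep r + x) ∂haar F := by
  set T : 𝓀[F] → Set F := fun r => {x | x - unif F ^ k * rep r ∈ primePow F (k + 1)} with hT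
  have hU : primePow F k = ⋃ r, T r := by
    ext x
    simp only [hT, Set.mem_iUnion, Set.mem_ofPred_eq, mem_coset_iff]
    exact ⟨fun h => ⟨_, h, rfl⟩, fun ⟨_, h, _⟩ => h⟩
  have hm : ∀ r, MeasurableSet (T r) := fun r =>
    (measurableSet_primePow (F := F) (k + 1)).preimage (measurable_id.sub_const _)
  rw [hU, integral_iUnion_fintype hm]
  · refine Finset.sum_congr rfl fun r _ => (setIntegral_translate f _ fun x => ?_).symm
    simp [hT]
  · intro r r' hrr'
    refine Set.disjoint_left.mpr fun x hx hx' => hrr' ?_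
    simp only [hT, Set.mem_ofPred_eq, mem_coset_iff] at hx hx'
    rw [← hx.2, hx'.2]
  · intro r
    refine (integrableOn_primePow hf k).mono_set ?_
    rw [hU]; exact Set.subset_iUnion T r

theorem card_residueField : Fintype.card 𝓀[F] = q F := (Nat.card_eq_fintype_card).symm

/-- The volume of `𝔭 ^ k` is `q ^ (-k)`. -/
theorem setIntegral_one (k : ℤ) :
    ∫ _ in primePow F k, (1 : ℂ) ∂haar F = ((q F : ℝ) ^ (-k) : ℝ) := by
  have hq : (q F : ℂ) ≠ 0 := by exact_mod_cast (q_pos F).ne'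
  have step : ∀ j : ℤ, ∫ _ in primePow F j, (1 : ℂ) ∂haar F =
      q F * ∫ _ in primePow F (j + 1), (1 : ℂ) ∂haar F := by
    intro j
    rw [setIntegral_primePow_eq_sum continuous_const, Finset.sum_const, Finset.card_univ,
      card_residueField, nsmul_eq_mul]
  have h0 : ∫ _ in primePow F 0, (1 : ℂ) ∂haar F = 1 := by
    have : haar F (primePow F 0) = 1 := by
      rw [primePow_eq_closedBall, neg_zero, zpow_zero]
      exact Measure.addHaarMeasure_self
    simp [measureReal_def, this]
  induction k with
  | zero => rw [h0]; simp
  | succ k ih =>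
    rw [step] at ih
    apply mul_left_cancel₀ hq
    rw [ih]
    push_cast
    rw [← zpow_one_add₀ hq]; congr 1; ring
  | pred k ih =>
    rw [step, sub_add_cancel, ih]
    push_cast
    rw [← zpow_one_add₀ hq]; congr 1; ring

theorem setIntegral_swap {f : F → F → ℂ} (hf : Continuous (Function.uncurry f)) (j k : ℤ) :
    ∫ x in primePow F j, ∫ y in primePow F k, f x y ∂haar F ∂haar F =
      ∫ y in primePow F k, ∫ x in primePow F j, f x y ∂haar F ∂haar F := by
  apply integral_integral_swap
  rw [Measure.prod_restrict]
  exact hf.continuousOn.integrableOn_compact ((isCompact_primePow j).prod (isCompact_primePow k))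

/-- Averaging over a smaller ideal does not change the integral. -/
theorem setIntegral_average {f : F → ℂ} (hf : Continuous f) {j k : ℤ} (hjk : j ≤ k) :
    ∫ x in primePow F j, ∫ h in primePow F k, f (x + h) ∂haar F ∂haar F =
      ((q F : ℝ) ^ (-k) : ℝ) * ∫ x in primePow F j, f x ∂haar F := by
  rw [setIntegral_swap (f := fun x h => f (x + h)) (by fun_prop), ← setIntegral_one,
    ← integral_mul_const]
  refine setIntegral_congr_fun (measurableSet_primePow k) fun h hh => ?_
  simp only [one_mul]
  rw [← setIntegral_primePow_translate f (primePow_anti hjk hh)]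
  simp only [add_comm]

end Integration

/-! ### Conductors of additive characters -/

section Conductor

variable {F : Type*} [NontriviallyNormedField F] [IsUltrametricDist F] [ProperSpace F]
  [OddNormalized F]

namespace NontrivialAddChar

theorem map_add (ψ : NontrivialAddChar F) (x y : F) : ψ (x + y) = ψ x * ψ y :=
  AddChar.map_add_eq_mul _ _ _

theorem continuous_coe (ψ : NontrivialAddChar F) : Continuous fun x : F => ((ψ x : Circle) : ℂ) :=
  continuous_induced_dom.comp ψ.continuous'

@[fun_prop]
theorem continuous_comp (ψ : NontrivialAddChar F) {X : Type*} [TopologicalSpace X] {f : X → F}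
    (hf : Continuous f) : Continuous fun x => ((ψ (f x) : Circle) : ℂ) :=
  ψ.continuous_coe.comp hf

theorem twist_apply (ψ : NontrivialAddChar F) (a : Fˣ) (x : F) : ψ.twist a x = ψ (a * x) :=
  AddChar.mulShift_apply

theorem twist_twist (ψ : NontrivialAddChar F) (a b : Fˣ) :
    (ψ.twist a).twist b = ψ.twist (a * b) := by
  have h : ((ψ.twist a).twist b).toAddChar = (ψ.twist (a * b)).toAddChar := by
    ext x
    change ((ψ.twist a).twist b x : ℂ) = (ψ.twist (a * b) x : ℂ)
    rw [twist_apply, twist_apply, twist_apply, Units.val_mul, mul_assoc]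
  cases h1 : (ψ.twist a).twist b
  cases h2 : ψ.twist (a * b)
  rw [h1, h2] at h
  cases h
  rfl

theorem cond_mem_and_le (ψ : NontrivialAddChar F) :
    (∀ x ∈ primePow F ψ.cond, ψ x = 1) ∧
      ∀ k : ℤ, (∀ x ∈ primePow F k, ψ x = 1) → ψ.cond ≤ k := by
  set S := {k : ℤ | ∀ x ∈ primePow F k, ψ x = 1} with hS
  have hne : S.Nonempty := by
    obtain ⟨r, hr, h⟩ := ψ.exists_ball
    obtain ⟨k, hk⟩ := exists_pow_lt (F := F) hr
    exact ⟨k, fun x hx => h x (lt_of_le_of_lt hx hk)⟩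
  have hbdd : BddBelow S := by
    obtain ⟨z, hz⟩ : ∃ z, ψ z ≠ 1 := by
      by_contra hcon
      push Not at hcon
      exact ψ.ne_one' (by ext x; simp [hcon x])
    refine ⟨ord z, fun k hk => ?_⟩
    by_contra hlt
    exact hz (hk z (primePow_anti (not_le.mp hlt).le (mem_primePow_ord z)))
  exact ⟨Int.csInf_mem hne hbdd, fun k hk => csInf_le hbdd hk⟩

theorem apply_eq_one (ψ : NontrivialAddChar F) {x : F} (hx : x ∈ primePow F ψ.cond) : ψ x = 1 :=
  ψ.cond_mem_and_le.1 x hx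

theorem exists_ne_one (ψ : NontrivialAddChar F) {k : ℤ} (hk : k < ψ.cond) :
    ∃ x ∈ primePow F k, ψ x ≠ 1 := by
  by_contra hcon
  push Not at hcon
  exact absurd (ψ.cond_mem_and_le.2 k hcon) (not_le.mpr hk)

theorem cond_eq (ψ : NontrivialAddChar F) {k : ℤ} (h : ∀ x ∈ primePow F k, ψ x = 1)
    (h' : ∃ x ∈ primePow F (k - 1), ψ x ≠ 1) : ψ.cond = k := by
  apply le_antisymm (ψ.cond_mem_and_le.2 k h)
  by_contra hlt
  obtain ⟨x, hx, hne⟩ := h'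
  exact hne (ψ.apply_eq_one (primePow_anti (by omega) hx))

theorem cond_twist (ψ : NontrivialAddChar F) (a : Fˣ) :
    (ψ.twist a).cond = ψ.cond - ord (a : F) := by
  apply cond_eq
  · intro x hx
    rw [twist_apply]
    exact ψ.apply_eq_one ((mem_primePow_of_scale a.ne_zero).mpr hx)
  · obtain ⟨x, hx, hne⟩ := ψ.exists_ne_one (sub_one_lt ψ.cond)
    refine ⟨(a : F)⁻¹ * x, ?_, by rwa [twist_apply, mul_inv_cancel_left₀ a.ne_zero]⟩
    rw [mem_primePow_of_scale (inv_ne_zero a.ne_zero), ord_inv a.ne_zero]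
    exact primePow_anti (by omega) hx

/-- The annihilator of `𝔭 ^ k` under `ψ`. -/
theorem forall_mul_eq_one_iff (ψ : NontrivialAddChar F) (c : F) (k : ℤ) :
    (∀ x ∈ primePow F k, ψ (c * x) = 1) ↔ c ∈ primePow F (ψ.cond - k) := by
  constructor
  · intro h
    by_cases hc : c = 0
    · rw [hc]; exact zero_mem_primePow _
    rw [mem_primePow_iff hc]
    have h1 : (ψ.twist (Units.mk0 c hc)).cond ≤ k := by
      apply (ψ.twist (Units.mk0 c hc)).cond_mem_and_le.2
      intro x hx
      rw [twist_apply]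
      exact h x hx
    rw [cond_twist, Units.val_mk0] at h1
    omega
  · intro hc x hx
    exact ψ.apply_eq_one (mul_mem_primePow hc hx (by omega))

variable [MeasurableSpace F] [BorelSpace F]

theorem setIntegral_mul_eq (ψ : NontrivialAddChar F) {c : F} {k : ℤ}
    (hc : c ∈ primePow F (ψ.cond - k)) :
    ∫ x in primePow F k, ((ψ (c * x) : Circle) : ℂ) ∂haar F = ((q F : ℝ) ^ (-k) : ℝ) := by
  rw [← setIntegral_one]
  refine setIntegral_congr_fun (measurableSet_primePow k) fun x hx => ?_
  simp only [(ψ.forall_mul_eq_one_iff c k).mpr hc x hx, Circle.coe_one]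

theorem setIntegral_mul_eq_zero (ψ : NontrivialAddChar F) {c : F} {k : ℤ}
    (hc : c ∉ primePow F (ψ.cond - k)) :
    ∫ x in primePow F k, ((ψ (c * x) : Circle) : ℂ) ∂haar F = 0 := by
  rw [← forall_mul_eq_one_iff] at hc
  push Not at hc
  obtain ⟨z, hz, hne⟩ := hc
  have h := setIntegral_primePow_translate (fun x => ((ψ (c * x) : Circle) : ℂ)) hz
  simp only [mul_add, map_add, Circle.coe_mul] at h
  rw [integral_const_mul] at h
  have h2 : (((ψ (c * z) : Circle) : ℂ) - 1) *
      ∫ x in primePow F k, ((ψ (c * x) : Circle) : ℂ) ∂haar F = 0 := by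
    rw [sub_mul, h, one_mul, sub_self]
  rcases mul_eq_zero.mp h2 with h3 | h3
  · exact absurd (Circle.ext (by simpa using sub_eq_zero.mp h3)) hne
  · exact h3

end NontrivialAddChar

end Conductor

/-! ### The Weil index -/

section Gauss

variable {k : Type*} [Field k] [Fintype k] [DecidableEq k]

/-- The quadratic character of a finite field with complex values. -/
def quadChar (k : Type*) [Field k] [Fintype k] [DecidableEq k] : MulChar k ℂ :=
  (quadraticChar k).ringHomComp (Int.castRingHom ℂ)

theorem quadChar_apply (r : k) : quadChar k r = ((quadraticChar k r : ℤ) : ℂ) := rfl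

theorem sum_sq_eq_sum (hk : ringChar k ≠ 2) (f : k → ℂ) :
    ∑ r, f (r ^ 2) = ∑ s, (quadChar k s + 1) * f s := by
  classical
  rw [← Finset.sum_fiberwise (s := Finset.univ) (g := fun r : k => r ^ 2)]
  refine Finset.sum_congr rfl fun s _ => ?_
  have h := quadraticChar_card_sqrts hk s
  rw [Finset.sum_congr rfl (g := fun _ => f s) (fun r hr => by
    rw [(Finset.mem_filter.mp hr).2]), Finset.sum_const, nsmul_eq_mul]
  congr 1
  have e : {x : k | x ^ 2 = s}.toFinset = Finset.univ.filter fun r : k => r ^ 2 = s := by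
    ext; simp
  rw [e] at h
  rw [quadChar_apply]
  exact_mod_cast congrArg (Int.cast : ℤ → ℂ) h

theorem sum_mul_sq_eq_gaussSum (hk : ringChar k ≠ 2) {θ : AddChar k ℂ} (hθ : θ ≠ 1) {d : k}
    (hd : d ≠ 0) : ∑ r, θ (d * r ^ 2) = quadChar k d * gaussSum (quadChar k) θ := by
  have hp : θ.mulShift d ≠ 1 := AddChar.IsPrimitive.of_ne_one hθ hd
  have h1 := sum_sq_eq_sum hk (fun s => θ.mulShift d s)
  simp only [add_mul, one_mul, Finset.sum_add_distrib] at h1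
  rw [AddChar.sum_eq_zero_of_ne_one hp, add_zero] at h1
  have h2 := gaussSum_mulShift (quadChar k) θ (Units.mk0 d hd)
  rw [Units.val_mk0] at h2
  have h3 : quadChar k d * quadChar k d = 1 := by
    rw [← map_mul, ← pow_two, quadChar_apply, quadraticChar_sq_one' hd, Int.cast_one]
  simp only [AddChar.mulShift_apply] at h1
  rw [← h2, ← mul_assoc, h3, one_mul, h1]
  simp only [gaussSum, AddChar.mulShift_apply]

theorem gaussSum_quadChar_sq (hk : ringChar k ≠ 2) {θ : AddChar k ℂ} (hθ : θ ≠ 1) :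
    gaussSum (quadChar k) θ ^ 2 = quadChar k (-1) * Fintype.card k := by
  apply gaussSum_sq
  · intro h
    obtain ⟨a, ha⟩ := quadraticChar_exists_neg_one' hk
    have h1 : quadChar k (a : k) = 1 := by rw [h]; exact MulChar.one_apply a.isUnit
    rw [quadChar_apply, ha] at h1
    norm_num at h1
  · exact (quadraticChar_isQuadratic k).comp _
  · exact AddChar.IsPrimitive.of_ne_one hθ

end Gauss

section Weil

variable {F : Type*} [NontriviallyNormedField F] [IsUltrametricDist F] [ProperSpace F]
  [OddNormalized F]

namespace NontrivialAddChar

/-- The additive character of the residue field obtained from `x ↦ ψ (c x)` when `c` has valuation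
`c(ψ) - 1`. -/
def residual (ψ : NontrivialAddChar F) {c : F} (hc : c ∈ primePow F (ψ.cond - 1)) :
    AddChar 𝓀[F] ℂ where
  toFun r := ((ψ (c * rep r) : Circle) : ℂ)
  map_zero_eq_one' := by
    rw [ψ.apply_eq_one, Circle.coe_one]
    refine mul_mem_primePow hc (k := 1) ?_ (by omega)
    rw [mem_primePow_one, ← red_eq_zero_iff (norm_rep_le _), red_rep]
  map_add_eq_mul' r s := by
    rw [← Circle.coe_mul, ← ψ.map_add, ← mul_add]
    congr 1
    have e : c * rep (r + s) = c * (rep (r + s) - (rep r + rep s)) + c * (rep r + rep s) := by ring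
    have h1 : ‖rep r + rep s‖ ≤ 1 :=
      (IsUltrametricDist.norm_add_le_max _ _).trans (max_le (norm_rep_le r) (norm_rep_le s))
    rw [e, ψ.map_add, ψ.apply_eq_one, one_mul]
    refine mul_mem_primePow hc (k := 1) ?_ (by omega)
    rw [mem_primePow_one, ← red_eq_iff (norm_rep_le _) h1, red_rep,
      red_add (norm_rep_le _) (norm_rep_le _), red_rep, red_rep]

theorem residual_red (ψ : NontrivialAddChar F) {c : F} (hc : c ∈ primePow F (ψ.cond - 1)) {x : F}
    (hx : ‖x‖ ≤ 1) : ψ.residual hc (red x) = ((ψ (c * x) : Circle) : ℂ) := by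
  change ((ψ (c * rep (red x)) : Circle) : ℂ) = _
  have e : c * rep (red x) = c * (rep (red x) - x) + c * x := by ring
  rw [e, ψ.map_add, ψ.apply_eq_one, one_mul]
  refine mul_mem_primePow hc (k := 1) ?_ (by omega)
  rw [mem_primePow_one, ← red_eq_iff (norm_rep_le _) hx, red_rep]

theorem residual_ne_one (ψ : NontrivialAddChar F) {c : F} (hc0 : c ≠ 0) (hc : ord c = ψ.cond - 1) :
    ψ.residual (c := c) (hc ▸ mem_primePow_ord c) ≠ 1 := by
  intro h
  obtain ⟨x, hx, hne⟩ := ψ.exists_ne_one (sub_one_lt ψ.cond)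
  have hx1 : ‖c⁻¹ * x‖ ≤ 1 := by
    rw [← mem_primePow_zero, mem_primePow_of_scale (inv_ne_zero hc0), ord_inv hc0, hc]
    exact primePow_anti (by omega) hx
  have h1 := ψ.residual_red (c := c) (hc ▸ mem_primePow_ord c) hx1
  rw [h, mul_inv_cancel_left₀ hc0, AddChar.one_apply] at h1
  exact hne (Circle.ext (by simpa using h1.symm))

variable [MeasurableSpace F] [BorelSpace F]

/-- The quadratic phase `ψ (x²)` concentrates the integral of an invariant function on the ideal
under which it is invariant. -/
theorem setIntegral_mul_quadratic (ψ : NontrivialAddChar F) {j k : ℤ} (hk : 2 * k ≤ ψ.cond)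
    (hjk : j ≤ k) {φ : F → ℂ} (hφ : Continuous φ)
    (hinv : ∀ x, ∀ h ∈ primePow F k, φ (x + h) = φ x) :
    ∫ x in primePow F j, φ x * ((ψ (x ^ 2) : Circle) : ℂ) ∂haar F =
      φ 0 * ∫ x in primePow F k, ((ψ (x ^ 2) : Circle) : ℂ) ∂haar F := by
  have hc : Continuous fun x => φ x * ((ψ (x ^ 2) : Circle) : ℂ) := by fun_prop
  have h1 := setIntegral_average hc (j := j) (k := ψ.cond - k) (by omega)
  have hq : (((q F : ℝ) ^ (-(ψ.cond - k)) : ℝ) : ℂ) ≠ 0 := by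
    exact_mod_cast (zpow_pos (q_pos F) _).ne'
  apply mul_left_cancel₀ hq
  rw [← h1]
  have h2 : ∀ x, ∫ h in primePow F (ψ.cond - k),
      φ (x + h) * ((ψ ((x + h) ^ 2) : Circle) : ℂ) ∂haar F =
      (primePow F k).indicator (fun x => (((q F : ℝ) ^ (-(ψ.cond - k)) : ℝ) : ℂ) *
        (φ 0 * ((ψ (x ^ 2) : Circle) : ℂ))) x := by
    intro x
    have h3 : ∀ h ∈ primePow F (ψ.cond - k), φ (x + h) * ((ψ ((x + h) ^ 2) : Circle) : ℂ) =
        φ x * ((ψ (x ^ 2) : Circle) : ℂ) * ((ψ (2 * x * h) : Circle) : ℂ) := by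
      intro h hh
      have e : (x + h) ^ 2 = h * h + x ^ 2 + 2 * x * h := by ring
      rw [hinv x h (primePow_anti (by omega) hh), e, ψ.map_add, ψ.map_add,
        ψ.apply_eq_one (mul_mem_primePow hh hh (by omega)), one_mul, Circle.coe_mul]
      ring
    rw [setIntegral_congr_fun (measurableSet_primePow _) h3, integral_const_mul]
    have h2x : 2 * x ∈ primePow F (ψ.cond - (ψ.cond - k)) ↔ x ∈ primePow F k := by
      rw [mem_primePow_of_scale two_ne_zero', ord_two]
      ring_nf
    by_cases hx : x ∈ primePow F k
    · rw [ψ.setIntegral_mul_eq (h2x.mpr hx), Set.indicator_of_mem hx]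
      have : φ x = φ 0 := by simpa using hinv 0 x hx
      rw [this]; ring
    · rw [ψ.setIntegral_mul_eq_zero (fun h => hx (h2x.mp h)), Set.indicator_of_notMem hx, mul_zero]
  simp only [h2]
  rw [setIntegral_indicator (measurableSet_primePow k),
    Set.inter_eq_self_of_subset_right (primePow_anti hjk), integral_const_mul, integral_const_mul]

theorem integral_selfDual (ψ : NontrivialAddChar F) (S : Set F) (f : F → ℂ) :
    ∫ x in S, f x ∂selfDual ψ = ((q F : ℝ) ^ ((ψ.cond : ℝ) / 2) : ℝ) * ∫ x in S, f x ∂haar F := by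
  rw [selfDual, Measure.restrict_smul, integral_smul_measure, ENNReal.toReal_ofReal (by positivity)]
  simp

variable [CharZero F]

theorem cond_two (ψ : NontrivialAddChar F) : ψ.two.cond = ψ.cond := by
  rw [two, cond_twist, Units.val_mk0, ord_two, sub_zero]

theorem weilIndex_eq (ψ : NontrivialAddChar F) {k : ℤ} (hk : 2 * k ≤ ψ.cond) :
    weilIndex ψ = ((q F : ℝ) ^ ((ψ.cond : ℝ) / 2) : ℝ) *
      ∫ x in primePow F k, ((ψ (x ^ 2) : Circle) : ℂ) ∂haar F := by
  apply Tendsto.limUnder_eq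
  apply tendsto_const_nhds.congr'
  filter_upwards [eventually_ge_atTop (-k).toNat] with j hj
  rw [integral_selfDual, cond_two]
  congr 1
  have := ψ.setIntegral_mul_quadratic hk (j := -(j : ℤ)) (by omega) (φ := fun _ => 1)
    continuous_const (fun _ _ _ => rfl)
  simpa using this.symm

theorem weilIndex_of_even (ψ : NontrivialAddChar F) {k : ℤ} (hk : ψ.cond = 2 * k) :
    weilIndex ψ = 1 := by
  rw [ψ.weilIndex_eq hk.ge]
  have h : ∫ x in primePow F k, ((ψ (x ^ 2) : Circle) : ℂ) ∂haar F = ((q F : ℝ) ^ (-k) : ℝ) := by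
    rw [← setIntegral_one]
    refine setIntegral_congr_fun (measurableSet_primePow k) fun x hx => ?_
    have : ψ (x ^ 2) = 1 := by
      rw [pow_two]; exact ψ.apply_eq_one (mul_mem_primePow hx hx (by omega))
    simp only [this, Circle.coe_one]
  rw [h, hk, ← Complex.ofReal_mul, ← Real.rpow_intCast, ← Real.rpow_add (q_pos F)]
  push_cast
  norm_num

open Classical in
theorem weilIndex_twist_of_odd (ψ : NontrivialAddChar F) {k : ℤ} (hk : ψ.cond = 2 * k + 1) :
    ∃ θ : AddChar 𝓀[F] ℂ, θ ≠ 1 ∧ ∀ d : Fˣ, ‖(d : F)‖ = 1 →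
      weilIndex (ψ.twist d) = ((q F : ℝ) ^ (-(1 / 2 : ℝ)) : ℝ) *
        (((leg (d : F) : ℤˣ) : ℤ) * gaussSum (quadChar 𝓀[F]) θ) := by
  have hϖ : unif F ^ (2 * k) ≠ 0 := zpow_ne_zero _ (unif_ne_zero F)
  have ho : ord (unif F ^ (2 * k)) = ψ.cond - 1 := by rw [ord_unif_zpow, hk]; ring
  have hm : unif F ^ (2 * k) ∈ primePow F (ψ.cond - 1) := ho ▸ mem_primePow_ord _
  refine ⟨ψ.residual hm, ψ.residual_ne_one hϖ ho, fun d hd => ?_⟩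
  have hdc : (ψ.twist d).cond = ψ.cond := by rw [cond_twist, ord_eq_zero_of_norm hd, sub_zero]
  rw [(ψ.twist d).weilIndex_eq (k := k) (by omega), setIntegral_primePow_eq_sum (by fun_prop)]
  have h1 : ∀ r : 𝓀[F], ∫ x in primePow F (k + 1),
      ((ψ.twist d ((unif F ^ k * rep r + x) ^ 2) : Circle) : ℂ) ∂haar F =
      ((q F : ℝ) ^ (-(k + 1)) : ℝ) * ψ.residual hm (red (d : F) * r ^ 2) := by
    intro r
    have hr2 : ‖rep r * rep r‖ ≤ 1 := by
      rw [norm_mul]; exact mul_le_one₀ (norm_rep_le r) (norm_nonneg _) (norm_rep_le r)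
    have h2 : ψ.residual hm (red (d : F) * r ^ 2) =
        ((ψ (unif F ^ (2 * k) * (d * (rep r * rep r))) : Circle) : ℂ) := by
      rw [← ψ.residual_red hm (by rw [norm_mul, hd, one_mul]; exact hr2), red_mul hd.le hr2,
        red_mul (norm_rep_le r) (norm_rep_le r), red_rep, pow_two]
    rw [h2, ← setIntegral_one, ← integral_mul_const]
    refine setIntegral_congr_fun (measurableSet_primePow _) fun x hx => ?_
    have hw := unif_zpow_mul_rep_mem k r
    have h2' : (2 : F) ∈ primePow F 0 := mem_primePow_zero.mpr norm_two.le
    have e : (unif F ^ k * rep r + x) ^ 2 =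
        x * x + 2 * (unif F ^ k * rep r) * x + unif F ^ (2 * k) * (rep r * rep r) := by
      have e2 : unif F ^ (2 * k) = unif F ^ k * unif F ^ k := by
        rw [← zpow_add₀ (unif_ne_zero F), two_mul]
      rw [e2]; ring
    have h3 : ψ.twist d ((unif F ^ k * rep r + x) ^ 2) =
        ψ (unif F ^ (2 * k) * (d * (rep r * rep r))) := by
      rw [e, (ψ.twist d).map_add, (ψ.twist d).apply_eq_one, one_mul, twist_apply, mul_left_comm]
      rw [hdc]
      exact add_mem_primePow (mul_mem_primePow hx hx (by omega))
        (mul_mem_primePow (mul_mem_primePow h2' hw le_rfl) hx (by omega))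
    simp only [h3, one_mul]
  have hd0 : red (d : F) ≠ 0 := (red_ne_zero_iff hd.le).mpr hd
  simp only [h1]
  rw [← Finset.mul_sum, sum_mul_sq_eq_gaussSum OddNormalized.ringChar_ne_two
    (ψ.residual_ne_one hϖ ho) hd0, quadChar_apply, ← leg_eq_quadraticChar hd, ← mul_assoc,
    ← Complex.ofReal_mul, hdc]
  have hq : (q F : ℝ) ^ ((ψ.cond : ℝ) / 2) * (q F : ℝ) ^ (-(k + 1)) = (q F : ℝ) ^ (-(1 / 2 : ℝ)) := by
    rw [← Real.rpow_intCast, ← Real.rpow_add (q_pos F), hk]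
    congr 1
    push_cast
    ring
  rw [hq]

end NontrivialAddChar

end Weil

/-! ### Weil indices of twists -/

/-- The inclusion of `{±1}` in `ℂ`. -/
def sgn : ℤˣ →* ℂ := ((Int.castRingHom ℂ : ℤ →+* ℂ) : ℤ →* ℂ).comp (Units.coeHom ℤ)

theorem sgn_apply (s : ℤˣ) : sgn s = ((s : ℤ) : ℂ) := rfl

theorem sgn_mul_self (s : ℤˣ) : sgn s * sgn s = 1 := by
  rw [← map_mul, Int.units_mul_self, map_one]

theorem sgn_ne_zero (s : ℤˣ) : sgn s ≠ 0 := left_ne_zero_of_mul_eq_one (sgn_mul_self s)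

theorem sgn_inv (s : ℤˣ) : (sgn s)⁻¹ = sgn s := inv_eq_of_mul_eq_one_left (sgn_mul_self s)

theorem signOf_sgn (s : ℤˣ) : signOf (sgn s) = s := by
  rcases Int.units_eq_one_or s with rfl | rfl
  · rw [signOf, map_one, if_neg (by norm_num)]
  · exact if_pos (by simp [sgn_apply])

theorem units_zpow_two_mul (s : ℤˣ) (k : ℤ) : s ^ (2 * k) = 1 := by
  rw [zpow_mul, zpow_ofNat, Int.units_sq, one_zpow]

theorem units_zpow_congr (s : ℤˣ) {j k l : ℤ} (h : j = k + 2 * l) : s ^ j = s ^ k := by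
  rw [h, zpow_add, units_zpow_two_mul, mul_one]

section WeilIndex

variable {F : Type*} [NontriviallyNormedField F] [IsUltrametricDist F] [ProperSpace F]
  [OddNormalized F] [MeasurableSpace F] [BorelSpace F] [CharZero F]

namespace NontrivialAddChar

theorem twist_one (ψ : NontrivialAddChar F) : ψ.twist 1 = ψ := by
  obtain ⟨f, _, _⟩ := ψ
  simp [NontrivialAddChar.twist]

theorem weilIndex_twist_unit (ψ : NontrivialAddChar F) {d : Fˣ} (hd : ‖(d : F)‖ = 1) :
    weilIndex (ψ.twist d) = sgn (leg (d : F) ^ ψ.cond) * weilIndex ψ := by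
  have hdc : (ψ.twist d).cond = ψ.cond := by rw [cond_twist, ord_eq_zero_of_norm hd, sub_zero]
  rcases Int.even_or_odd' ψ.cond with ⟨k, hk | hk⟩
  · rw [(ψ.twist d).weilIndex_of_even (hdc.trans hk), ψ.weilIndex_of_even hk, hk,
      units_zpow_two_mul, map_one, mul_one]
  · classical
    obtain ⟨θ, -, h⟩ := ψ.weilIndex_twist_of_odd hk
    have h1 := h 1 (by simp)
    rw [twist_one, Units.val_one, leg_one, Units.val_one, Int.cast_one, one_mul] at h1
    rw [h d hd, h1, units_zpow_congr (leg (d : F)) (k := 1) (l := k) (by omega), zpow_one,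
      sgn_apply]
    ring

theorem weilIndex_sq (ψ : NontrivialAddChar F) :
    weilIndex ψ * weilIndex ψ = sgn (leg (-1 : F) ^ ψ.cond) := by
  rcases Int.even_or_odd' ψ.cond with ⟨k, hk | hk⟩
  · rw [ψ.weilIndex_of_even hk, hk, units_zpow_two_mul, map_one, mul_one]
  · classical
    obtain ⟨θ, hθ, h⟩ := ψ.weilIndex_twist_of_odd hk
    have h1 := h 1 (by simp)
    rw [twist_one, Units.val_one, leg_one, Units.val_one, Int.cast_one, one_mul] at h1
    have h2 := gaussSum_quadChar_sq (k := 𝓀[F]) OddNormalized.ringChar_ne_two hθ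
    have hm : red (-1 : F) = -1 := by
      have := red_sub (F := F) (x := 0) (y := 1) (by simp) (by simp)
      rw [zero_sub, (red_eq_zero_iff (by simp)).mpr (by simp : ‖(0 : F)‖ < 1), red_one,
        zero_sub] at this
      exact this
    rw [quadChar_apply, ← hm, ← leg_eq_quadraticChar (by simp), card_residueField] at h2
    have hq : ((q F : ℝ) ^ (-(1 / 2 : ℝ))) * ((q F : ℝ) ^ (-(1 / 2 : ℝ))) * q F = 1 := by
      rw [← Real.rpow_add (q_pos F)]
      norm_num
      rw [Real.rpow_neg_one]
      exact inv_mul_cancel₀ (q_pos F).ne'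
    have hq' : (((q F : ℝ) ^ (-(1 / 2 : ℝ)) : ℝ) : ℂ) * (((q F : ℝ) ^ (-(1 / 2 : ℝ)) : ℝ) : ℂ) *
        q F = 1 := by exact_mod_cast hq
    rw [h1, units_zpow_congr (leg (-1 : F)) (k := 1) (l := k) (by omega), zpow_one, sgn_apply]
    linear_combination (((q F : ℝ) ^ (-(1 / 2 : ℝ)) : ℝ) : ℂ) ^ 2 * h2 +
      (((leg (-1 : F) : ℤˣ) : ℤ) : ℂ) * hq'

theorem weilIndex_ne_zero (ψ : NontrivialAddChar F) : weilIndex ψ ≠ 0 := by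
  have h := sgn_ne_zero (leg (-1 : F) ^ ψ.cond)
  rw [← weilIndex_sq] at h
  exact left_ne_zero_of_mul h

theorem relWeilIndex_unit (ψ : NontrivialAddChar F) {d : Fˣ} (hd : ‖(d : F)‖ = 1) :
    relWeilIndex d ψ = sgn (leg (d : F) ^ ψ.cond) := by
  rw [relWeilIndex, ψ.weilIndex_twist_unit hd, mul_div_cancel_right₀ _ ψ.weilIndex_ne_zero]

end NontrivialAddChar

open Classical in
theorem splitSign_of_unit (ψ : NontrivialAddChar F) {g : SL(2, F)} (hd : ‖g 1 1‖ = 1) :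
    splitSign ψ g = (if g 1 0 = 0 then 1 else leg (g 1 1) ^ ord (g 1 0)) * leg (g 1 1) ^ ψ.cond := by
  rw [splitSign, dif_pos hd]
  congr 1
  · by_cases hc : g 1 0 = 0
    · rw [if_pos hc, if_pos hc]
    · rw [if_neg hc, if_neg hc, hilbert_unit_right hc hd]
  · rw [ψ.relWeilIndex_unit (by simp [hd]), signOf_sgn]
    simp [leg_inv]

end WeilIndex

/-! ### Formulas for the Weil representation -/

section WeilFormula

variable {F : Type*} [NontriviallyNormedField F] [IsUltrametricDist F] [ProperSpace F]
  [OddNormalized F]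

theorem exists_support_primePow (φ : SchwartzBruhat F) :
    ∃ j₀ : ℤ, ∀ y, y ∉ primePow F j₀ → φ.1 y = 0 := by
  obtain ⟨R, hR⟩ := φ.2.2.isBounded.exists_norm_le
  obtain ⟨k, hk⟩ := pow_unbounded_of_one_lt R (one_lt_q_real F)
  refine ⟨-k, fun y hy => ?_⟩
  by_contra hne
  apply hy
  have := hR y (subset_tsupport _ hne)
  rw [mem_primePow, neg_neg, zpow_natCast]
  linarith

theorem exists_invariant_primePow (φ : SchwartzBruhat F) :
    ∃ l₀ : ℤ, ∀ h ∈ primePow F l₀, ∀ x, φ.1 (x + h) = φ.1 x := by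
  obtain ⟨r, hr, h⟩ := exists_invariant φ
  obtain ⟨k, hk⟩ := exists_pow_lt (F := F) hr
  exact ⟨k, fun x hx => h x (lt_of_le_of_lt hx hk)⟩

theorem det_eq_one (g : SL(2, F)) : g 0 0 * g 1 1 - g 0 1 * g 1 0 = 1 := by
  have := g.det_coe
  rwa [Matrix.det_fin_two] at this

variable [MeasurableSpace F] [BorelSpace F]

theorem integral_eq_setIntegral {f : F → ℂ} {j : ℤ} (h : ∀ y, y ∉ primePow F j → f y = 0) :
    ∫ x, f x ∂haar F = ∫ x in primePow F j, f x ∂haar F :=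
  (setIntegral_eq_integral_of_forall_compl_eq_zero h).symm

variable [CharZero F]

/-- The Weil representation at an element with `c ≠ 0` is an integral operator with a quadratic
kernel. -/
theorem weil_apply_of_ne (ψ : NontrivialAddChar F) (x : Metaplectic F) (hc : x.mat 1 0 ≠ 0)
    (φ : SchwartzBruhat F) (y : F) :
    (weil ψ x φ).1 y = sgn x.sign *
      ((((q F : ℝ) ^ (((ψ.twist (Units.mk0 _ hc)⁻¹).cond : ℝ) / 2) : ℝ) : ℂ) *
        (weilIndex (ψ.twist (Units.mk0 _ hc)⁻¹))⁻¹) *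
      ∫ z, φ.1 z * ((ψ.twist (Units.mk0 _ hc)⁻¹
        (x.mat 0 0 * y ^ 2 - 2 * z * y + x.mat 1 1 * z ^ 2) : Circle) : ℂ) ∂haar F := by
  set a := x.mat 0 0
  set c := x.mat 1 0
  set d := x.mat 1 1
  set ψc := ψ.twist (Units.mk0 c hc)⁻¹ with hψc
  have hcond : ψc.cond = ψ.cond + ord c := by
    rw [hψc, NontrivialAddChar.cond_twist, Units.val_inv_eq_inv_val, Units.val_mk0, ord_inv hc]
    ring
  have hll : ψ.twist (llUnit x.mat hc) = ψc.twist (-1) := by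
    rw [hψc, NontrivialAddChar.twist_twist]
    congr 1
    ext
    simp [llUnit, c]
  have hrel : relWeilIndex (llUnit x.mat hc) ψ =
      sgn (leg (-1 : F) ^ ψc.cond) * weilIndex ψc / weilIndex ψ := by
    rw [relWeilIndex, hll, ψc.weilIndex_twist_unit (by simp)]
    simp
  have hhil : hilbert (-1) (-c⁻¹) = leg (-1 : F) ^ ord c := by
    rw [hilbert_unit_left (neg_ne_zero.mpr (inv_ne_zero hc)) (by simp), ord_neg, ord_inv hc,
      zpow_neg]
    exact Int.units_inv_eq_self _
  have hsqrt : Real.sqrt ‖-c⁻¹‖ * (q F : ℝ) ^ ((ψ.cond : ℝ) / 2) =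
      (q F : ℝ) ^ ((ψc.cond : ℝ) / 2) := by
    rw [norm_neg, norm_inv, norm_eq_ord hc, ← zpow_neg, neg_neg, Real.sqrt_eq_rpow,
      ← Real.rpow_intCast, ← Real.rpow_mul (q_pos F).le, ← Real.rpow_add (q_pos F), hcond]
    congr 1
    push_cast
    ring
  have hconst : sgn (leg (-1 : F) ^ ord c) * (relWeilIndex (llUnit x.mat hc) ψ)⁻¹ * weilIndex ψ =
      (weilIndex ψc)⁻¹ := by
    have h1 := ψ.weilIndex_ne_zero
    have h2 := ψc.weilIndex_ne_zero
    have h3 := sgn_ne_zero (leg (-1 : F) ^ ψc.cond)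
    have h4 : sgn (leg (-1 : F) ^ ψc.cond) =
        sgn (leg (-1 : F) ^ ord c) * (weilIndex ψ * weilIndex ψ) := by
      rw [ψ.weilIndex_sq, ← map_mul, ← zpow_add, hcond, add_comm]
    rw [hrel]
    field_simp
    rw [h4]
    ring
  have hint : ∀ f : F → ℂ, ∫ z, f z ∂selfDual ψ.two =
      (((q F : ℝ) ^ ((ψ.cond : ℝ) / 2) : ℝ) : ℂ) * ∫ z, f z ∂haar F := by
    intro f
    have := ψ.two.integral_selfDual Set.univ f
    rwa [Measure.restrict_univ, Measure.restrict_univ, NontrivialAddChar.cond_two] at this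
  have hwe : (weil ψ x φ).1 y = ((ψ (a / c * y ^ 2) : Circle) : ℂ) *
      (sgn (x.sign * hilbert (-1) (-c⁻¹)) * (Real.sqrt ‖-c⁻¹‖ : ℂ) *
        (relWeilIndex (llUnit x.mat hc) ψ)⁻¹ *
        (weilIndex ψ * ∫ z, ((ψ (d / c * z ^ 2) : Circle) : ℂ) * φ.1 z *
          ((ψ (2 * z * (-c⁻¹ * y)) : Circle) : ℂ) ∂selfDual ψ.two)) := by
    rw [weil, dif_neg hc]
    rfl
  rw [hwe, hint, hhil, map_mul sgn, ← hsqrt, ← hconst]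
  have hphase : ((ψ (a / c * y ^ 2) : Circle) : ℂ) *
      ∫ z, ((ψ (d / c * z ^ 2) : Circle) : ℂ) * φ.1 z *
          ((ψ (2 * z * (-c⁻¹ * y)) : Circle) : ℂ) ∂haar F =
      ∫ z, φ.1 z * ((ψc (a * y ^ 2 - 2 * z * y + d * z ^ 2) : Circle) : ℂ) ∂haar F := by
    rw [← integral_const_mul]
    congr 1
    funext z
    have e : ψc (a * y ^ 2 - 2 * z * y + d * z ^ 2) =
        ψ (a / c * y ^ 2) * ψ (d / c * z ^ 2) * ψ (2 * z * (-c⁻¹ * y)) := by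
      rw [← ψ.map_add, ← ψ.map_add, hψc, NontrivialAddChar.twist_apply]
      congr 1
      rw [Units.val_inv_eq_inv_val, Units.val_mk0]
      field_simp
      ring
    rw [e]
    push_cast
    ring
  rw [← hphase]
  push_cast
  ring

/-- The Weil representation at the lift of a matrix whose lower right entry is a unit. -/
theorem weil_lift_apply (ψ ψ' : NontrivialAddChar F) {g : SL(2, F)} (hd : ‖g 1 1‖ = 1)
    (φ : SchwartzBruhat F) {k : ℤ} (hinv : ∀ h ∈ primePow F k, ∀ x, φ.1 (x + h) = φ.1 x)
    (hc : g 1 0 ∈ primePow F (2 * k - ψ'.cond)) (y : F) :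
    (weil ψ' (lift ψ g) φ).1 y = sgn (leg (g 1 1) ^ (ψ.cond + ψ'.cond)) *
      ((ψ' (g 0 1 / g 1 1 * y ^ 2) : Circle) : ℂ) * φ.1 (y / g 1 1) := by
  have hd0 : g 1 1 ≠ 0 := norm_ne_zero_iff.mp (by rw [hd]; exact one_ne_zero)
  have hdet := det_eq_one g
  by_cases hc0 : g 1 0 = 0
  · rw [hc0, mul_zero, sub_zero] at hdet
    have ha : g 0 0 = (g 1 1)⁻¹ := eq_inv_of_mul_eq_one_left hdet
    have hul : ((ulUnit g hc0 : Fˣ) : F) = (g 1 1)⁻¹ := ha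
    have hwe : (weil ψ' (lift ψ g) φ).1 y = ((ψ' (g 0 0 * g 0 1 * y ^ 2) : Circle) : ℂ) *
        (sgn (splitSign ψ g) * (Real.sqrt ‖((ulUnit g hc0 : Fˣ) : F)‖ : ℂ) *
          (relWeilIndex (ulUnit g hc0) ψ')⁻¹ * φ.1 (((ulUnit g hc0 : Fˣ) : F) * y)) := by
      rw [weil, dif_pos (show (lift ψ g).mat 1 0 = 0 from hc0)]
      rfl
    rw [hwe, splitSign_of_unit ψ hd, if_pos hc0, one_mul,
      ψ'.relWeilIndex_unit (by rw [hul, norm_inv, hd, inv_one]), sgn_inv, hul, leg_inv, norm_inv,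
      hd, inv_one, Real.sqrt_one, ha, zpow_add, map_mul sgn, div_eq_inv_mul, div_eq_inv_mul]
    push_cast
    ring
  · rw [weil_apply_of_ne ψ' (lift ψ g) hc0]
    change sgn (splitSign ψ g) * _ * ∫ z, φ.1 z * ((ψ'.twist (Units.mk0 _ hc0)⁻¹
        (g 0 0 * y ^ 2 - 2 * z * y + g 1 1 * z ^ 2) : Circle) : ℂ) ∂haar F = _
    set ψc := ψ'.twist (Units.mk0 _ hc0)⁻¹ with hψc
    set D : Fˣ := Units.mk0 _ hd0
    have hcond : ψc.cond = ψ'.cond + ord (g 1 0) := by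
      rw [hψc, NontrivialAddChar.cond_twist, Units.val_inv_eq_inv_val, Units.val_mk0, ord_inv hc0]
      ring
    have hk : 2 * k ≤ ψc.cond := by
      rw [mem_primePow_iff hc0] at hc
      omega
    have hDc : (ψc.twist D).cond = ψc.cond := by
      rw [NontrivialAddChar.cond_twist, ord_eq_zero_of_norm (by exact hd), sub_zero]
    obtain ⟨j₀, hj₀⟩ := exists_support_primePow φ
    set j := min j₀ (min k (ord (y / g 1 1)))
    have hyj : y / g 1 1 ∈ primePow F j :=
      primePow_anti ((min_le_right _ _).trans (min_le_right _ _)) (mem_primePow_ord _)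
    have hphase : ∀ z, ψc (g 0 0 * y ^ 2 - 2 * z * y + g 1 1 * z ^ 2) =
        ψ' (g 0 1 / g 1 1 * y ^ 2) * ψc.twist D ((z - y / g 1 1) ^ 2) := by
      intro z
      have e : ψ' (g 0 1 / g 1 1 * y ^ 2) = ψc (g 1 0 * (g 0 1 / g 1 1 * y ^ 2)) := by
        rw [hψc, NontrivialAddChar.twist_apply, Units.val_inv_eq_inv_val, Units.val_mk0,
          inv_mul_cancel_left₀ hc0]
      have e2 : ψc.twist D ((z - y / g 1 1) ^ 2) = ψc (g 1 1 * (z - y / g 1 1) ^ 2) :=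
        NontrivialAddChar.twist_apply _ _ _
      rw [e, e2, ← ψc.map_add]
      congr 1
      field_simp
      linear_combination y ^ 2 * hdet
    have hI : ∫ z, φ.1 z * ((ψc (g 0 0 * y ^ 2 - 2 * z * y + g 1 1 * z ^ 2) : Circle) : ℂ) ∂haar F =
        ((ψ' (g 0 1 / g 1 1 * y ^ 2) : Circle) : ℂ) * (φ.1 (y / g 1 1) *
          ∫ z in primePow F k, ((ψc.twist D (z ^ 2) : Circle) : ℂ) ∂haar F) := by
      rw [integral_eq_setIntegral (j := j) (fun z hz => by
        rw [hj₀ z (fun h => hz (primePow_anti (min_le_left _ _) h)), zero_mul]),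
        ← setIntegral_primePow_translate _ hyj]
      have h2 := (ψc.twist D).setIntegral_mul_quadratic (j := j) (k := k) (hDc.symm ▸ hk)
        ((min_le_right _ _).trans (min_le_left _ _)) (φ := fun z => φ.1 (y / g 1 1 + z))
        (φ.2.1.continuous.comp (continuous_const.add continuous_id))
        (fun x h hh => by simp only [← add_assoc, hinv h hh])
      rw [add_zero] at h2
      rw [← h2, ← integral_const_mul]
      congr 1
      funext z
      rw [hphase, add_sub_cancel_left]
      push_cast
      ring
    have hW := (ψc.twist D).weilIndex_eq (k := k) (hDc.symm ▸ hk)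
    rw [ψc.weilIndex_twist_unit (by exact hd), hDc] at hW
    have hDv : (D : F) = g 1 1 := rfl
    rw [hDv] at hW
    have hs : sgn (splitSign ψ g) * sgn (leg (g 1 1) ^ ψc.cond) =
        sgn (leg (g 1 1) ^ (ψ.cond + ψ'.cond)) := by
      rw [← map_mul, splitSign_of_unit ψ hd, if_neg hc0, ← zpow_add, ← zpow_add]
      rw [units_zpow_congr (leg (g 1 1)) (k := ψ.cond + ψ'.cond) (l := ord (g 1 0))]
      rw [hcond]; ring
    have hne := ψc.weilIndex_ne_zero
    rw [hI, ← hs]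
    have hq0 : (((q F : ℝ) ^ ((ψc.cond : ℝ) / 2) : ℝ) : ℂ) ≠ 0 := by
      exact_mod_cast (Real.rpow_pos_of_pos (q_pos F) _).ne'
    have hW' : (((q F : ℝ) ^ ((ψc.cond : ℝ) / 2) : ℝ) : ℂ) * (weilIndex ψc)⁻¹ *
        ∫ z in primePow F k, ((ψc.twist D (z ^ 2) : Circle) : ℂ) ∂haar F =
        sgn (leg (g 1 1) ^ ψc.cond) := by
      rw [mul_right_comm, ← hW, mul_inv_cancel_right₀ hne]
    have hring : ∀ s r w p f i : ℂ, s * (r * w) * (p * (f * i)) = s * (r * w * i) * p * f := by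
      intros; ring
    rw [← hW']
    exact hring _ _ _ _ _ _

end WeilFormula

/-! ### Fourier inversion for the Weil representation -/

section Fourier

variable {F : Type*} [NontriviallyNormedField F] [IsUltrametricDist F] [ProperSpace F]
  [OddNormalized F] [MeasurableSpace F] [BorelSpace F]

/-- The Fourier transform of `φ` with respect to `ψ_2`, without normalization. -/
def fourier (ψ : NontrivialAddChar F) (φ : SchwartzBruhat F) (ξ : F) : ℂ :=
  ∫ y, φ.1 y * ((ψ (2 * ξ * y) : Circle) : ℂ) ∂haar F

theorem fourier_eq_setIntegral (ψ : NontrivialAddChar F) {φ : SchwartzBruhat F} {j : ℤ}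
    (hj : ∀ y, y ∉ primePow F j → φ.1 y = 0) (ξ : F) :
    fourier ψ φ ξ = ∫ y in primePow F j, φ.1 y * ((ψ (2 * ξ * y) : Circle) : ℂ) ∂haar F :=
  integral_eq_setIntegral fun y hy => by rw [hj y hy, zero_mul]

theorem fourier_inversion (ψ : NontrivialAddChar F) (φ : SchwartzBruhat F) :
    ∃ (i : ℤ) (C : ℂ), C ≠ 0 ∧ ∀ y,
      C * φ.1 y = ∫ ξ in primePow F i, fourier ψ φ ξ * ((ψ (-(2 * ξ * y)) : Circle) : ℂ) ∂haar F := by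
  obtain ⟨l, hl⟩ := exists_invariant_primePow φ
  obtain ⟨j₀, hj₀⟩ := exists_support_primePow φ
  set i := ψ.cond - l with hi
  refine ⟨i, ((q F : ℝ) ^ (-i) : ℝ) * ((q F : ℝ) ^ (-l) : ℝ), ?_, fun y => ?_⟩
  · exact_mod_cast mul_ne_zero (zpow_pos (q_pos F) _).ne' (zpow_pos (q_pos F) _).ne'
  have hφ : Continuous φ.1 := φ.2.1.continuous
  set j := min j₀ (min l (ord y))
  have hyj : y ∈ primePow F j :=
    primePow_anti ((min_le_right _ _).trans (min_le_right _ _)) (mem_primePow_ord _)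
  have hjl : j ≤ l := (min_le_right _ _).trans (min_le_left _ _)
  have hj : ∀ z, z ∉ primePow F j → φ.1 z = 0 := fun z hz =>
    hj₀ z fun h => hz (primePow_anti (min_le_left _ _) h)
  simp only [fourier_eq_setIntegral ψ hj, ← integral_mul_const]
  rw [setIntegral_swap (f := fun ξ x => φ.1 x * ((ψ (2 * ξ * x) : Circle) : ℂ) *
    ((ψ (-(2 * ξ * y)) : Circle) : ℂ))
    (by
      have h1 : Continuous fun p : F × F => φ.1 p.2 := hφ.comp continuous_snd
      change Continuous fun p : F × F => φ.1 p.2 * ((ψ (2 * p.1 * p.2) : Circle) : ℂ) *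
        ((ψ (-(2 * p.1 * y)) : Circle) : ℂ)
      fun_prop)]
  rw [← setIntegral_primePow_translate _ hyj]
  have h2 : ∀ x, ∫ ξ in primePow F i, φ.1 (y + x) * ((ψ (2 * ξ * (y + x)) : Circle) : ℂ) *
      ((ψ (-(2 * ξ * y)) : Circle) : ℂ) ∂haar F =
      (primePow F l).indicator (fun _ => φ.1 y * ((q F : ℝ) ^ (-i) : ℝ)) x := by
    intro x
    have h3 : ∀ ξ, φ.1 (y + x) * ((ψ (2 * ξ * (y + x)) : Circle) : ℂ) *
        ((ψ (-(2 * ξ * y)) : Circle) : ℂ) = φ.1 (y + x) * ((ψ (2 * x * ξ) : Circle) : ℂ) := by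
      intro ξ
      rw [mul_assoc, ← Circle.coe_mul, ← ψ.map_add]
      congr 4
      ring
    simp only [h3]
    rw [integral_const_mul]
    have h2x : 2 * x ∈ primePow F (ψ.cond - i) ↔ x ∈ primePow F l := by
      rw [mem_primePow_of_scale two_ne_zero', ord_two, hi]
      ring_nf
    by_cases hx : x ∈ primePow F l
    · rw [ψ.setIntegral_mul_eq (h2x.mpr hx), Set.indicator_of_mem hx, hl x hx]
    · rw [ψ.setIntegral_mul_eq_zero (fun h => hx (h2x.mp h)), Set.indicator_of_notMem hx, mul_zero]
  simp only [h2]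
  rw [setIntegral_indicator (measurableSet_primePow l),
    Set.inter_eq_self_of_subset_right (primePow_anti hjl), ← setIntegral_one l, ← integral_const_mul,
    ← integral_mul_const]
  congr 1
  funext _
  ring

/-- A function whose Fourier transform is supported in `𝔭 ^ k` is invariant under the dual ideal. -/
theorem invariant_of_fourier (ψ : NontrivialAddChar F) (φ : SchwartzBruhat F) {k : ℤ}
    (hk : ∀ ξ, ξ ∉ primePow F k → fourier ψ φ ξ = 0) {h : F} (hh : h ∈ primePow F (ψ.cond - k))
    (y : F) : φ.1 (y + h) = φ.1 y := by
  obtain ⟨i, C, hC, hinv⟩ := fourier_inversion ψ φ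
  apply mul_left_cancel₀ hC
  rw [hinv, hinv]
  congr 1
  funext ξ
  by_cases hξ : ξ ∈ primePow F k
  · have e : -(2 * ξ * (y + h)) = -(2 * ξ * y) + -(2 * ξ * h) := by ring
    have h2 : (2 : F) ∈ primePow F 0 := mem_primePow_zero.mpr norm_two.le
    rw [e, ψ.map_add, ψ.apply_eq_one (neg_mem_primePow
      (mul_mem_primePow (mul_mem_primePow h2 hξ le_rfl) hh (by omega))), mul_one]
  · rw [hk ξ hξ, zero_mul, zero_mul]

variable [CharZero F]

/-- The operator of `n^op(c)` multiplies the Fourier transform by a quadratic phase. -/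
theorem fourier_of_nop_invariant (ψ ψ' : NontrivialAddChar F) {c : F} (hc : c ≠ 0)
    {φ : SchwartzBruhat F} (h : weil ψ' (lift ψ (nop c)) φ = φ) (ξ : F) :
    fourier ψ' φ ξ = ((ψ' (-(c * ξ ^ 2)) : Circle) : ℂ) * fourier ψ' φ ξ := by
  have hφ : Continuous φ.1 := φ.2.1.continuous
  have hc' : (lift ψ (nop c)).mat 1 0 ≠ 0 := by simpa [lift, nop] using hc
  set ψc := ψ'.twist (Units.mk0 c hc)⁻¹ with hψc
  set K : ℂ := (((q F : ℝ) ^ ((ψc.cond : ℝ) / 2) : ℝ) : ℂ) * (weilIndex ψc)⁻¹ with hK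
  have hφy : ∀ y, φ.1 y = K * ∫ z, φ.1 z * ((ψc ((y - z) ^ 2) : Circle) : ℂ) ∂haar F := by
    intro y
    conv_lhs => rw [← h]
    rw [weil_apply_of_ne ψ' _ hc']
    have e00 : (lift ψ (nop c)).mat 0 0 = 1 := by simp [lift, nop]
    have e11 : (lift ψ (nop c)).mat 1 1 = 1 := by simp [lift, nop]
    have e10 : (lift ψ (nop c)).mat 1 0 = c := by simp [lift, nop]
    have es : (lift ψ (nop c)).sign = 1 := by
      change splitSign ψ (nop c) = 1
      have h1 : nop c 1 1 = 1 := by simp [nop]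
      rw [splitSign_of_unit ψ (by rw [h1, norm_one]), h1, leg_one]
      simp
    have eu : Units.mk0 _ hc' = Units.mk0 c hc := by ext; exact e10
    rw [es, map_one, one_mul, eu, e00, e11]
    congr 1
    congr 1
    funext z
    congr 4
    ring
  obtain ⟨j₀, hj₀⟩ := exists_support_primePow φ
  have hc2 : ψc.cond = ψ'.cond + ord c := by
    rw [hψc, NontrivialAddChar.cond_twist, Units.val_inv_eq_inv_val, Units.val_mk0, ord_inv hc]
    ring
  set i := min j₀ (min (ψc.cond / 2) (ord (c * ξ)))
  have hi : ∀ z, z ∉ primePow F i → φ.1 z = 0 := fun z hz =>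
    hj₀ z fun h => hz (primePow_anti (min_le_left _ _) h)
  have hik : 2 * i ≤ ψc.cond := by
    have : i ≤ ψc.cond / 2 := (min_le_right _ _).trans (min_le_left _ _)
    omega
  have hcξ : c * ξ ∈ primePow F i :=
    primePow_anti ((min_le_right _ _).trans (min_le_right _ _)) (mem_primePow_ord _)
  have hG : K * ∫ z in primePow F i, ((ψc (z ^ 2) : Circle) : ℂ) ∂haar F = 1 := by
    rw [hK, mul_right_comm, ← ψc.weilIndex_eq hik, mul_inv_cancel₀ ψc.weilIndex_ne_zero]
  have hφy' : ∀ y, φ.1 y =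
      K * ∫ z in primePow F i, φ.1 z * ((ψc ((y - z) ^ 2) : Circle) : ℂ) ∂haar F := by
    intro y
    rw [← integral_eq_setIntegral fun z hz => by rw [hi z hz, zero_mul]]
    exact hφy y
  have hψ'c : ∀ z, ψ' z = ψc (c * z) := by
    intro z
    rw [hψc, NontrivialAddChar.twist_apply, Units.val_inv_eq_inv_val, Units.val_mk0,
      inv_mul_cancel_left₀ hc]
  have h1 : ∀ y, φ.1 y * ((ψ' (2 * ξ * y) : Circle) : ℂ) =
      K * ∫ z in primePow F i, φ.1 z * ((ψc ((y - z) ^ 2) : Circle) : ℂ) *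
        ((ψ' (2 * ξ * y) : Circle) : ℂ) ∂haar F := by
    intro y
    conv_lhs => rw [hφy' y]
    rw [integral_mul_const, mul_assoc]
  have h2 : ∀ z ∈ primePow F i, ∫ y in primePow F i, φ.1 z * ((ψc ((y - z) ^ 2) : Circle) : ℂ) *
      ((ψ' (2 * ξ * y) : Circle) : ℂ) ∂haar F =
      (∫ z in primePow F i, ((ψc (z ^ 2) : Circle) : ℂ) ∂haar F) *
        ((ψ' (-(c * ξ ^ 2)) : Circle) : ℂ) * (φ.1 z * ((ψ' (2 * ξ * z) : Circle) : ℂ)) := by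
    intro z hz
    rw [← setIntegral_primePow_translate _ (sub_mem_primePow hz hcξ), ← integral_mul_const,
      ← integral_mul_const]
    congr 1
    funext y
    have e : ψc ((z - c * ξ + y - z) ^ 2) * ψ' (2 * ξ * (z - c * ξ + y)) =
        ψc (y ^ 2) * ψ' (-(c * ξ ^ 2)) * ψ' (2 * ξ * z) := by
      rw [hψ'c, hψ'c, hψ'c, ← ψc.map_add, ← ψc.map_add, ← ψc.map_add]
      congr 1
      ring
    have e' := congrArg (fun x : Circle => (x : ℂ)) e
    simp only [Circle.coe_mul] at e'
    linear_combination φ.1 z * e'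
  conv_lhs => rw [fourier_eq_setIntegral ψ' hi ξ]
  simp only [h1]
  rw [integral_const_mul, setIntegral_swap (f := fun y z => φ.1 z *
      ((ψc ((y - z) ^ 2) : Circle) : ℂ) * ((ψ' (2 * ξ * y) : Circle) : ℂ))
    (by
      have h1 : Continuous fun p : F × F => φ.1 p.2 := hφ.comp continuous_snd
      change Continuous fun p : F × F => φ.1 p.2 * ((ψc ((p.1 - p.2) ^ 2) : Circle) : ℂ) *
        ((ψ' (2 * ξ * p.1) : Circle) : ℂ)
      fun_prop),
    setIntegral_congr_fun (measurableSet_primePow i) h2, integral_const_mul,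
    ← fourier_eq_setIntegral ψ' hi ξ, ← mul_assoc, ← mul_assoc, hG, one_mul]

end Fourier

/-! ### The isotypic spaces as spaces of homogeneous functions -/

section Radial

variable {F : Type*} [NontriviallyNormedField F] [IsUltrametricDist F]

/-- The functions supported in `𝔭 ^ n₀`, invariant under `𝔭 ^ n₁` and homogeneous of degree `θ`
under `𝒪ˣ`. -/
def homogeneous (n₀ n₁ : ℤ) (θ : 𝒪[F]ˣ →* ℂˣ) : Submodule ℂ (SchwartzBruhat F) where
  carrier := {φ | (∀ y, y ∉ primePow F n₀ → φ.1 y = 0) ∧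
    (∀ h ∈ primePow F n₁, ∀ x, φ.1 (x + h) = φ.1 x) ∧
    ∀ (u : 𝒪[F]ˣ) (y : F), φ.1 (((u : 𝒪[F]) : F) * y) = (θ u : ℂ) * φ.1 y}
  add_mem' h h' := ⟨fun y hy => by simp [h.1 y hy, h'.1 y hy],
    fun z hz x => by simp [h.2.1 z hz x, h'.2.1 z hz x],
    fun u y => by simp [h.2.2 u y, h'.2.2 u y, mul_add]⟩
  zero_mem' := ⟨fun _ _ => rfl, fun _ _ _ => rfl, fun _ _ => by simp⟩
  smul_mem' c φ h := ⟨fun y hy => by simp [h.1 y hy], fun z hz x => by simp [h.2.1 z hz x],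
    fun u y => by simp [h.2.2 u y, mul_left_comm]⟩

theorem evalUnit_coe (η : 𝒪[F]ˣ →* ℂˣ) (u : 𝒪[F]ˣ) : evalUnit η ((u : 𝒪[F]) : F) = η u := by
  have h : ∃ v : 𝒪[F]ˣ, ((v : 𝒪[F]) : F) = ((u : 𝒪[F]) : F) := ⟨u, rfl⟩
  rw [evalUnit, dif_pos h]
  congr 2
  exact Units.ext (Subtype.ext h.choose_spec)

theorem evalUnit_of_norm_ne_one (η : 𝒪[F]ˣ →* ℂˣ) {d : F} (hd : ‖d‖ ≠ 1) : evalUnit η d = 1 := by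
  rw [evalUnit, dif_neg]
  rintro ⟨u, rfl⟩
  exact hd (Valued.integer.norm_coe_unit u)

variable [ProperSpace F] [OddNormalized F]

theorem eq_zero_of_homogeneous {n₀ n₁ : ℤ} {θ : 𝒪[F]ˣ →* ℂˣ} {φ : SchwartzBruhat F}
    (hφ : φ ∈ homogeneous n₀ n₁ θ) (h : n₁ < n₀) (y : F) : φ.1 y = 0 := by
  by_cases hy : y ∈ primePow F n₀
  · have h1 : unif F ^ n₁ ∈ primePow F n₁ := by
      simpa [ord_unif_zpow] using mem_primePow_ord (unif F ^ n₁)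
    rw [← hφ.2.1 _ h1 y]
    refine hφ.1 _ fun h2 => ?_
    rw [add_mem_primePow_iff hy, mem_primePow_iff (zpow_ne_zero _ (unif_ne_zero F)),
      ord_unif_zpow] at h2
    omega
  · exact hφ.1 y hy

variable [MeasurableSpace F] [BorelSpace F] [CharZero F]

theorem mem_isotypic_iff {ψ ψ' : NontrivialAddChar F} {ε m : ℕ} {η : 𝒪[F]ˣ →* ℂˣ}
    (hm : unitCond η ≤ m) {φ : SchwartzBruhat F} :
    φ ∈ isotypic ψ ψ' ε m η ↔ φ ∈ evenPart F ∧
      ∀ g ∈ congruenceGroup F ε m, weil ψ' (lift ψ g) φ = evalUnit η (g 1 1) • φ := by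
  rw [isotypic, if_pos hm]
  simp [Submodule.mem_inf, Submodule.mem_iInf, LinearMap.mem_ker, sub_eq_zero]

theorem sgn_leg_eq {χ : Fˣ →* ℂˣ} {a : Fˣ} (h : IsHilbertChar χ a) {ε : ℕ}
    {ψ : NontrivialAddChar F} (hψ : ψ.cond = -(ε : ℤ)) (u : 𝒪[F]ˣ) :
    sgn (leg ((u : 𝒪[F]) : F) ^ (ψ.cond + (ψ.twist a).cond)) = resUnits χ u := by
  rw [resUnits_eq_leg h, ← sgn_apply, NontrivialAddChar.cond_twist, hψ]
  congr 1
  exact units_zpow_congr _ (l := -ε - ord (a : F)) (by ring)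

theorem isotypic_le_homogeneous {χ : Fˣ →* ℂˣ} {a : Fˣ} (h : IsHilbertChar χ a) {ε m : ℕ}
    {ψ : NontrivialAddChar F} (hψ : ψ.cond = -(ε : ℤ)) {η : 𝒪[F]ˣ →* ℂˣ} (hm : unitCond η ≤ m) :
    isotypic ψ (ψ.twist a) ε m η ≤ homogeneous (-(ord (a : F) / 2)) ((m - ord (a : F)) / 2)
      (η * resUnits χ)⁻¹ := by
  intro φ hφ
  rw [mem_isotypic_iff hm] at hφ
  obtain ⟨-, hφ⟩ := hφ
  set ψ' := ψ.twist a with hψ'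
  have hκ : ψ'.cond = -(ε : ℤ) - ord (a : F) := by rw [hψ', NontrivialAddChar.cond_twist, hψ]
  have hη1 : evalUnit η (1 : F) = 1 := by
    have := evalUnit_coe η 1
    simpa using this
  obtain ⟨l₀, hl₀⟩ := exists_invariant_primePow φ
  refine ⟨fun y hy => ?_, fun z hz x => ?_, fun u y => ?_⟩
  · by_contra hne
    have hy0 : y ≠ 0 := by rintro rfl; exact hy (zero_mem_primePow _)
    have h1 : ∀ b ∈ primePow F (-(ε : ℤ)), ψ' (y ^ 2 * b) = 1 := by
      intro b hb
      have e11 : n b 1 1 = 1 := by simp [n]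
      have e01 : n b 0 1 = b := by simp [n]
      have e10 : n b 1 0 = 0 := by simp [n]
      have hg : n b ∈ congruenceGroup F ε m := by
        refine ⟨?_, ?_, by rwa [e01], by rw [e10]; exact zero_mem_primePow _⟩
        · simp [n]
        · simp [n]
      have h2 := weil_lift_apply ψ ψ' (g := n b) (by rw [e11, norm_one]) φ hl₀
        (by rw [e10]; exact zero_mem_primePow _) y
      rw [hφ _ hg, e11, e01, hη1, one_smul, leg_one, one_zpow, map_one, one_mul, div_one, div_one]
        at h2
      have h3 : ((ψ' (b * y ^ 2) : Circle) : ℂ) = 1 := by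
        apply mul_right_cancel₀ hne
        rw [← h2, one_mul]
      rw [mul_comm]
      exact Circle.ext (by simpa using h3)
    rw [NontrivialAddChar.forall_mul_eq_one_iff, mem_primePow_iff (pow_ne_zero 2 hy0), ord_pow hy0,
      hκ] at h1
    rw [mem_primePow_iff hy0] at hy
    push_cast at h1
    omega
  · refine invariant_of_fourier ψ' φ (k := ψ'.cond - (m - ord (a : F)) / 2) (fun ξ hξ => ?_)
      (by simpa using hz) x
    by_contra hne
    have hξ0 : ξ ≠ 0 := by rintro rfl; exact hξ (zero_mem_primePow _)
    have h1 : ∀ c ∈ primePow F ((m : ℤ) + ε), ψ' (-ξ ^ 2 * c) = 1 := by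
      intro c hc
      by_cases hc0 : c = 0
      · rw [hc0, mul_zero]; exact AddChar.map_zero_eq_one _
      have e11 : nop c 1 1 = 1 := by simp [nop]
      have e01 : nop c 0 1 = 0 := by simp [nop]
      have e10 : nop c 1 0 = c := by simp [nop]
      have hg : nop c ∈ congruenceGroup F ε m := by
        refine ⟨?_, ?_, by rw [e01]; exact zero_mem_primePow _, by rwa [e10]⟩
        · simp [nop]
        · simp [nop]
      have h2 := hφ _ hg
      rw [e11, hη1, one_smul] at h2
      have h3 := fourier_of_nop_invariant ψ ψ' hc0 h2 ξ
      have h4 : ((ψ' (-(c * ξ ^ 2)) : Circle) : ℂ) = 1 := by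
        apply mul_right_cancel₀ hne
        rw [← h3, one_mul]
      have e : -ξ ^ 2 * c = -(c * ξ ^ 2) := by ring
      rw [e]
      exact Circle.ext (by simpa using h4)
    rw [NontrivialAddChar.forall_mul_eq_one_iff,
      mem_primePow_iff (neg_ne_zero.mpr (pow_ne_zero 2 hξ0)), ord_neg, ord_pow hξ0, hκ] at h1
    rw [mem_primePow_iff hξ0, hκ] at hξ
    push_cast at h1
    omega
  · set v : Fˣ := Units.map (𝒪[F].subtype : 𝒪[F] →* F) u
    have hv : (v : F) = ((u : 𝒪[F]) : F) := rfl
    have hvi : (v : F)⁻¹ = (((u⁻¹ : 𝒪[F]ˣ) : 𝒪[F]) : F) := by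
      rw [hv]
      apply inv_eq_of_mul_eq_one_right
      rw [← Subring.coe_mul, Units.mul_inv, Subring.coe_one]
    have e11 : t v 1 1 = (v : F)⁻¹ := by simp [t]
    have e01 : t v 0 1 = 0 := by simp [t]
    have e10 : t v 1 0 = 0 := by simp [t]
    have hg : t v ∈ congruenceGroup F ε m := by
      refine ⟨?_, ?_, by rw [e01]; exact zero_mem_primePow _, by rw [e10]; exact zero_mem_primePow _⟩
      · have e00 : t v 0 0 = ((u : 𝒪[F]) : F) := by simp [t, hv]
        rw [e00]; exact (u : 𝒪[F]).2
      · rw [e11, hvi]; exact ((u⁻¹ : 𝒪[F]ˣ) : 𝒪[F]).2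
    have h2 := weil_lift_apply ψ ψ' (g := t v)
      (by rw [e11, hvi, Valued.integer.norm_coe_unit]) φ hl₀
      (by rw [e10]; exact zero_mem_primePow _) y
    have h0 : ψ' 0 = 1 := AddChar.map_zero_eq_one _
    rw [hφ _ hg, e11, e01, div_inv_eq_mul, zero_mul, zero_mul, h0, Circle.coe_one, mul_one, leg_inv,
      div_inv_eq_mul, hvi, evalUnit_coe, hv, sgn_leg_eq h hψ, map_inv, Units.val_inv_eq_inv_val] at h2
    change ((η u : ℂˣ) : ℂ)⁻¹ * φ.1 y = _ at h2
    have hχ : ((resUnits χ u : ℂˣ) : ℂ) ≠ 0 := Units.ne_zero _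
    rw [MonoidHom.inv_apply, MonoidHom.mul_apply, Units.val_inv_eq_inv_val, Units.val_mul, mul_inv,
      mul_comm _⁻¹, mul_assoc, h2, inv_mul_cancel_left₀ hχ, mul_comm y]

theorem homogeneous_le_isotypic {χ : Fˣ →* ℂˣ} (hχ : χ ^ 2 = 1) {a : Fˣ} (h : IsHilbertChar χ a)
    {ε m : ℕ} {ψ : NontrivialAddChar F} (hψ : ψ.cond = -(ε : ℤ)) {η : 𝒪[F]ˣ →* ℂˣ}
    (hη1 : η (-1) = χ (-1)) (hm : unitCond η ≤ m) :
    homogeneous (-(ord (a : F) / 2)) ((m - ord (a : F)) / 2) (η * resUnits χ)⁻¹ ≤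
      isotypic ψ (ψ.twist a) ε m η := by
  intro φ hφ
  rw [mem_isotypic_iff hm]
  set ψ' := ψ.twist a with hψ'
  have hκ : ψ'.cond = -(ε : ℤ) - ord (a : F) := by rw [hψ', NontrivialAddChar.cond_twist, hψ]
  set θ := (η * resUnits χ)⁻¹ with hθ
  refine ⟨fun y => ?_, fun g hg => ?_⟩
  · have h1 := hφ.2.2 (-1) y
    have h2 : resUnits χ (-1) = χ (-1) := by
      rw [resUnits, MonoidHom.comp_apply]
      congr 1
    have h3 : θ (-1) = 1 := by
      rw [hθ, MonoidHom.inv_apply, MonoidHom.mul_apply, h2, hη1, ← pow_two]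
      have : χ (-1) ^ 2 = 1 := DFunLike.congr_fun hχ _
      rw [this, inv_one]
    rw [h3] at h1
    simpa using h1
  obtain ⟨ha, hd, hb, hc⟩ := hg
  have hdet := det_eq_one g
  rw [Valued.integer.mem_iff] at ha hd
  by_cases hd1 : ‖g 1 1‖ = 1
  · obtain ⟨u, hu⟩ := exists_unit_eq hd1
    ext y
    change _ = evalUnit η (g 1 1) * φ.1 y
    rw [weil_lift_apply ψ ψ' hd1 φ hφ.2.1 (primePow_anti (by rw [hκ]; omega) hc) y]
    rw [← hu, evalUnit_coe, sgn_leg_eq h hψ]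
    have hdiv : φ.1 (y / ((u : 𝒪[F]) : F)) = (η u : ℂ) * (resUnits χ u : ℂ) * φ.1 y := by
      have h1 := hφ.2.2 u (y / ((u : 𝒪[F]) : F))
      rw [mul_div_cancel₀ _ (coe_unit_ne_zero u), hθ, MonoidHom.inv_apply, MonoidHom.mul_apply,
        Units.val_inv_eq_inv_val, Units.val_mul] at h1
      rw [h1, mul_inv_cancel_left₀ (mul_ne_zero (Units.ne_zero _) (Units.ne_zero _))]
    have hχu : ((resUnits χ u : ℂˣ) : ℂ) * (resUnits χ u : ℂˣ) = 1 := by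
      rw [resUnits_eq_leg h, ← sgn_apply, sgn_mul_self]
    rw [hdiv]
    by_cases hy : y ∈ primePow F (-(ord (a : F) / 2))
    · rw [ψ'.apply_eq_one, Circle.coe_one]
      · linear_combination (η u : ℂ) * φ.1 y * hχu
      · have hdinv : (((u : 𝒪[F]) : F))⁻¹ ∈ primePow F 0 := by
          rw [mem_primePow_zero, norm_inv, Valued.integer.norm_coe_unit, inv_one]
        rw [div_eq_mul_inv, pow_two, hκ]
        exact mul_mem_primePow (mul_mem_primePow hb hdinv le_rfl) (mul_mem_primePow hy hy le_rfl)
          (by omega)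
    · rw [hφ.1 y hy]; ring
  · have hdlt : g 1 1 ∈ primePow F 1 := mem_primePow_one.mpr (lt_of_le_of_ne hd hd1)
    have had : g 0 0 * g 1 1 ∈ primePow F 1 :=
      mul_mem_primePow (mem_primePow_zero.mpr ha) hdlt (by norm_num)
    have hbc : ‖g 0 1 * g 1 0‖ = 1 := by
      have h1 : g 0 1 * g 1 0 = -1 + g 0 0 * g 1 1 := by linear_combination -hdet
      have h2 := mem_primePow_one.mp had
      rw [h1, IsUltrametricDist.norm_add_eq_max_of_norm_ne_norm (by simpa using h2.ne'), norm_neg,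
        norm_one, max_eq_left h2.le]
    have hbc0 : g 0 1 * g 1 0 ≠ 0 := norm_ne_zero_iff.mp (by rw [hbc]; exact one_ne_zero)
    have hb0 := left_ne_zero_of_mul hbc0
    have hc0 := right_ne_zero_of_mul hbc0
    have hord := ord_eq_zero_of_norm hbc
    rw [ord_mul hb0 hc0] at hord
    rw [mem_primePow_iff hb0] at hb
    rw [mem_primePow_iff hc0] at hc
    have hm0 : m = 0 := by omega
    have hoc : ord (g 1 0) = ε := by omega
    have hsign : (lift ψ g).sign = 1 := dif_neg hd1
    rw [evalUnit_of_norm_ne_one η hd1, one_smul]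
    rw [hm0, Nat.cast_zero, zero_sub] at hφ
    ext y
    rcases Int.even_or_odd' (ord (a : F)) with ⟨e, he | he⟩
    swap
    · have hz : φ = 0 := by
        ext z
        exact eq_zero_of_homogeneous hφ (by omega) z
      rw [hz, map_zero]
    have hn₀ : -(ord (a : F) / 2) = -e := by omega
    have hn₁ : -ord (a : F) / 2 = -e := by omega
    rw [hn₀, hn₁] at hφ
    rw [weil_apply_of_ne ψ' (lift ψ g) hc0, hsign, map_one, one_mul]
    set ψc : NontrivialAddChar F := ψ'.twist (Units.mk0 (g 1 0) hc0)⁻¹ with hψc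
    change (((q F : ℝ) ^ ((ψc.cond : ℝ) / 2) : ℝ) : ℂ) * (weilIndex ψc)⁻¹ * ∫ z, φ.1 z *
      ((ψc (g 0 0 * y ^ 2 - 2 * z * y + g 1 1 * z ^ 2) : Circle) : ℂ) ∂haar F = φ.1 y
    have hcond : ψc.cond = 2 * (-e) := by
      rw [hψc, NontrivialAddChar.cond_twist, Units.val_inv_eq_inv_val, Units.val_mk0, ord_inv hc0,
        hκ]
      rw [hoc, he]
      ring
    have hw : weilIndex ψc = 1 := ψc.weilIndex_of_even hcond
    have hφ0 : ∀ z ∈ primePow F (-e), φ.1 z = φ.1 0 := fun z hz => by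
      simpa using hφ.2.1 z hz 0
    rw [hw, inv_one, mul_one, integral_eq_setIntegral (j := -e) fun z hz => by
      rw [hφ.1 z hz, zero_mul]]
    have hphase : ∀ z ∈ primePow F (-e),
        φ.1 z * ((ψc (g 0 0 * y ^ 2 - 2 * z * y + g 1 1 * z ^ 2) : Circle) : ℂ) =
        φ.1 0 * ((ψc (g 0 0 * y ^ 2) : Circle) : ℂ) * ((ψc (-2 * y * z) : Circle) : ℂ) := by
      intro z hz
      have e1 : g 0 0 * y ^ 2 - 2 * z * y + g 1 1 * z ^ 2 =
          g 1 1 * (z * z) + g 0 0 * y ^ 2 + -2 * y * z := by ring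
      rw [hφ0 z hz, e1, ψc.map_add, ψc.map_add, ψc.apply_eq_one
        (mul_mem_primePow hdlt (mul_mem_primePow hz hz le_rfl) (by omega)), one_mul, Circle.coe_mul]
      ring
    rw [setIntegral_congr_fun (measurableSet_primePow _) hphase, integral_const_mul]
    have hq : (q F : ℝ) ^ ((ψc.cond : ℝ) / 2) * (q F : ℝ) ^ (-(-e)) = 1 := by
      rw [hcond, ← Real.rpow_intCast, ← Real.rpow_add (q_pos F)]
      have : ((2 * -e : ℤ) : ℝ) / 2 + ((-(-e) : ℤ) : ℝ) = 0 := by push_cast; ring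
      rw [this, Real.rpow_zero]
    have h2y : -2 * y ∈ primePow F (ψc.cond - -e) ↔ y ∈ primePow F (-e) := by
      rw [mem_primePow_of_scale (neg_ne_zero.mpr two_ne_zero'), ord_neg, ord_two, hcond]
      ring_nf
    by_cases hy : y ∈ primePow F (-e)
    · rw [ψc.setIntegral_mul_eq (h2y.mpr hy), hφ0 y hy, pow_two, ψc.apply_eq_one
        (mul_mem_primePow (mem_primePow_zero.mpr ha) (mul_mem_primePow hy hy le_rfl) (by omega)),
        Circle.coe_one, mul_one, mul_comm (φ.1 0), ← mul_assoc, ← Complex.ofReal_mul, hq,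
        Complex.ofReal_one, one_mul]
    · rw [ψc.setIntegral_mul_eq_zero fun h' => hy (h2y.mp h'), mul_zero, mul_zero, hφ.1 y hy]

end Radial

/-! ### Dimensions -/

section Dimension

variable {F : Type*} [NontriviallyNormedField F] [IsUltrametricDist F] [ProperSpace F]
  [OddNormalized F]

theorem exists_unitPart {y : F} (hy : y ≠ 0) : ∃ u : 𝒪[F]ˣ, y = unif F ^ ord y * ((u : 𝒪[F]) : F) := by
  have hk : unif F ^ ord y ≠ 0 := zpow_ne_zero _ (unif_ne_zero F)
  obtain ⟨u, hu⟩ := exists_unit_eq (u := y / unif F ^ ord y) (norm_eq_one_of_ord (div_ne_zero hy hk)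
    (by rw [ord_div hy hk, ord_unif_zpow, sub_self]))
  exact ⟨u, by rw [hu, mul_div_cancel₀ _ hk]⟩

open Classical in
/-- The unit `y / ϖ ^ ord y` for `y ≠ 0`. -/
def unitPart (y : F) : 𝒪[F]ˣ := if h : y = 0 then 1 else (exists_unitPart h).choose

theorem eq_mul_unitPart {y : F} (hy : y ≠ 0) :
    y = unif F ^ ord y * ((unitPart y : 𝒪[F]) : F) := by
  rw [unitPart, dif_neg hy]; exact (exists_unitPart hy).choose_spec

theorem ord_coe_unit (u : 𝒪[F]ˣ) : ord ((u : 𝒪[F]) : F) = 0 :=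
  ord_eq_zero_of_norm (Valued.integer.norm_coe_unit u)

theorem ord_unit_mul (u : 𝒪[F]ˣ) {y : F} (hy : y ≠ 0) : ord (((u : 𝒪[F]) : F) * y) = ord y := by
  rw [ord_mul (coe_unit_ne_zero u) hy, ord_coe_unit, zero_add]

theorem unit_mul_mem_primePow_iff (u : 𝒪[F]ˣ) (y : F) (k : ℤ) :
    ((u : 𝒪[F]) : F) * y ∈ primePow F k ↔ y ∈ primePow F k := by
  rw [mem_primePow_of_scale (coe_unit_ne_zero u), ord_coe_unit, sub_zero]

theorem unitPart_eq_of_eq_mul {y : F} {k : ℤ} {u : 𝒪[F]ˣ}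
    (h : y = unif F ^ k * ((u : 𝒪[F]) : F)) : unitPart y = u := by
  have hk : unif F ^ k ≠ 0 := zpow_ne_zero _ (unif_ne_zero F)
  have hy : y ≠ 0 := by rw [h]; exact mul_ne_zero hk (coe_unit_ne_zero u)
  have ho : ord y = k := by
    rw [h, ord_mul hk (coe_unit_ne_zero u), ord_unif_zpow, ord_coe_unit, add_zero]
  have h1 := eq_mul_unitPart hy
  rw [ho] at h1
  have h2 := mul_left_cancel₀ hk (h1.symm.trans h)
  exact Units.ext (Subtype.ext h2)

theorem unitPart_unit_mul (u : 𝒪[F]ˣ) {y : F} (hy : y ≠ 0) :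
    unitPart (((u : 𝒪[F]) : F) * y) = u * unitPart y := by
  apply unitPart_eq_of_eq_mul (k := ord y)
  conv_lhs => rw [eq_mul_unitPart hy]
  rw [Units.val_mul, Subring.coe_mul]
  ring

theorem unitPart_unif_zpow (k : ℤ) : unitPart (unif F ^ k) = 1 :=
  unitPart_eq_of_eq_mul (k := k) (by simp)

theorem isLocallyConstant_of_invariant {f : F → ℂ} {k : ℤ}
    (h : ∀ z ∈ primePow F k, ∀ x, f (x + z) = f x) : IsLocallyConstant f := by
  rw [IsLocallyConstant.iff_eventually_eq]
  intro x
  have : ∀ᶠ y in 𝓝 x, y - x ∈ primePow F k :=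
    (continuous_id.sub continuous_const).continuousAt.eventually_mem
      ((isOpen_primePow k).mem_nhds (by simpa using zero_mem_primePow k))
  filter_upwards [this] with y hy
  simpa using h _ hy x

theorem mem_schwartzBruhat {f : F → ℂ} {j k : ℤ} (hj : ∀ y, y ∉ primePow F j → f y = 0)
    (h : ∀ z ∈ primePow F k, ∀ x, f (x + z) = f x) : f ∈ SchwartzBruhat F := by
  refine ⟨isLocallyConstant_of_invariant h,
    HasCompactSupport.of_support_subset_isCompact (isCompact_primePow j) fun y hy => ?_⟩
  by_contra hn
  exact hy (hj y hn)

theorem apply_eq_unitPart {n₀ n₁ : ℤ} {θ : 𝒪[F]ˣ →* ℂˣ} {φ : SchwartzBruhat F}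
    (hφ : φ ∈ homogeneous n₀ n₁ θ) {y : F} (hy : y ≠ 0) :
    φ.1 y = (θ (unitPart y) : ℂ) * φ.1 (unif F ^ ord y) := by
  rw [← hφ.2.2]
  conv_lhs => rw [eq_mul_unitPart hy]
  rw [mul_comm]

theorem unif_zpow_mem_primePow_iff {j k : ℤ} : unif F ^ j ∈ primePow F k ↔ k ≤ j := by
  rw [mem_primePow_iff (zpow_ne_zero _ (unif_ne_zero F)), ord_unif_zpow]

/-- Evaluation at the powers of the uniformizer. -/
def evalUnif (n₀ n₁ : ℤ) (θ : 𝒪[F]ˣ →* ℂˣ) (r : ℕ) : homogeneous n₀ n₁ θ →ₗ[ℂ] (Fin r → ℂ) where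
  toFun φ i := φ.1.1 (unif F ^ (n₀ + i))
  map_add' _ _ := rfl
  map_smul' _ _ := rfl

theorem evalUnif_injective (n₀ n₁ : ℤ) {θ : 𝒪[F]ˣ →* ℂˣ} (hθ : Continuous θ) :
    Function.Injective (evalUnif n₀ n₁ θ (n₁ - n₀ - unitCond θ + 1).toNat) := by
  refine (injective_iff_map_eq_zero _).mpr ?_
  rintro ⟨φ, hφ⟩ h0
  have hz : ∀ k : ℤ, n₀ ≤ k → k ≤ n₁ - unitCond θ → φ.1 (unif F ^ k) = 0 := by
    intro k h1 h2
    have h3 := congrFun h0 ⟨(k - n₀).toNat, by omega⟩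
    have h4 : n₀ + ((k - n₀).toNat : ℤ) = k := by omega
    change φ.1 (unif F ^ (n₀ + ((k - n₀).toNat : ℤ))) = 0 at h3
    rwa [h4] at h3
  have hinv : ∀ k : ℤ, n₁ ≤ k → φ.1 (unif F ^ k) = φ.1 0 := fun k hk => by
    simpa using hφ.2.1 (unif F ^ k) (unif_zpow_mem_primePow_iff.mpr hk) 0
  have hzero : φ.1 0 = 0 := by
    by_cases h1 : θ = 1
    · have hc := (unitCond_eq_zero_iff hθ).mpr h1
      rcases lt_or_ge n₁ n₀ with h | h
      · exact eq_zero_of_homogeneous hφ h 0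
      · rw [← hinv n₁ le_rfl]
        exact hz n₁ h (by omega)
    · obtain ⟨u, hu⟩ : ∃ u, θ u ≠ 1 := by
        by_contra hcon
        push Not at hcon
        exact h1 (MonoidHom.ext hcon)
      have h2 := hφ.2.2 u 0
      rw [mul_zero] at h2
      by_contra hne
      exact hu (Units.ext (mul_right_cancel₀ hne (h2.symm.trans (one_mul _).symm)))
  have hpow : ∀ k : ℤ, φ.1 (unif F ^ k) = 0 := by
    intro k
    rcases lt_or_ge k n₀ with h1 | h1
    · exact hφ.1 _ (by rw [unif_zpow_mem_primePow_iff]; omega)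
    rcases le_or_gt k (n₁ - unitCond θ) with h2 | h2
    · exact hz k h1 h2
    by_cases hc : unitCond θ = 0
    · rw [hinv k (by omega), hzero]
    · obtain ⟨u, hu, hne⟩ := exists_of_lt_unitCond (Nat.sub_one_lt hc)
      have h3 := hφ.2.2 u (unif F ^ k)
      have e : ((u : 𝒪[F]) : F) * unif F ^ k =
          unif F ^ k + unif F ^ k * (((u : 𝒪[F]) : F) - 1) := by ring
      rw [e, hφ.2.1 _ (mul_mem_primePow (unif_zpow_mem_primePow_iff.mpr le_rfl) hu (by omega))] at h3
      by_contra hne'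
      exact hne (Units.ext (mul_right_cancel₀ hne' (h3.symm.trans (one_mul _).symm)))
  ext y
  change φ.1 y = 0
  by_cases hy : y = 0
  · rw [hy, hzero]
  · rw [apply_eq_unitPart hφ hy, hpow, mul_zero]

theorem ord_add_of_mem {x h : F} {k : ℤ} (hx : x ∉ primePow F k) (hh : h ∈ primePow F k) :
    x + h ≠ 0 ∧ ord (x + h) = ord x := by
  have hx0 : x ≠ 0 := by rintro rfl; exact hx (zero_mem_primePow k)
  have hlt : ‖h‖ < ‖x‖ := lt_of_le_of_lt hh (not_le.mp hx)
  have hn : ‖x + h‖ = ‖x‖ := by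
    rw [IsUltrametricDist.norm_add_eq_max_of_norm_ne_norm hlt.ne', max_eq_left hlt.le]
  exact ⟨norm_ne_zero_iff.mp (by rw [hn]; exact norm_ne_zero_iff.mpr hx0),
    ord_eq_of_norm (by rw [hn, norm_eq_ord hx0])⟩

theorem evalUnif_surjective (n₀ n₁ : ℤ) {θ : 𝒪[F]ˣ →* ℂˣ} (hθ : Continuous θ) :
    Function.Surjective (evalUnif n₀ n₁ θ (n₁ - n₀ - unitCond θ + 1).toNat) := by
  classical
  obtain ⟨r, hr⟩ : ∃ r, r = (n₁ - n₀ - unitCond θ + 1).toNat := ⟨_, rfl⟩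
  rw [← hr]
  intro f
  let v : ℤ → ℂ := fun k => if h : n₀ ≤ k ∧ (k - n₀).toNat < r then f ⟨_, h.2⟩ else 0
  have hv : ∀ k, k < n₀ → v k = 0 := fun k hk => dif_neg (by omega)
  have hvi : ∀ i : Fin r, v (n₀ + i) = f i := by
    intro i
    have h : n₀ ≤ n₀ + (i : ℤ) ∧ (n₀ + (i : ℤ) - n₀).toNat < r := ⟨by omega, by omega⟩
    simp only [v, dif_pos h]
    congr 1
    ext
    simp
  obtain ⟨N, z, hN, hNc, hz, hz0, hNi⟩ : ∃ (N : ℤ) (z : ℂ), N ≤ n₁ ∧ (unitCond θ : ℤ) ≤ n₁ - N + 1 ∧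
      (∀ u, (θ u : ℂ) * z = z) ∧ (N < n₀ → z = 0) ∧
      ∀ i : Fin r, N ≤ n₀ + i → z = f i := by
    by_cases h1 : θ = 1
    · have hc := (unitCond_eq_zero_iff hθ).mpr h1
      refine ⟨n₁, v n₁, le_rfl, by omega, fun u => by simp [h1], fun h => hv _ h, fun i hi => ?_⟩
      rw [← hvi i]
      congr 1
      have := i.2
      omega
    · have hc : unitCond θ ≠ 0 := fun h => h1 ((unitCond_eq_zero_iff hθ).mp h)
      refine ⟨n₁ - unitCond θ + 1, 0, by omega, by omega, fun u => mul_zero _, fun _ => rfl,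
        fun i hi => ?_⟩
      have := i.2
      omega
  let g : F → ℂ := fun y => if y ∈ primePow F N then z else (θ (unitPart y) : ℂ) * v (ord y)
  have hsupp : ∀ y, y ∉ primePow F n₀ → g y = 0 := by
    intro y hy
    have hy0 : y ≠ 0 := by rintro rfl; exact hy (zero_mem_primePow _)
    have hlt : ord y < n₀ := by rwa [mem_primePow_iff hy0, not_le] at hy
    by_cases hyN : y ∈ primePow F N
    · simp only [g, if_pos hyN]
      rw [mem_primePow_iff hy0] at hyN
      exact hz0 (by omega)
    · simp only [g, if_neg hyN, hv _ hlt, mul_zero]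
  have hinv : ∀ h ∈ primePow F n₁, ∀ y, g (y + h) = g y := by
    intro h hh y
    have hhN := primePow_anti hN hh
    by_cases hyN : y ∈ primePow F N
    · simp only [g, if_pos hyN, if_pos (add_mem_primePow hyN hhN)]
    · have hyhN : y + h ∉ primePow F N := fun h' => hyN (by simpa using sub_mem_primePow h' hhN)
      obtain ⟨hyh0, hord⟩ := ord_add_of_mem hyN hhN
      have hy0 : y ≠ 0 := by rintro rfl; exact hyN (zero_mem_primePow _)
      simp only [g, if_neg hyN, if_neg hyhN, hord]
      congr 2
      have hlt : ord y < N := by rwa [mem_primePow_iff hy0, not_le] at hyN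
      obtain ⟨u, hu⟩ := exists_unit_eq (u := (y + h) / y)
        (norm_eq_one_of_ord (div_ne_zero hyh0 hy0) (by rw [ord_div hyh0 hy0, hord, sub_self]))
      have hu1 : θ u = 1 := by
        apply unitCond_spec hθ
        have e : (y + h) / y - 1 = y⁻¹ * h := by field_simp; ring
        rw [hu, e, mem_primePow_of_scale (inv_ne_zero hy0), ord_inv hy0]
        exact primePow_anti (by omega) hh
      have e : y + h = ((u : 𝒪[F]) : F) * y := by rw [hu, div_mul_cancel₀ _ hy0]
      rw [e, unitPart_unit_mul u hy0, map_mul, hu1, one_mul]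
  refine ⟨⟨⟨g, mem_schwartzBruhat hsupp hinv⟩, hsupp, hinv, fun u y => ?_⟩, ?_⟩
  · change g _ = _ * g y
    by_cases hyN : y ∈ primePow F N
    · simp only [g, if_pos hyN, if_pos ((unit_mul_mem_primePow_iff u y N).mpr hyN), hz]
    · have hy0 : y ≠ 0 := by rintro rfl; exact hyN (zero_mem_primePow _)
      simp only [g, if_neg hyN, if_neg (mt (unit_mul_mem_primePow_iff u y N).mp hyN),
        ord_unit_mul u hy0, unitPart_unit_mul u hy0, map_mul, Units.val_mul, mul_assoc]
  · funext i
    change g (unif F ^ (n₀ + (i : ℤ))) = f i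
    by_cases hi : N ≤ n₀ + (i : ℤ)
    · simp only [g, if_pos (unif_zpow_mem_primePow_iff.mpr hi)]
      exact hNi i hi
    · simp only [g, if_neg (mt unif_zpow_mem_primePow_iff.mp hi), unitPart_unif_zpow, map_one,
        Units.val_one, one_mul, ord_unif_zpow, hvi]

/-- The dimension of a space of homogeneous functions. -/
theorem finrank_homogeneous (n₀ n₁ : ℤ) {θ : 𝒪[F]ˣ →* ℂˣ} (hθ : Continuous θ) :
    Module.Finite ℂ (homogeneous n₀ n₁ θ) ∧
      Module.finrank ℂ (homogeneous n₀ n₁ θ) = (n₁ - n₀ - unitCond θ + 1).toNat := by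
  let e := LinearEquiv.ofBijective _ ⟨evalUnif_injective n₀ n₁ hθ, evalUnif_surjective n₀ n₁ hθ⟩
  exact ⟨Module.Finite.equiv e.symm, by rw [e.finrank_eq, Module.finrank_fin_fun]⟩

theorem unitCond_inv (η : 𝒪[F]ˣ →* ℂˣ) : unitCond η⁻¹ = unitCond η := by
  simp only [unitCond, MonoidHom.inv_apply, inv_eq_one]

theorem floor_half (z : ℤ) : ⌊(z : ℚ) / 2⌋ = z / 2 := by
  have := Rat.floor_intCast_div_natCast z 2
  exact_mod_cast this

variable [MeasurableSpace F] [BorelSpace F] [CharZero F]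

theorem finrank_isotypic {χ : Fˣ →* ℂˣ} (hχ : χ ^ 2 = 1) {a : Fˣ} (h : IsHilbertChar χ a) {ε : ℕ}
    {ψ : NontrivialAddChar F} (hψ : ψ.cond = -(ε : ℤ)) {η : 𝒪[F]ˣ →* ℂˣ} (hη : Continuous η)
    (hη1 : η (-1) = χ (-1)) (m : ℕ) :
    Module.Finite ℂ (isotypic ψ (ψ.twist a) ε m η) ∧
      (Module.finrank ℂ (isotypic ψ (ψ.twist a) ε m η) : ℤ) =
        max 0 (((m : ℤ) - 2 * unitCond (η * resUnits χ) - unitCond (resUnits χ)) / 2 + 1) := by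
  have hle := unitCond_le_of_mul h hη
  by_cases hm : unitCond η ≤ m
  · rw [le_antisymm (isotypic_le_homogeneous h hψ hm)
      (homogeneous_le_isotypic hχ h hψ hη1 hm)]
    have hc : Continuous ((η * resUnits χ)⁻¹ : 𝒪[F]ˣ →* ℂˣ) := (hη.mul (continuous_resUnits h)).inv
    obtain ⟨h1, h2⟩ := finrank_homogeneous (-(ord (a : F) / 2)) ((m - ord (a : F)) / 2) hc
    refine ⟨h1, ?_⟩
    rw [h2, unitCond_inv, unitCond_resUnits h]
    omega
  · rw [isotypic, if_neg hm]
    refine ⟨inferInstance, ?_⟩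
    rw [finrank_bot]
    omega

theorem isotypic_ne_bot_iff {χ : Fˣ →* ℂˣ} (hχ : χ ^ 2 = 1) {a : Fˣ} (h : IsHilbertChar χ a) {ε : ℕ}
    {ψ : NontrivialAddChar F} (hψ : ψ.cond = -(ε : ℤ)) {η : 𝒪[F]ˣ →* ℂˣ} (hη : Continuous η)
    (hη1 : η (-1) = χ (-1)) (m : ℕ) :
    isotypic ψ (ψ.twist a) ε m η ≠ ⊥ ↔
      2 * unitCond (η * resUnits χ) + unitCond (resUnits χ) ≤ m := by
  obtain ⟨h1, h2⟩ := finrank_isotypic hχ h hψ hη hη1 m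
  rw [Ne, ← Submodule.finrank_eq_zero (R := ℂ)]
  omega

theorem etaCond_eq {χ : Fˣ →* ℂˣ} (hχ : χ ^ 2 = 1) {a : Fˣ} (h : IsHilbertChar χ a) {ε : ℕ}
    {ψ : NontrivialAddChar F} (hψ : ψ.cond = -(ε : ℤ)) {η : 𝒪[F]ˣ →* ℂˣ} (hη : Continuous η)
    (hη1 : η (-1) = χ (-1)) :
    etaCond ψ (ψ.twist a) ε η =
      ((2 * unitCond (η * resUnits χ) + unitCond (resUnits χ) : ℕ) : ℕ∞) := by
  apply le_antisymm
  · exact sInf_le ⟨_, rfl, (isotypic_ne_bot_iff hχ h hψ hη hη1 _).mpr le_rfl⟩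
  · refine le_sInf ?_
    rintro _ ⟨m, rfl, hm⟩
    exact_mod_cast (isotypic_ne_bot_iff hχ h hψ hη hη1 m).mp hm

theorem resUnits_neg_one (χ : Fˣ →* ℂˣ) : resUnits (F := F) χ (-1) = χ (-1) := by
  rw [resUnits, MonoidHom.comp_apply]
  congr 1

theorem weil_neg_one {χ : Fˣ →* ℂˣ} {a : Fˣ} (h : IsHilbertChar χ a) {ε : ℕ}
    {ψ : NontrivialAddChar F} (hψ : ψ.cond = -(ε : ℤ)) {φ : SchwartzBruhat F} (hφ : φ ∈ evenPart F) :
    weil (ψ.twist a) ⟨-1, signOf (relWeilIndex (-1) ψ)⟩ φ = (χ (-1) : ℂ) • φ := by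
  have e11 : (-1 : SL(2, F)) 1 1 = -1 := by simp
  have e01 : (-1 : SL(2, F)) 0 1 = 0 := by simp
  have e10 : (-1 : SL(2, F)) 1 0 = 0 := by simp
  have hl : (⟨-1, signOf (relWeilIndex (-1) ψ)⟩ : Metaplectic F) = lift ψ (-1) := by
    refine Metaplectic.ext rfl ?_
    change _ = splitSign ψ (-1)
    rw [splitSign_of_unit ψ (by rw [e11]; simp), if_pos e10, e11, one_mul,
      ψ.relWeilIndex_unit (by simp), signOf_sgn]
    simp
  obtain ⟨l₀, hl₀⟩ := exists_invariant_primePow φ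
  ext y
  have h1 := weil_lift_apply ψ (ψ.twist a) (g := -1) (by rw [e11]; simp) φ hl₀
    (by rw [e10]; exact zero_mem_primePow _) y
  have h2 := sgn_leg_eq h hψ (-1)
  have h3 : (((-1 : 𝒪[F]ˣ) : 𝒪[F]) : F) = -1 := by simp
  have h0 : ψ.twist a 0 = 1 := AddChar.map_zero_eq_one _
  rw [h3, resUnits_neg_one] at h2
  rw [hl, h1, e11, e01, h2, zero_div, zero_mul, h0, Circle.coe_one, mul_one, div_neg, div_one, hφ y]
  rfl

theorem isCentralSign_iff {χ : Fˣ →* ℂˣ} (hχ : χ ^ 2 = 1) {a : Fˣ} (h : IsHilbertChar χ a) {ε : ℕ}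
    {ψ : NontrivialAddChar F} (hψ : ψ.cond = -(ε : ℤ)) (η : 𝒪[F]ˣ →* ℂˣ) :
    IsCentralSign ψ (ψ.twist a) (η (-1) : ℂ) ↔ η (-1) = χ (-1) := by
  constructor
  · intro hz
    have hne := (isotypic_ne_bot_iff hχ h hψ (continuous_resUnits h) (resUnits_neg_one χ) _).mpr le_rfl
    obtain ⟨φ, hφ, hφ0⟩ := Submodule.exists_mem_ne_zero_of_ne_bot hne
    have hev : φ ∈ evenPart F := by
      rw [isotypic] at hφ
      split_ifs at hφ
      · exact hφ.1
      · exact absurd ((Submodule.mem_bot ℂ).mp hφ) hφ0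
    have h1 := hz φ hev
    rw [weil_neg_one h hψ hev] at h1
    exact (Units.ext (smul_left_injective ℂ hφ0 h1)).symm
  · intro he φ hφ
    rw [he]
    exact weil_neg_one h hψ hφ

theorem minCond_eq {χ : Fˣ →* ℂˣ} (hχ : χ ^ 2 = 1) {a : Fˣ} (h : IsHilbertChar χ a) {ε : ℕ}
    {ψ : NontrivialAddChar F} (hψ : ψ.cond = -(ε : ℤ)) :
    minCond ψ (ψ.twist a) ε = (unitCond (resUnits χ) : ℕ∞) := by
  have hc := continuous_resUnits h
  apply le_antisymm
  · refine sInf_le ⟨resUnits χ, hc, (isCentralSign_iff hχ h hψ _).mpr (resUnits_neg_one χ), ?_⟩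
    rw [etaCond_eq hχ h hψ hc (resUnits_neg_one χ), (unitCond_eq_zero_iff (hc.mul hc)).mpr
      ((mul_resUnits_eq_one_iff hχ _).mpr rfl), mul_zero, zero_add]
  · refine le_sInf ?_
    rintro _ ⟨η, hη, hz, rfl⟩
    rw [etaCond_eq hχ h hψ hη ((isCentralSign_iff hχ h hψ η).mp hz)]
    exact_mod_cast Nat.le_add_left _ _

end Dimension

end

end Mp

theorem mainTheorem3 {F : Type*} [NontriviallyNormedField F] [IsUltrametricDist F] [ProperSpace F]
    [CharZero F] [MeasurableSpace F] [BorelSpace F]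
    (hnorm : ∀ ϖ : 𝒪[F], Irreducible ϖ → ‖(ϖ : F)‖ = (Mp.q F : ℝ)⁻¹)
    (hodd : ringChar 𝓀[F] ≠ 2)
    (ε : ℕ) (hε : ε = 0 ∨ ε = 1)
    (ψ : Mp.NontrivialAddChar F) (hψ : ψ.cond = -(ε : ℤ))
    (χ : Fˣ →* ℂˣ) (hχ : χ ^ 2 = 1) :
    (∃ a : Fˣ, Mp.IsHilbertChar χ a) ∧
    ∀ a : Fˣ, Mp.IsHilbertChar χ a →
      Mp.minCond ψ (ψ.twist a) ε = (Mp.unitCond (Mp.resUnits χ) : ℕ∞) ∧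
      ∀ η : 𝒪[F]ˣ →* ℂˣ, Continuous η → η (-1) = χ (-1) →
        Mp.etaCond ψ (ψ.twist a) ε η =
          ((2 * Mp.unitCond (η * Mp.resUnits χ) + Mp.unitCond (Mp.resUnits χ) : ℕ) : ℕ∞) ∧
        (∀ m : ℕ, Module.Finite ℂ (Mp.isotypic ψ (ψ.twist a) ε m η) ∧
          (Module.finrank ℂ (Mp.isotypic ψ (ψ.twist a) ε m η) : ℤ) =
            max 0 (⌊((m : ℚ) - 2 * Mp.unitCond (η * Mp.resUnits χ) -
              Mp.unitCond (Mp.resUnits χ)) / 2⌋ + 1)) ∧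
        (Mp.minCond ψ (ψ.twist a) ε = Mp.etaCond ψ (ψ.twist a) ε η ↔ η = Mp.resUnits χ) := by
  have : Mp.OddNormalized F := ⟨hnorm, hodd⟩
  refine ⟨Mp.exists_isHilbertChar hχ, fun a h => ⟨Mp.minCond_eq hχ h hψ, fun η hη hη1 => ?_⟩⟩
  have heta := Mp.etaCond_eq hχ h hψ hη hη1
  refine ⟨heta, fun m => ?_, ?_⟩
  · obtain ⟨h1, h2⟩ := Mp.finrank_isotypic hχ h hψ hη hη1 m
    refine ⟨h1, h2.trans ?_⟩
    rw [← Mp.floor_half]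
    push_cast
    rfl
  · rw [heta, Mp.minCond_eq hχ h hψ, ← Mp.mul_resUnits_eq_one_iff hχ,
      ← Mp.unitCond_eq_zero_iff (hη.mul (Mp.continuous_resUnits h)), Nat.cast_inj]
    omega
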